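/- Let $\xi$ be a random variable with values in $\{0,1,2,\dots\}$ such that $\mathbb E\,\xi=1$, $\operatorname{Var}\xi>0$ and $\mathbb E\,\xi^{2+\delta}<\infty$ for some $\delta>0$. Let $\mathcal T$ be the Galton--Watson tree with offspring distribution $\mathcal L(\xi)$, regarded as a finite rooted ordered (plane) tree. Let $|T|$ denote the number of nodes of a tree $T$, and, for each $n$ with $\mathbb P(|\mathcal T|=n)>0$, let $\mathcal T_n$ be $\mathcal T$ conditioned on $|\mathcal T|=n$. For a real-valued functional $f$ defined on all finite rooted ordered trees, put \[ F(T)=\sum_{v\in T} f(T_v),\qquad f_k(T)=f(T)\,\mathbf 1\{|T|=k\},\qquad \mu_k=\mathbb E f(\mathcal T_k)=\mathbb E f_k(\mathcal T_k), \] where $T_v$ is the fringe subtree of $T$ consisting of the node $v$ and all its descendants. Then there is a constant $C<\infty$, which may depend on $\delta$ and the distribution of $\xi$ but not on $f$ or $n$, such that for every such functional $f$ and every $n$ with $\mathbb P(|\mathcal T|=n)>0$, \[ \bigl(\operatorname{Var}F(\mathcal T_n)\bigr)^{1/2}\le C\,n^{1/2}\Bigl(\sup_k\bigl(\mathbb E\,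 [f_k(\mathcal T_k)^2]\bigr)^{1/2}+\sum_k\frac{(\operatorname{Var}f_k(\mathcal T_k))^{1/2}}{k}+\Bigl(\sum_k\frac{\mu_k^2}{k}\Bigr)^{1/2}\Bigr), \] where the supremum and the sums are over all $k\ge1$ with $\mathbb P(|\mathcal T|=k)>0$, and the right-hand side may be $+\infty$. -/

import Mathlib

open MeasureTheory ProbabilityTheory
open scoped ENNReal NNReal

/-- Finite rooted ordered (plane) trees: a root together with the ordered list of its branches. -/
inductive PlaneTree : Type where
  | node : List PlaneTree → PlaneTree

namespace PlaneTree

/-- The order `|T|`, i.e. the number of nodes of `T`. -/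
def size : PlaneTree → ℕ
  | node ts => 1 + (ts.map size).sum

/-- The list of all fringe subtrees `T_v`, one entry for every node `v` of `T`, with the nodes
taken in depth-first order. -/
def fringe : PlaneTree → List PlaneTree
  | node ts => node ts :: ts.flatMap fringe

/-- The additive functional `F(T) = F(T; f) = ∑_{v ∈ T} f(T_v)` with toll function `f`. -/
def additive (f : PlaneTree → ℝ) (T : PlaneTree) : ℝ :=
  (T.fringe.map f).sum

/-- The restriction `f_k(T) = f(T) · 1{|T| = k}` of `f` to the trees of order `k`. -/
def restrict (f : PlaneTree → ℝ) (k : ℕ) (T : PlaneTree) : ℝ :=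
  if T.size = k then f T else 0

/-- Every set of trees is an event. -/
instance : MeasurableSpace PlaneTree := ⊤

/-- The probability that the Galton-Watson tree with offspring distribution `p` equals a given
finite tree: the root has `d` children with probability `p d`, and given this the `d` branches are
independent copies of the whole tree. -/
noncomputable def gwProb (p : PMF ℕ) : PlaneTree → ℝ≥0∞
  | node ts => p ts.length * (ts.map (gwProb p)).prod

end PlaneTree

/-- The law, on finite plane trees, of the Galton-Watson tree with offspring distribution `p`. -/
noncomputable def gwLaw (p : PMF ℕ) : Measure PlaneTree :=
  Measure.sum fun T => PlaneTree.gwProb p T • Measure.dirac T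

/-- The orders `k` that the Galton-Watson tree has with positive probability. -/
def gwSizes (p : PMF ℕ) : Set ℕ :=
  {k | gwLaw p {T | T.size = k} ≠ 0}

/-- The law of the conditioned Galton-Watson tree of order `n` (meant for `n ∈ gwSizes p`). -/
noncomputable def condGWLaw (p : PMF ℕ) (n : ℕ) : Measure PlaneTree :=
  ProbabilityTheory.cond (gwLaw p) {T | T.size = n}

namespace PlaneTree

/-! ### Finite sets of forests and trees of given order -/

/-! The proof expands second moments exactly and then estimates random-walk probabilities. Write
`p_k` for P(|𝒯| = k), `S_j` for a sum of `j` independent offspring variables, `a_j = P(S_j = j)` and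
`c_j = P(S_j = j + 1)`. A tree of order `n` with a marked fringe subtree of order `k` is that
subtree grafted onto a tree with one hole and `n - k` other nodes; such holed trees have total
weight `a_{n-k}`. Two disjoint fringe subtrees of orders `k`, `m` leave a tree with an ordered pair
of holes, of total weight `(j + 1) c_j` with `j = n - k - m`. Nested pairs are charged to the upper
node (`nested`). This gives `treeSum_additive` and `treeSum_additive_mul`; both come from exploring
a forest root by root, with the hitting time theorem as input.

Decompose `f(T) = g(T) + μ_{|T|}`, so that `g` has conditional mean zero at every order. For `g` the
disjoint pairs cancel, and Cauchy-Schwarz on the nested pairs bounds the second moment `V_n` of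
`F(𝒯_n; g)` by a sum involving `√V_k`, `k ≤ n`. Taking the maximum of `√(V_k / k)` closes this
inequality and yields the supremum term and the sum of standard deviations
(`WalkBounds.sqrt_condMean_additive_le`).

For the toll `μ_{|T|}`, orders `k > n/4` are handled by a crude second moment bound. For `k, m ≤
n/4` the variance is a quadratic form in `μ` whose coefficients need two cancellations. First, `n
c_{n-k-m}` nearly equals `a_{n-k} a_{n-m} / p_n`: on the Fourier side the first-order terms drop out
(`CharBounds.exists_product_estimate`). Second, for `m < k` the nested contribution `p_m a_{k-m}
a_{n-k}` nearly equals `k p_k p_m a_{n-k}`, and this is offset by the part `-k c_{n-k-m}` of the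
disjoint contribution, since there are only `n - k - m + 1` places instead of `n`. What remains,
after division by `n p_n` of order `n^{-1/2}`, is a kernel with two parts. One has a bounded double
sum and is paid for by `sup |μ_k|`. The other, `hardyKernel`, has a logarithmically divergent double
sum but is bounded on sequences with `∑ μ_k² / k` finite, by a Hardy-type inequality; this is the
source of the last term of the theorem.

The extra moment `2 + δ` makes the error in `a_{k-m} ≈ k p_k` of order `k^{-1-η/2}` for bounded `m`,
which is summable; the routine bound `1/k` would lose a logarithm. This comes from comparing the
characteristic function with a Gaussian, for which the first-order term is odd and integrates to
zero (`CharBounds.exists_twist_sub_one_estimate`). The estimates hold uniformly on the lattice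
generated by the offspring support. -/

lemma size_node (ts : List PlaneTree) : (node ts).size = 1 + (ts.map size).sum := by
  rw [size]

lemma size_pos (T : PlaneTree) : 0 < T.size := by
  cases T with
  | node ts => rw [size_node]; omega

lemma length_le_sum_size (l : List PlaneTree) : l.length ≤ (l.map size).sum := by
  induction l with
  | nil => simp
  | cons T l ih => have := size_pos T; simp; omega

open Classical in
/-- The forests with `n` nodes and `r` trees. -/
noncomputable def forests : ℕ → ℕ → Finset (List PlaneTree)
  | 0, 0 => {[]}
  | 0, _ + 1 => ∅
  | _ + 1, 0 => ∅
  | n + 1, r + 1 => (Finset.range (n + 1)).biUnion fun d =>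
      (forests n (r + d)).image fun l => node (l.take d) :: l.drop d

lemma mem_forests (n r : ℕ) (l : List PlaneTree) :
    l ∈ forests n r ↔ l.length = r ∧ (l.map size).sum = n := by
  induction n generalizing r l with
  | zero =>
    have h := length_le_sum_size l
    cases r with
    | zero =>
      rw [forests, Finset.mem_singleton]
      constructor
      · rintro rfl; simp
      · rintro ⟨h1, -⟩; exact List.length_eq_zero_iff.1 h1
    | succ r =>
      rw [forests]
      simp only [Finset.notMem_empty, false_iff]
      omega
  | succ n ih =>
    cases r with
    | zero =>
      rw [forests]
      simp only [Finset.notMem_empty, false_iff]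
      rintro ⟨h1, h2⟩
      rw [List.length_eq_zero_iff.1 h1] at h2
      simp at h2
    | succ r =>
      rw [forests]
      simp only [Finset.mem_biUnion, Finset.mem_range, Finset.mem_image, ih]
      constructor
      · rintro ⟨d, hd, l', ⟨h1, h2⟩, rfl⟩
        have h3 : ((l'.take d).map size).sum + ((l'.drop d).map size).sum = n := by
          rw [← List.sum_append, ← List.map_append, List.take_append_drop, h2]
        refine ⟨by simp [h1], ?_⟩
        rw [List.map_cons, List.sum_cons, size_node]
        omega
      · rintro ⟨h1, h2⟩
        match l, h1, h2 with
        | node ts :: l', h1, h2 =>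
          rw [List.map_cons, List.sum_cons, size_node] at h2
          have := length_le_sum_size ts
          refine ⟨ts.length, by omega, ts ++ l', ⟨?_, ?_⟩, by simp⟩
          · simp at h1 ⊢; omega
          · simp; omega

/-- Depth-first exploration: deleting the first root and putting its `d` branches in front of the
other trees is a bijection onto a forest together with `d`. The number of trees changes along the
way, so the inductions must be about forests, not trees. -/
lemma sum_forests_succ {M : Type*} [AddCommMonoid M] (n r : ℕ) (φ : List PlaneTree → M) :
    ∑ l ∈ forests (n + 1) (r + 1), φ l = ∑ d ∈ Finset.range (n + 1), ∑ l ∈ forests n (r + d),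
      φ (node (l.take d) :: l.drop d) := by
  classical
  rw [forests, Finset.sum_biUnion]
  · refine Finset.sum_congr rfl fun d _ => ?_
    rw [Finset.sum_image]
    intro l _ l' _ h
    simp only [List.cons.injEq, node.injEq] at h
    rw [← List.take_append_drop d l, h.1, h.2, List.take_append_drop]
  · intro d hd d' hd' hne
    rw [Function.onFun, Finset.disjoint_left]
    intro l hl hl'
    simp only [Finset.mem_image, mem_forests] at hl hl'
    obtain ⟨a, ⟨ha, -⟩, rfl⟩ := hl
    obtain ⟨b, ⟨hb, -⟩, hab⟩ := hl'
    simp only [List.cons.injEq, node.injEq] at hab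
    have := congrArg List.length hab.1
    rw [List.length_take, List.length_take] at this
    omega

lemma forests_eq_empty {n r : ℕ} (h : n < r) : forests n r = ∅ := by
  ext l
  simp only [mem_forests, Finset.notMem_empty, iff_false]
  have := length_le_sum_size l
  omega

lemma forests_succ_zero (n : ℕ) : forests (n + 1) 0 = ∅ := by rw [forests]

open Classical in
/-- The trees with `n` nodes. -/
noncomputable def trees : ℕ → Finset PlaneTree
  | 0 => ∅
  | n + 1 => (Finset.range (n + 1)).biUnion fun d => (forests n d).image node

@[simp]
lemma mem_trees (n : ℕ) (T : PlaneTree) : T ∈ trees n ↔ T.size = n := by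
  cases n with
  | zero => have := size_pos T; simp only [trees, Finset.notMem_empty, false_iff]; omega
  | succ n =>
    cases T with
    | node ts =>
      have := length_le_sum_size ts
      simp only [trees, Finset.mem_biUnion, Finset.mem_range, Finset.mem_image, mem_forests,
        node.injEq, exists_eq_right, size_node]
      constructor
      · rintro ⟨d, hd, h1, h2⟩; omega
      · intro h; exact ⟨ts.length, by omega, rfl, by omega⟩

/-- Splitting off the whole first tree, rather than just its root; weighted sums of product form
thereby become Cauchy products of power series. -/
lemma sum_forests_cons {M : Type*} [AddCommMonoid M] (n r : ℕ) (φ : List PlaneTree → M) :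
    ∑ l ∈ forests n (r + 1), φ l = ∑ x ∈ Finset.HasAntidiagonal.antidiagonal n, ∑ T ∈ trees x.1,
      ∑ l ∈ forests x.2 r, φ (T :: l) := by
  classical
  have h0 : ∀ x : ℕ × ℕ, ∑ T ∈ trees x.1, ∑ l ∈ forests x.2 r, φ (T :: l)
      = ∑ y ∈ trees x.1 ×ˢ forests x.2 r, φ (y.1 :: y.2) := fun x =>
    (Finset.sum_product' _ _ fun T l => φ (T :: l)).symm
  rw [Finset.sum_congr rfl fun x _ => h0 x, Finset.sum_sigma' (Finset.HasAntidiagonal.antidiagonal n) (fun x => trees x.1 ×ˢ forests x.2 r)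
    (fun _ y => φ (y.1 :: y.2))]
  symm
  refine Finset.sum_bij' (fun y _ => y.2.1 :: y.2.2)
    (fun l _ => ⟨((l.headD (node [])).size, (l.tail.map size).sum), (l.headD (node []), l.tail)⟩)
    ?_ ?_ ?_ ?_ ?_
  · rintro ⟨⟨k, m⟩, T, l⟩ h
    simp only [Finset.mem_sigma, Finset.HasAntidiagonal.mem_antidiagonal, Finset.mem_product, mem_trees,
      mem_forests] at h
    simp only [mem_forests, List.length_cons, List.map_cons, List.sum_cons]
    omega
  · intro l h
    match l, h with
    | T :: l, h =>
      simp only [mem_forests, List.length_cons, List.map_cons, List.sum_cons] at h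
      simp only [Finset.mem_sigma, Finset.HasAntidiagonal.mem_antidiagonal, Finset.mem_product, mem_trees,
        mem_forests, List.headD_cons, List.tail_cons]
      exact ⟨by omega, trivial, by omega, trivial⟩
    | [], h => simp [mem_forests] at h
  · rintro ⟨⟨k, m⟩, T, l⟩ h
    simp only [Finset.mem_sigma, Finset.HasAntidiagonal.mem_antidiagonal, Finset.mem_product, mem_trees,
      mem_forests] at h
    obtain ⟨-, rfl, -, rfl⟩ := h
    rfl
  · intro l h
    match l, h with
    | T :: l, h => rfl
    | [], h => simp [mem_forests] at h
  · intro _ _; rfl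

lemma sum_trees_succ {M : Type*} [AddCommMonoid M] (n : ℕ) (φ : PlaneTree → M) :
    ∑ T ∈ trees n, φ T = ∑ l ∈ forests n 1, φ (l.headD (node [])) := by
  refine Finset.sum_bij' (fun T _ => [T]) (fun l _ => l.headD (node [])) ?_ ?_ ?_ ?_ ?_
  · intro T h; simpa [mem_forests] using h
  · intro l h
    obtain ⟨h1, h2⟩ := (mem_forests _ _ _).1 h
    obtain ⟨T, rfl⟩ := List.length_eq_one_iff.1 h1
    simpa using h2
  · intro T _; rfl
  · intro l h
    obtain ⟨T, rfl⟩ := List.length_eq_one_iff.1 ((mem_forests _ _ _).1 h).1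
    rfl
  · intro T _; rfl

/-! ### Additive functionals -/

lemma additive_node (f : PlaneTree → ℝ) (ts : List PlaneTree) :
    additive f (node ts) = f (node ts) + (ts.map (additive f)).sum := by
  rw [additive, fringe, List.map_cons, List.sum_cons]
  congr 1
  induction ts with
  | nil => simp
  | cons T l ih => simp [ih, additive]

end PlaneTree

/-! ### Power series identities, hitting times and moment formulas for forests. -/

namespace PlaneTree

open PowerSeries in
-- Averaging over the degree of the explored root is multiplication by the offspring series. Any
-- truncation beyond `M` is harmless, as `X ^ (r + d)` kills the coefficient for `d > M`.
lemma sum_range_mul_coeff_X_pow_mul {q : ℕ → ℝ} {r M N : ℕ} (h : M < N) (A : PowerSeries ℝ) :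
    ∑ d ∈ Finset.range N, q d * coeff M (X ^ (r + d) * A) = coeff M (X ^ r * (mk q * A)) := by
  have h1 : X ^ r * (mk q * A) = mk q * (X ^ r * A) := by ring
  rw [h1, coeff_mul, Finset.Nat.sum_antidiagonal_eq_sum_range_succ
    (fun i j => coeff i (mk q) * coeff j (X ^ r * A)) M]
  symm
  refine Finset.sum_subset_zero_on_sdiff (by intro d; simp; omega) ?_ ?_
  · intro d hd
    simp only [Finset.mem_sdiff, Finset.mem_range] at hd
    rw [coeff_X_pow_mul', if_neg (by omega), mul_zero]
  · intro d hd
    simp only [Finset.mem_range] at hd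
    rw [coeff_mk, add_comm r d, pow_add, mul_assoc, coeff_X_pow_mul' _ d, if_pos (by omega)]

open PowerSeries in
lemma coeff_X_pow_mul_X_mul_derivative (r n : ℕ) (A : PowerSeries ℝ) :
    coeff n (X ^ r * (X * derivative ℝ A)) = ((n : ℝ) - r) * coeff n (X ^ r * A) := by
  rw [coeff_X_pow_mul', coeff_X_pow_mul']
  split_ifs with h
  · obtain ⟨m, rfl⟩ := Nat.exists_eq_add_of_le h
    rw [Nat.add_sub_cancel_left]
    cases m with
    | zero => simp
    | succ m =>
      rw [coeff_succ_X_mul, coeff_derivative]; push_cast; ring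
  · simp

open PowerSeries in
-- This is `(n + 1) Q ^ n · X Q' = X (Q ^ (n + 1))'` read off coefficientwise. It takes the place of
-- the cycle lemma in the hitting time theorem.
lemma sum_range_natCast_mul_coeff_X_pow_mul {q : ℕ → ℝ} {r M N : ℕ} (h : M < N) (n : ℕ) :
    (n + 1) * ∑ d ∈ Finset.range N, q d * ((d : ℝ) * coeff M (X ^ (r + d) * mk q ^ n))
      = ((M : ℝ) - r) * coeff M (X ^ r * mk q ^ (n + 1)) := by
  have h1 : mk (fun d => (d : ℝ) * q d) = X * derivative ℝ (mk q) := by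
    ext m
    cases m with
    | zero => simp
    | succ m => rw [coeff_succ_X_mul, coeff_derivative, coeff_mk, coeff_mk]; push_cast; ring
  have h2 := sum_range_mul_coeff_X_pow_mul (q := fun d => (d : ℝ) * q d) (r := r) h (mk q ^ n)
  rw [← coeff_X_pow_mul_X_mul_derivative, derivative_pow, Nat.add_sub_cancel]
  have h3 : X ^ r * (X * (((n + 1 : ℕ) : PowerSeries ℝ) * mk q ^ n * derivative ℝ (mk q)))
      = C ((n : ℝ) + 1) * (X ^ r * (mk (fun d => (d : ℝ) * q d) * mk q ^ n)) := by
    rw [h1]; push_cast; simp only [map_add, map_natCast, map_one]; ring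
  rw [h3, coeff_C_mul, ← h2]
  congr 1
  exact Finset.sum_congr rfl fun d _ => by ring

open PowerSeries in
-- If `A` agrees with `X * B` up to degree `n + 1`, so do their products with any series. It
-- transfers a recurrence for hole series to their products with toll series.
lemma coeff_succ_mul_eq {G A B : PowerSeries ℝ} {n : ℕ} (h0 : coeff 0 A = 0)
    (h : ∀ m ≤ n, coeff (m + 1) A = coeff m B) : coeff (n + 1) (G * A) = coeff n (G * B) := by
  have h1 : coeff n (G * B) = coeff (n + 1) (G * (X * B)) := by
    rw [← coeff_succ_X_mul]; congr 1; ring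
  rw [h1, coeff_mul, coeff_mul]
  refine Finset.sum_congr rfl fun x hx => ?_
  congr 1
  have hx' := Finset.HasAntidiagonal.mem_antidiagonal.1 hx
  rcases hm : x.2 with _ | m
  · simp [h0]
  · rw [coeff_succ_X_mul, h m (by omega)]

variable (p : PMF ℕ)

/-- The Galton-Watson weight of a tree as a real number. -/
noncomputable def weight (T : PlaneTree) : ℝ := (gwProb p T).toReal

/-- The generating series of the offspring distribution. -/
noncomputable def offspringSeries : PowerSeries ℝ := PowerSeries.mk fun d => (p d).toReal

lemma weight_node (ts : List PlaneTree) :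
    weight p (node ts) = (p ts.length).toReal * (ts.map (weight p)).prod := by
  rw [weight, gwProb, ENNReal.toReal_mul]
  congr 1
  induction ts with
  | nil => simp
  | cons T l ih => rw [List.map_cons, List.prod_cons, ENNReal.toReal_mul, ih]; rfl

lemma weight_nonneg (T : PlaneTree) : 0 ≤ weight p T := ENNReal.toReal_nonneg

/-- The weighted sum of `φ` over the forests with `n` nodes and `r` trees. -/
noncomputable def forestSum (n r : ℕ) (φ : List PlaneTree → ℝ) : ℝ :=
  ∑ l ∈ forests n r, (l.map (weight p)).prod * φ l

/-- The weighted sum of `g` over the trees with `n` nodes. -/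
noncomputable def treeSum (g : PlaneTree → ℝ) (n : ℕ) : ℝ :=
  ∑ T ∈ trees n, weight p T * g T

lemma treeSum_zero (g : PlaneTree → ℝ) : treeSum p g 0 = 0 := by simp [treeSum, trees]

/-- The sum of `additive f` over the trees of a forest. -/
noncomputable def additiveForest (f : PlaneTree → ℝ) (l : List PlaneTree) : ℝ :=
  (l.map (additive f)).sum

lemma forestSum_add (n r : ℕ) (φ ψ : List PlaneTree → ℝ) :
    forestSum p n r (fun l => φ l + ψ l) = forestSum p n r φ + forestSum p n r ψ := by
  simp_rw [forestSum, mul_add, Finset.sum_add_distrib]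

lemma forestSum_congr {n r : ℕ} {φ ψ : List PlaneTree → ℝ}
    (h : ∀ l, l.length = r → φ l = ψ l) : forestSum p n r φ = forestSum p n r ψ :=
  Finset.sum_congr rfl fun l hl => by rw [h l ((mem_forests _ _ _).1 hl).1]

lemma forestSum_succ {n r N : ℕ} (hN : n < N) (φ : List PlaneTree → ℝ) :
    forestSum p (n + 1) (r + 1) φ = ∑ d ∈ Finset.range N, (p d).toReal *
      forestSum p n (r + d) fun l => φ (node (l.take d) :: l.drop d) := by
  rw [forestSum, sum_forests_succ]
  refine Finset.sum_subset_zero_on_sdiff (by intro d; simp; omega) ?_ ?_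
  · intro d hd
    simp only [Finset.mem_sdiff, Finset.mem_range] at hd
    rw [forestSum, forests_eq_empty (by omega), Finset.sum_empty, mul_zero]
  · intro d _
    rw [forestSum, Finset.mul_sum]
    refine Finset.sum_congr rfl fun l hl => ?_
    have h1 := ((mem_forests _ _ _).1 hl).1
    rw [List.map_cons, List.prod_cons, weight_node, List.length_take, h1,
      Nat.min_eq_left (by omega), mul_assoc (p d).toReal, ← List.prod_append, ← List.map_append,
      List.take_append_drop, mul_assoc]

lemma forestSum_cons (n r : ℕ) {φ ψ : List PlaneTree → ℝ} {g : PlaneTree → ℝ}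
    (h : ∀ T l, φ (T :: l) = g T * ψ l) :
    forestSum p n (r + 1) φ = PowerSeries.coeff n
      (PowerSeries.mk (treeSum p g) * PowerSeries.mk fun m => forestSum p m r ψ) := by
  rw [forestSum, sum_forests_cons, PowerSeries.coeff_mul]
  refine Finset.sum_congr rfl fun x _ => ?_
  rw [PowerSeries.coeff_mk, PowerSeries.coeff_mk, treeSum, forestSum, Finset.sum_mul_sum]
  refine Finset.sum_congr rfl fun T _ => Finset.sum_congr rfl fun l _ => ?_
  rw [h, List.map_cons, List.prod_cons]; ring

lemma forestSum_zero_right_succ (n : ℕ) (φ : List PlaneTree → ℝ) :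
    forestSum p (n + 1) 0 φ = 0 := by
  rw [forestSum, forests_succ_zero, Finset.sum_empty]

lemma forestSum_zero_zero (φ : List PlaneTree → ℝ) : forestSum p 0 0 φ = φ [] := by
  simp [forestSum, forests]

lemma forestSum_zero_succ (r : ℕ) (φ : List PlaneTree → ℝ) : forestSum p 0 (r + 1) φ = 0 := by
  rw [forestSum, forests_eq_empty (by omega), Finset.sum_empty]

open PowerSeries in
/-- The hitting time theorem. -/
lemma natCast_mul_forestSum_one (n r : ℕ) :
    n * forestSum p n r (fun _ => 1) = r * coeff n (X ^ r * offspringSeries p ^ n) := by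
  induction n generalizing r with
  | zero => cases r <;> simp
  | succ n ih =>
    cases r with
    | zero => simp [forestSum_zero_right_succ]
    | succ r =>
      rw [forestSum_succ p (Nat.lt_succ_self n)]
      have e : coeff (n + 1) (X ^ (r + 1) * offspringSeries p ^ (n + 1))
          = coeff n (X ^ r * offspringSeries p ^ (n + 1)) := by
        rw [pow_succ', mul_assoc, coeff_succ_X_mul]
      rw [e]
      -- The induction hypothesis carries a factor `n` that has to be cancelled, so `n = 0` is
      -- checked directly.
      rcases n.eq_zero_or_pos with rfl | hn
      · cases r with
        | zero => simp [forestSum_zero_zero, offspringSeries]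
        | succ r =>
          have : ∀ d, r + 1 + d = (r + d) + 1 := by intro d; ring
          simp [this, forestSum_zero_succ]
      · have hn' : (n : ℝ) ≠ 0 := by positivity
        -- The factor `r + d` from the induction hypothesis is split: the `r` part multiplies by the
        -- offspring series, the `d` part goes through the derivative identity.
        have h1 : (n : ℝ) * ∑ d ∈ Finset.range (n + 1), (p d).toReal *
              forestSum p n (r + d) (fun _ => 1)
            = r * ∑ d ∈ Finset.range (n + 1), (p d).toReal *
                coeff n (X ^ (r + d) * offspringSeries p ^ n)
              + ∑ d ∈ Finset.range (n + 1), (p d).toReal * (d *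
                coeff n (X ^ (r + d) * offspringSeries p ^ n)) := by
          rw [Finset.mul_sum, Finset.mul_sum, ← Finset.sum_add_distrib]
          refine Finset.sum_congr rfl fun d _ => ?_
          rw [mul_left_comm, ih]; push_cast; ring
        have h2 := sum_range_mul_coeff_X_pow_mul (q := fun d => (p d).toReal) (r := r)
          (Nat.lt_succ_self n) (offspringSeries p ^ n)
        have h3 := sum_range_natCast_mul_coeff_X_pow_mul (q := fun d => (p d).toReal) (r := r)
          (Nat.lt_succ_self n) n
        have h4 : mk (fun d => (p d).toReal) * offspringSeries p ^ n
          = offspringSeries p ^ (n + 1) := by rw [pow_succ']; rfl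
        rw [h4] at h2
        change _ = _ * coeff n (X ^ r * offspringSeries p ^ (n + 1)) at h3
        change _ * ∑ d ∈ Finset.range (n + 1), (p d).toReal *
                (d * coeff n (X ^ (r + d) * offspringSeries p ^ n)) = _ at h3
        apply mul_left_cancel₀ hn'
        rw [mul_left_comm, h1, h2]
        push_cast
        linear_combination h3

/-- The generating series of the forests of `r` trees with one leaf removed. -/
noncomputable def oneHoleSeries (r : ℕ) : PowerSeries ℝ := PowerSeries.mk fun m =>
  r * PowerSeries.coeff (m + 1) (PowerSeries.X ^ r * offspringSeries p ^ m)

/-- The generating series of the forests of `r` trees with an ordered pair of leaves removed. -/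
noncomputable def twoHoleSeries (r : ℕ) : PowerSeries ℝ := PowerSeries.mk fun m =>
  r * (m + 1) * PowerSeries.coeff (m + 2) (PowerSeries.X ^ r * offspringSeries p ^ m)

open PowerSeries in
-- Either the first root is the hole, leaving an arbitrary forest of `r` trees, or it is an ordinary
-- node with `d` branches. The index `m` counts the nodes other than the hole.
lemma coeff_oneHoleSeries_succ {r m N : ℕ} (hN : m + 1 < N) :
    coeff (m + 1) (oneHoleSeries p (r + 1)) = forestSum p (m + 1) r (fun _ => 1) +
      ∑ d ∈ Finset.range N, (p d).toReal * coeff m (oneHoleSeries p (r + d)) := by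
  have h1 : ∑ d ∈ Finset.range N, (p d).toReal * coeff m (oneHoleSeries p (r + d))
      = r * ∑ d ∈ Finset.range N, (p d).toReal *
          coeff (m + 1) (X ^ (r + d) * offspringSeries p ^ m)
        + ∑ d ∈ Finset.range N, (p d).toReal * (d *
          coeff (m + 1) (X ^ (r + d) * offspringSeries p ^ m)) := by
    rw [Finset.mul_sum, ← Finset.sum_add_distrib]
    refine Finset.sum_congr rfl fun d _ => ?_
    rw [oneHoleSeries, coeff_mk]; push_cast; ring
  have h2 := sum_range_mul_coeff_X_pow_mul (q := fun d => (p d).toReal) (r := r)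
    hN (offspringSeries p ^ m)
  have h3 := sum_range_natCast_mul_coeff_X_pow_mul (q := fun d => (p d).toReal) (r := r) hN m
  have h4 : mk (fun d => (p d).toReal) * offspringSeries p ^ m
    = offspringSeries p ^ (m + 1) := by rw [pow_succ']; rfl
  have h5 := natCast_mul_forestSum_one p (m + 1) r
  rw [h4] at h2
  change (_ : ℝ) = _ * coeff (m + 1) (X ^ r * offspringSeries p ^ (m + 1)) at h3
  change _ * ∑ d ∈ Finset.range N, (p d).toReal *
    (d * coeff (m + 1) (X ^ (r + d) * offspringSeries p ^ m)) = _ at h3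
  have e : coeff (m + 1 + 1) (X ^ (r + 1) * offspringSeries p ^ (m + 1))
      = coeff (m + 1) (X ^ r * offspringSeries p ^ (m + 1)) := by
    rw [pow_succ', mul_assoc, coeff_succ_X_mul]
  rw [h1, h2, oneHoleSeries, coeff_mk, e]
  have hm : ((m : ℝ) + 1) ≠ 0 := by positivity
  apply mul_left_cancel₀ hm
  push_cast at h3 h5 ⊢
  linear_combination -h3 - h5

open PowerSeries in
lemma coeff_oneHoleSeries_zero (r : ℕ) :
    coeff 0 (oneHoleSeries p (r + 1)) = forestSum p 0 r (fun _ => 1) := by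
  cases r with
  | zero => simp [oneHoleSeries, forestSum_zero_zero]
  | succ r => simp [oneHoleSeries, forestSum_zero_succ, coeff_X_pow]

open PowerSeries in
-- The first root can be either of the two labelled holes, hence the factor 2, or an ordinary node
-- with `d` branches.
lemma coeff_twoHoleSeries_succ {r m N : ℕ} (hN : m + 2 < N) :
    coeff (m + 1) (twoHoleSeries p (r + 1)) = 2 * coeff (m + 1) (oneHoleSeries p r) +
      ∑ d ∈ Finset.range N, (p d).toReal * coeff m (twoHoleSeries p (r + d)) := by
  have h1 : ∑ d ∈ Finset.range N, (p d).toReal * coeff m (twoHoleSeries p (r + d))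
      = (m + 1) * (r * ∑ d ∈ Finset.range N, (p d).toReal *
          coeff (m + 2) (X ^ (r + d) * offspringSeries p ^ m)
        + ∑ d ∈ Finset.range N, (p d).toReal * (d *
          coeff (m + 2) (X ^ (r + d) * offspringSeries p ^ m))) := by
    rw [Finset.mul_sum, ← Finset.sum_add_distrib, Finset.mul_sum]
    refine Finset.sum_congr rfl fun d _ => ?_
    rw [twoHoleSeries, coeff_mk]; push_cast; ring
  have h2 := sum_range_mul_coeff_X_pow_mul (q := fun d => (p d).toReal) (r := r)
    hN (offspringSeries p ^ m)
  have h3 := sum_range_natCast_mul_coeff_X_pow_mul (q := fun d => (p d).toReal) (r := r) hN m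
  have h4 : mk (fun d => (p d).toReal) * offspringSeries p ^ m
    = offspringSeries p ^ (m + 1) := by rw [pow_succ']; rfl
  rw [h4] at h2
  change (_ : ℝ) = _ * coeff (m + 2) (X ^ r * offspringSeries p ^ (m + 1)) at h3
  change _ * ∑ d ∈ Finset.range N, (p d).toReal *
    (d * coeff (m + 2) (X ^ (r + d) * offspringSeries p ^ m)) = _ at h3
  have e : coeff (m + 1 + 2) (X ^ (r + 1) * offspringSeries p ^ (m + 1))
      = coeff (m + 2) (X ^ r * offspringSeries p ^ (m + 1)) := by
    rw [pow_succ', mul_assoc, coeff_succ_X_mul]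
  rw [h1, h2, twoHoleSeries, oneHoleSeries, coeff_mk, coeff_mk, e]
  push_cast at h3 ⊢
  linear_combination -h3

open PowerSeries in
lemma coeff_twoHoleSeries_zero (r : ℕ) :
    coeff 0 (twoHoleSeries p (r + 1)) = 2 * coeff 0 (oneHoleSeries p r) := by
  match r with
  | 0 => simp [oneHoleSeries, twoHoleSeries]
  | 1 => simp [oneHoleSeries, twoHoleSeries]
  | r + 2 => simp [oneHoleSeries, twoHoleSeries, coeff_X_pow]

lemma additiveForest_cons (g : PlaneTree → ℝ) (T : PlaneTree) (l : List PlaneTree) :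
    additiveForest g (T :: l) = additive g T + additiveForest g l := by
  simp [additiveForest]

lemma additiveForest_take_add_drop (g : PlaneTree → ℝ) (d : ℕ) (l : List PlaneTree) :
    additiveForest g (l.take d) + additiveForest g (l.drop d) = additiveForest g l := by
  rw [additiveForest, additiveForest, ← List.sum_append, ← List.map_append,
    List.take_append_drop, additiveForest]

lemma additive_node' (f : PlaneTree → ℝ) (ts : List PlaneTree) :
    additive f (node ts) = f (node ts) + additiveForest f ts := additive_node f ts

/-- Exploring the first root of a forest with one functional of its tree and one of the rest. -/
lemma forestSum_head_mul (n r : ℕ) (g : PlaneTree → ℝ) (ψ : List PlaneTree → ℝ) :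
    forestSum p n (r + 1) (fun l => g (l.headD (node [])) * ψ l.tail) = PowerSeries.coeff n
      (PowerSeries.mk (treeSum p g) * PowerSeries.mk fun m => forestSum p m r ψ) :=
  forestSum_cons p n r fun _ _ => rfl

open PowerSeries in
/-- First moment formula for additive functionals of forests. -/
lemma forestSum_additiveForest (g : PlaneTree → ℝ) (n r : ℕ) :
    forestSum p n r (additiveForest g) = coeff n (mk (treeSum p g) * oneHoleSeries p r) := by
  induction n generalizing r with
  | zero =>
    have h : coeff 0 (mk (treeSum p g) * oneHoleSeries p r) = 0 := by
      simp [coeff_mul, treeSum_zero]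
    rw [h]
    cases r with
    | zero => simp [forestSum_zero_zero, additiveForest]
    | succ r => exact forestSum_zero_succ p r _
  | succ n ih =>
    cases r with
    | zero => simp [forestSum_zero_right_succ, oneHoleSeries, coeff_mul]
    | succ r =>
      set N := n + 2 with hN
      -- Once the toll of the first tree is removed, the rest is the same functional of the forest
      -- obtained by opening the first root, and the induction hypothesis applies.
      have h1 : ∀ l : List PlaneTree, l.length = r + 1 → additiveForest g l
          = g (l.headD (node [])) * (1 : ℝ)
            + (additiveForest g l - g (l.headD (node []))) := fun l _ => by ring
      rw [forestSum_congr p h1, forestSum_add,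
        forestSum_head_mul p (n + 1) r g (fun _ => 1),
        forestSum_succ p (show n < N by omega)]
      have h2 : ∀ d ∈ Finset.range N, (p d).toReal * (forestSum p n (r + d) fun l =>
            additiveForest g (node (l.take d) :: l.drop d)
              - g ((node (l.take d) :: l.drop d).headD (node [])))
          = (p d).toReal * coeff n (mk (treeSum p g) * oneHoleSeries p (r + d)) := by
        intro d _
        rw [← ih]
        congr 1
        refine forestSum_congr p fun l _ => ?_
        rw [additiveForest_cons, additive_node', ← additiveForest_take_add_drop g d l,
          List.headD_cons]
        ring
      rw [Finset.sum_congr rfl h2]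
      have h3 : ∑ d ∈ Finset.range N, (p d).toReal *
            coeff n (mk (treeSum p g) * oneHoleSeries p (r + d))
          = coeff n (mk (treeSum p g) *
              ∑ d ∈ Finset.range N, C (p d).toReal * oneHoleSeries p (r + d)) := by
        rw [Finset.mul_sum, map_sum]
        refine Finset.sum_congr rfl fun d _ => ?_
        rw [mul_left_comm, coeff_C_mul]
      -- The series `A` counts the one-hole forests whose hole is not the first root; its
      -- coefficients shifted by one are exactly the sum over `d`.
      rw [h3, ← coeff_succ_mul_eq (n := n) (A := oneHoleSeries p (r + 1)
        - mk fun m => forestSum p m r fun _ => 1), ← map_add]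
      · congr 1; ring
      · rw [map_sub, coeff_oneHoleSeries_zero, coeff_mk, sub_self]
      · intro m hm
        rw [map_sub, coeff_oneHoleSeries_succ p (show m + 1 < N by omega), coeff_mk, map_sum]
        simp only [coeff_C_mul]
        ring

/-- The toll function collecting the nested pairs in a product of two additive functionals. -/
noncomputable def nested (g h : PlaneTree → ℝ) (T : PlaneTree) : ℝ :=
  g T * additive h T + h T * additive g T - g T * h T

open PowerSeries in
/-- Second moment formula for additive functionals of forests. -/
lemma forestSum_additiveForest_mul (g h : PlaneTree → ℝ) (n r : ℕ) :
    forestSum p n r (fun l => additiveForest g l * additiveForest h l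
        - additiveForest (nested g h) l)
      = coeff n (mk (treeSum p g) * mk (treeSum p h) * twoHoleSeries p r) := by
  induction n generalizing r with
  | zero =>
    have e : coeff 0 (mk (treeSum p g) * mk (treeSum p h) * twoHoleSeries p r) = 0 := by
      simp [coeff_mul, treeSum_zero]
    rw [e]
    cases r with
    | zero => simp [forestSum_zero_zero, additiveForest]
    | succ r => exact forestSum_zero_succ p r _
  | succ n ih =>
    cases r with
    | zero => simp [forestSum_zero_right_succ, twoHoleSeries, coeff_mul]
    | succ r =>
      set N := n + 3 with hN
      set R : List PlaneTree → ℝ := fun l => additiveForest g l * additiveForest h l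
        - additiveForest (nested g h) l with hR
      -- `R` sums over ordered pairs of disjoint subtrees. Pairs using the first root must take the
      -- other subtree from the remaining trees, giving the two one-hole terms; all other pairs
      -- survive opening the first root.
      have h1 : ∀ l : List PlaneTree, l.length = r + 1 → R l
          = (g (l.headD (node [])) * additiveForest h l.tail
            + h (l.headD (node [])) * additiveForest g l.tail)
            + (R l - (g (l.headD (node [])) * additiveForest h l.tail
            + h (l.headD (node [])) * additiveForest g l.tail)) := fun l _ => by ring
      rw [forestSum_congr p h1, forestSum_add, forestSum_add,
        forestSum_head_mul p (n + 1) r g, forestSum_head_mul p (n + 1) r h,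
        forestSum_succ p (show n < N by omega)]
      have h2 : ∀ d ∈ Finset.range N, (p d).toReal * (forestSum p n (r + d) fun l =>
            R (node (l.take d) :: l.drop d)
              - (g ((node (l.take d) :: l.drop d).headD (node []))
                * additiveForest h (node (l.take d) :: l.drop d).tail
              + h ((node (l.take d) :: l.drop d).headD (node []))
                * additiveForest g (node (l.take d) :: l.drop d).tail))
          = (p d).toReal * coeff n (mk (treeSum p g) * mk (treeSum p h)
              * twoHoleSeries p (r + d)) := by
        intro d _
        rw [← ih]
        congr 1
        refine forestSum_congr p fun l _ => ?_
        simp only [hR, List.headD_cons, List.tail_cons, additiveForest_cons, additive_node',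
          nested]
        rw [← additiveForest_take_add_drop g d l, ← additiveForest_take_add_drop h d l,
          ← additiveForest_take_add_drop (nested g h) d l]
        ring
      rw [Finset.sum_congr rfl h2]
      simp_rw [forestSum_additiveForest]
      have e1 : ∀ k : PlaneTree → ℝ, (mk fun m => coeff m (mk (treeSum p k) * oneHoleSeries p r))
          = mk (treeSum p k) * oneHoleSeries p r := fun k => by ext m; rw [coeff_mk]
      rw [e1, e1]
      have h3 : ∑ d ∈ Finset.range N, (p d).toReal *
            coeff n (mk (treeSum p g) * mk (treeSum p h) * twoHoleSeries p (r + d))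
          = coeff n (mk (treeSum p g) * mk (treeSum p h) *
              ∑ d ∈ Finset.range N, C (p d).toReal * twoHoleSeries p (r + d)) := by
        rw [Finset.mul_sum, map_sum]
        refine Finset.sum_congr rfl fun d _ => ?_
        rw [mul_left_comm, coeff_C_mul]
      rw [h3, ← coeff_succ_mul_eq (n := n) (A := twoHoleSeries p (r + 1) - C 2 * oneHoleSeries p r),
        ← map_add, ← map_add]
      · have : (C (2 : ℝ) : PowerSeries ℝ) = 2 := map_ofNat _ 2
        rw [this]
        congr 1; ring
      · rw [map_sub, coeff_twoHoleSeries_zero, coeff_C_mul, sub_self]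
      · intro m hm
        rw [map_sub, coeff_twoHoleSeries_succ p (show m + 2 < N by omega), coeff_C_mul, map_sum]
        simp only [coeff_C_mul]
        ring

end PlaneTree

namespace PlaneTree

variable (p : PMF ℕ)

/-! ### Moments of additive functionals of trees -/

lemma treeSum_eq_forestSum (g : PlaneTree → ℝ) (n : ℕ) :
    treeSum p g n = forestSum p n 1 fun l => g (l.headD (node [])) := by
  rw [treeSum, sum_trees_succ, forestSum]
  refine Finset.sum_congr rfl fun l hl => ?_
  obtain ⟨T, rfl⟩ := List.length_eq_one_iff.1 ((mem_forests _ _ _).1 hl).1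
  simp

lemma treeSum_add (g h : PlaneTree → ℝ) (n : ℕ) :
    treeSum p (fun T => g T + h T) n = treeSum p g n + treeSum p h n := by
  simp_rw [treeSum, mul_add, Finset.sum_add_distrib]

lemma treeSum_sub (g h : PlaneTree → ℝ) (n : ℕ) :
    treeSum p (fun T => g T - h T) n = treeSum p g n - treeSum p h n := by
  simp_rw [treeSum, mul_sub, Finset.sum_sub_distrib]

lemma treeSum_const_mul (c : ℝ) (g : PlaneTree → ℝ) (n : ℕ) :
    treeSum p (fun T => c * g T) n = c * treeSum p g n := by
  simp_rw [treeSum, Finset.mul_sum, mul_left_comm c]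

lemma treeSum_congr {g h : PlaneTree → ℝ} {n : ℕ} (H : ∀ T, T.size = n → g T = h T) :
    treeSum p g n = treeSum p h n :=
  Finset.sum_congr rfl fun T hT => by rw [H T ((mem_trees _ _).1 hT)]

lemma treeSum_mono {g h : PlaneTree → ℝ} {n : ℕ} (H : ∀ T, T.size = n → g T ≤ h T) :
    treeSum p g n ≤ treeSum p h n :=
  Finset.sum_le_sum fun T hT =>
    mul_le_mul_of_nonneg_left (H T ((mem_trees _ _).1 hT)) (weight_nonneg p T)

lemma treeSum_nonneg {g : PlaneTree → ℝ} {n : ℕ} (H : ∀ T, T.size = n → 0 ≤ g T) :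
    0 ≤ treeSum p g n :=
  Finset.sum_nonneg fun T hT =>
    mul_nonneg (weight_nonneg p T) (H T ((mem_trees _ _).1 hT))

lemma treeSum_mul_sq_le (g h : PlaneTree → ℝ) (n : ℕ) :
    treeSum p (fun T => g T * h T) n ^ 2
      ≤ treeSum p (fun T => g T ^ 2) n * treeSum p (fun T => h T ^ 2) n := by
  refine Finset.sum_sq_le_sum_mul_sum_of_sq_le_mul _ ?_ ?_ ?_
  · intro T _; have := weight_nonneg p T; positivity
  · intro T _; have := weight_nonneg p T; positivity
  · intro T _; exact le_of_eq (by ring)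

/-- The probability that the Galton-Watson tree has `n` nodes. -/
noncomputable def sizeProb (n : ℕ) : ℝ := treeSum p (fun _ => 1) n

lemma sizeProb_nonneg (n : ℕ) : 0 ≤ sizeProb p n :=
  treeSum_nonneg p fun _ _ => zero_le_one

lemma treeSum_const (c : ℝ) (n : ℕ) : treeSum p (fun _ => c) n = c * sizeProb p n := by
  rw [sizeProb, ← treeSum_const_mul]; simp

/-- The probability that the sum of `j` independent offspring variables is `s`. -/
noncomputable def walkProb (j s : ℕ) : ℝ := PowerSeries.coeff s (offspringSeries p ^ j)

/-- The hitting time theorem for a single tree. It also makes `n p_n` a walk probability, so Fourier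
inversion applies to it. -/
lemma natCast_mul_sizeProb (n : ℕ) : (n + 1 : ℝ) * sizeProb p (n + 1) = walkProb p (n + 1) n := by
  have h := natCast_mul_forestSum_one p (n + 1) 1
  rw [sizeProb, treeSum_eq_forestSum]
  push_cast at h
  rw [h, one_mul, pow_one, PowerSeries.coeff_succ_X_mul, walkProb]

/-- A marked fringe subtree of order `k` is grafted at the hole of a tree with `n - k` other nodes;
for a single tree the hole series has coefficients `walkProb p j j`. -/
lemma treeSum_additive (g : PlaneTree → ℝ) (n : ℕ) :
    treeSum p (additive g) n
      = ∑ k ∈ Finset.range (n + 1), treeSum p g k * walkProb p (n - k) (n - k) := by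
  have h := forestSum_additiveForest p g n 1
  have h1 : treeSum p (additive g) n = forestSum p n 1 (additiveForest g) := by
    rw [treeSum_eq_forestSum]
    refine forestSum_congr p fun l hl => ?_
    obtain ⟨T, rfl⟩ := List.length_eq_one_iff.1 hl
    simp [additiveForest]
  rw [h1, h, PowerSeries.coeff_mul, Finset.Nat.sum_antidiagonal_eq_sum_range_succ
    (fun i j => PowerSeries.coeff i (PowerSeries.mk (treeSum p g))
      * PowerSeries.coeff j (oneHoleSeries p 1)) n]
  refine Finset.sum_congr rfl fun k _ => ?_
  rw [PowerSeries.coeff_mk, oneHoleSeries, PowerSeries.coeff_mk, pow_one,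
    PowerSeries.coeff_succ_X_mul, walkProb]
  simp

/-- The first sum collects nested pairs, including equal ones, at their upper node; the second
collects ordered disjoint pairs grafted at two holes. -/
lemma treeSum_additive_mul (g h : PlaneTree → ℝ) (n : ℕ) :
    treeSum p (fun T => additive g T * additive h T) n
      = ∑ k ∈ Finset.range (n + 1), treeSum p (nested g h) k * walkProb p (n - k) (n - k)
        + ∑ k ∈ Finset.range (n + 1), ∑ m ∈ Finset.range (n - k + 1),
          treeSum p g k * treeSum p h m * (((n - k - m : ℕ) + 1 : ℝ) *
            walkProb p (n - k - m) (n - k - m + 1)) := by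
  have H := forestSum_additiveForest_mul p g h n 1
  have h1 : treeSum p (fun T => additive g T * additive h T) n
      = treeSum p (additive (nested g h)) n + forestSum p n 1 (fun l =>
        additiveForest g l * additiveForest h l - additiveForest (nested g h) l) := by
    rw [treeSum_eq_forestSum, treeSum_eq_forestSum, ← forestSum_add]
    refine forestSum_congr p fun l hl => ?_
    obtain ⟨T, rfl⟩ := List.length_eq_one_iff.1 hl
    simp [additiveForest]
  rw [h1, treeSum_additive, H]
  congr 1
  rw [mul_assoc, PowerSeries.coeff_mul, Finset.Nat.sum_antidiagonal_eq_sum_range_succ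
    (fun i j => PowerSeries.coeff i (PowerSeries.mk (treeSum p g))
      * PowerSeries.coeff j (PowerSeries.mk (treeSum p h) * twoHoleSeries p 1)) n]
  refine Finset.sum_congr rfl fun k _ => ?_
  rw [PowerSeries.coeff_mul, Finset.Nat.sum_antidiagonal_eq_sum_range_succ
    (fun i j => PowerSeries.coeff i (PowerSeries.mk (treeSum p h))
      * PowerSeries.coeff j (twoHoleSeries p 1)) (n - k), Finset.mul_sum]
  refine Finset.sum_congr rfl fun m _ => ?_
  rw [PowerSeries.coeff_mk, PowerSeries.coeff_mk, twoHoleSeries, PowerSeries.coeff_mk, pow_one,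
    PowerSeries.coeff_succ_X_mul, walkProb]
  push_cast; ring

/-! ### The conditioned law -/

lemma gwProb_le_one (T : PlaneTree) : gwProb p T ≤ 1 := by
  refine PlaneTree.rec (motive_1 := fun T => gwProb p T ≤ 1)
    (motive_2 := fun l => (l.map (gwProb p)).prod ≤ 1) ?_ ?_ ?_ T
  · intro ts h
    rw [gwProb]
    exact mul_le_one' (p.coe_le_one _) h
  · simp
  · intro T l h1 h2
    rw [List.map_cons, List.prod_cons]
    exact mul_le_one' h1 h2

lemma gwProb_ne_top (T : PlaneTree) : gwProb p T ≠ ⊤ :=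
  ne_top_of_le_ne_top ENNReal.one_ne_top (gwProb_le_one p T)

lemma gwLaw_singleton (T : PlaneTree) : gwLaw p {T} = gwProb p T := by
  rw [gwLaw, Measure.sum_apply _ (measurableSet_singleton T), tsum_eq_single T]
  · simp
  · intro T' h
    simp [h]

lemma setOf_size_eq (n : ℕ) : {T : PlaneTree | T.size = n} = (trees n : Set PlaneTree) := by
  ext T; simp

lemma gwLaw_size (n : ℕ) : gwLaw p {T | T.size = n} = ENNReal.ofReal (sizeProb p n) := by
  rw [setOf_size_eq, ← sum_measure_singleton, sizeProb, treeSum,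
    ENNReal.ofReal_sum_of_nonneg (fun T _ => by have := weight_nonneg p T; positivity)]
  refine Finset.sum_congr rfl fun T _ => ?_
  rw [gwLaw_singleton, mul_one, weight, ENNReal.ofReal_toReal (gwProb_ne_top p T)]

lemma mem_gwSizes_iff (n : ℕ) : n ∈ gwSizes p ↔ 0 < sizeProb p n := by
  rw [gwSizes, Set.mem_ofPred_eq, gwLaw_size, ne_eq, ENNReal.ofReal_eq_zero, not_le]

lemma sizeProb_eq_zero {n : ℕ} (h : n ∉ gwSizes p) : sizeProb p n = 0 := by
  rw [mem_gwSizes_iff, not_lt] at h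
  exact le_antisymm h (sizeProb_nonneg p n)

lemma treeSum_eq_zero {n : ℕ} (h : n ∉ gwSizes p) (g : PlaneTree → ℝ) : treeSum p g n = 0 := by
  have h1 := sizeProb_eq_zero p h
  rw [sizeProb, treeSum, Finset.sum_eq_zero_iff_of_nonneg
    (fun T _ => by have := weight_nonneg p T; positivity)] at h1
  refine Finset.sum_eq_zero fun T hT => ?_
  have := h1 T hT
  rw [mul_one] at this
  rw [this, zero_mul]

/-- The expectation of `g` over the conditioned tree of order `n`. -/
noncomputable def condMean (g : PlaneTree → ℝ) (n : ℕ) : ℝ := treeSum p g n / sizeProb p n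

/-- There are finitely many trees of order `n`, so every functional is integrable. When `n` has
probability zero both sides are zero. -/
lemma integral_condGWLaw (g : PlaneTree → ℝ) (n : ℕ) :
    ∫ T, g T ∂condGWLaw p n = condMean p g n := by
  have hint : IntegrableOn g (trees n : Set PlaneTree) (gwLaw p) := by
    rw [← Set.biUnion_of_singleton (trees n : Set PlaneTree)]
    refine (integrableOn_finset_iUnion (s := trees n)).2 fun T _ => ?_
    exact integrableOn_singleton (by finiteness)
      (by rw [gwLaw_singleton]; exact (gwProb_ne_top p T).lt_top)
  rw [condGWLaw, ProbabilityTheory.cond, integral_smul_measure, setOf_size_eq,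
    setIntegral_finset _ hint, ← setOf_size_eq, gwLaw_size, condMean, treeSum, ENNReal.toReal_inv,
    ENNReal.toReal_ofReal (sizeProb_nonneg p n), smul_eq_mul, div_eq_inv_mul]
  congr 1
  refine Finset.sum_congr rfl fun T _ => ?_
  rw [Measure.real, gwLaw_singleton, smul_eq_mul, weight]

lemma variance_condGWLaw (g : PlaneTree → ℝ) (n : ℕ) :
    Var[g; condGWLaw p n] = condMean p (fun T => (g T - condMean p g n) ^ 2) n := by
  rw [variance_eq_integral (measurable_from_top.aemeasurable), integral_condGWLaw,
    integral_condGWLaw]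

lemma condMean_sub_sq {n : ℕ} (hn : n ∈ gwSizes p) (g : PlaneTree → ℝ) (c : ℝ) :
    condMean p (fun T => (g T - c) ^ 2) n
      = condMean p (fun T => g T ^ 2) n - 2 * c * condMean p g n + c ^ 2 := by
  have hp := ((mem_gwSizes_iff p n).1 hn).ne'
  have : (fun T => (g T - c) ^ 2) = fun T => (g T ^ 2 - (2 * c) * g T) + c ^ 2 := by
    ext T; ring
  rw [condMean, this, treeSum_add, treeSum_sub, treeSum_const_mul, treeSum_const, condMean,
    condMean]
  field_simp

end PlaneTree

namespace PlaneTree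

variable (p : PMF ℕ)

/-! ### Fourier inversion for the random walk -/

lemma walkProb_zero (s : ℕ) : walkProb p 0 s = if s = 0 then 1 else 0 := by
  rw [walkProb, pow_zero, PowerSeries.coeff_one]

lemma walkProb_succ (j s : ℕ) : walkProb p (j + 1) s
    = ∑ x ∈ Finset.HasAntidiagonal.antidiagonal s, (p x.1).toReal * walkProb p j x.2 := by
  rw [walkProb, pow_succ', PowerSeries.coeff_mul]
  refine Finset.sum_congr rfl fun x _ => ?_
  rw [offspringSeries, PowerSeries.coeff_mk]; rfl

lemma walkProb_nonneg (j s : ℕ) : 0 ≤ walkProb p j s := by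
  induction j generalizing s with
  | zero => rw [walkProb_zero]; positivity
  | succ j ih =>
    rw [walkProb_succ]
    exact Finset.sum_nonneg fun x _ => mul_nonneg ENNReal.toReal_nonneg (ih _)

lemma dvd_of_walkProb_ne_zero {d : ℕ} (hd : ∀ k, p k ≠ 0 → d ∣ k) {j s : ℕ}
    (h : walkProb p j s ≠ 0) : d ∣ s := by
  induction j generalizing s with
  | zero =>
    rw [walkProb_zero] at h
    have : s = 0 := by by_contra h'; simp [h'] at h
    simp [this]
  | succ j ih =>
    rw [walkProb_succ] at h
    obtain ⟨x, hx, hne⟩ := Finset.exists_ne_zero_of_sum_ne_zero h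
    rw [← Finset.HasAntidiagonal.mem_antidiagonal.1 hx]
    refine dvd_add (hd _ fun h0 => hne (by simp [h0])) (ih fun h0 => hne (by simp [h0]))

lemma summable_toReal : Summable fun k => (p k).toReal :=
  ENNReal.summable_toReal p.tsum_coe_ne_top

lemma summable_norm_mul_pow {z : ℂ} (hz : ‖z‖ = 1) (j : ℕ) :
    Summable (fun k => ‖(walkProb p j k : ℂ) * z ^ k‖) ∧
      ∑' k, (walkProb p j k : ℂ) * z ^ k = (∑' k, ((p k).toReal : ℂ) * z ^ k) ^ j := by
  have h0 : Summable (fun k => ‖((p k).toReal : ℂ) * z ^ k‖) := by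
    simpa [hz] using summable_toReal p
  induction j with
  | zero =>
    have h : ∀ k, k ≠ 0 → (walkProb p 0 k : ℂ) * z ^ k = 0 := fun k hk => by
      simp [walkProb_zero, hk]
    refine ⟨summable_of_ne_finset_zero (s := {0}) fun k hk => ?_, ?_⟩
    · rw [h k (by simpa using hk), norm_zero]
    · rw [tsum_eq_single 0 h]; simp [walkProb_zero]
  | succ j ih =>
    have h : ∀ n, ∑ x ∈ Finset.HasAntidiagonal.antidiagonal n,
        (((p x.1).toReal : ℂ) * z ^ x.1) * ((walkProb p j x.2 : ℂ) * z ^ x.2)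
        = (walkProb p (j + 1) n : ℂ) * z ^ n := by
      intro n
      rw [walkProb_succ]
      push_cast
      rw [Finset.sum_mul]
      refine Finset.sum_congr rfl fun x hx => ?_
      rw [← Finset.HasAntidiagonal.mem_antidiagonal.1 hx, pow_add]; ring
    have h1 := tsum_mul_tsum_eq_tsum_sum_antidiagonal_of_summable_norm h0 ih.1
    have h2 := summable_norm_sum_mul_antidiagonal_of_summable_norm h0 ih.1
    simp_rw [h] at h1 h2
    exact ⟨h2, by rw [← h1, ih.2, pow_succ']⟩

/-- The characteristic function of the centered offspring distribution. -/
noncomputable def centeredChar (t : ℝ) : ℂ :=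
  ∫ k : ℕ, Complex.exp (((t * ((k : ℝ) - 1) : ℝ) : ℂ) * Complex.I) ∂p.toMeasure

lemma norm_cexp_eq (x : ℝ) : ‖Complex.exp ((x : ℂ) * Complex.I)‖ = 1 :=
  Complex.norm_exp_ofReal_mul_I x

lemma integrable_cexp (t : ℝ) : Integrable
    (fun k : ℕ => Complex.exp (((t * ((k : ℝ) - 1) : ℝ) : ℂ) * Complex.I)) p.toMeasure := by
  refine Integrable.of_bound (measurable_from_top.aestronglyMeasurable) 1 ?_
  exact Filter.Eventually.of_forall fun k => (norm_cexp_eq _).le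

lemma tsum_mul_pow_eq (t : ℝ) :
    ∑' k, ((p k).toReal : ℂ) * Complex.exp ((t : ℂ) * Complex.I) ^ k
      = Complex.exp ((t : ℂ) * Complex.I) * centeredChar p t := by
  rw [centeredChar, PMF.integral_eq_tsum _ _ (integrable_cexp p t), ← tsum_mul_left]
  refine tsum_congr fun k => ?_
  rw [Complex.real_smul, mul_left_comm, ← Complex.exp_add, ← Complex.exp_nat_mul]
  congr 2
  push_cast; ring

lemma continuous_centeredChar : Continuous (centeredChar p) := by
  refine continuous_of_dominated (bound := fun _ => 1) ?_ ?_ ?_ ?_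
  · exact fun t => (integrable_cexp p t).aestronglyMeasurable
  · exact fun t => Filter.Eventually.of_forall fun k => (norm_cexp_eq _).le
  · exact integrable_const _
  · exact Filter.Eventually.of_forall fun k => by fun_prop

lemma norm_centeredChar_le_one (t : ℝ) : ‖centeredChar p t‖ ≤ 1 := by
  refine (norm_integral_le_integral_norm _).trans ?_
  simp_rw [norm_cexp_eq]
  simp

lemma integral_cexp_eq_zero {d : ℕ} (hd : 0 < d) {m : ℤ} (hm : m ≠ 0) :
    ∫ t in (-(Real.pi / d))..(Real.pi / d),
      Complex.exp (((t * (d * m : ℝ) : ℝ) : ℂ) * Complex.I) = 0 := by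
  have hd' : (d : ℂ) ≠ 0 := by exact_mod_cast hd.ne'
  have hm' : (m : ℂ) ≠ 0 := by exact_mod_cast hm
  have h1 : ∀ t : ℝ, Complex.exp (((t * (d * m : ℝ) : ℝ) : ℂ) * Complex.I)
      = Complex.exp ((d * m * Complex.I) * t) := by intro t; congr 1; push_cast; ring
  simp_rw [h1]
  rw [integral_exp_mul_complex (by simp [hd', hm'])]
  have h2 : Complex.exp (d * m * Complex.I * ((Real.pi / d : ℝ) : ℂ))
      = Complex.exp (d * m * Complex.I * ((-(Real.pi / d) : ℝ) : ℂ)) := by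
    rw [Complex.exp_eq_exp_iff_exists_int]
    refine ⟨m, ?_⟩
    push_cast
    field_simp
    ring
  rw [h2, sub_self, zero_div]

/-- The series for `ψ^j e^{it(j-s)}` is integrated term by term. All its frequencies `k - s` are
multiples of `d`, so over one period of length `2π/d` only `k = s` contributes. -/
lemma integral_walk {d : ℕ} (hd : 0 < d) (hdvd : ∀ k, p k ≠ 0 → d ∣ k) (j : ℕ) {s : ℕ}
    (hs : d ∣ s) : (walkProb p j s : ℂ) * (2 * Real.pi / d)
      = ∫ t in (-(Real.pi / d))..(Real.pi / d), centeredChar p t ^ j *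
        Complex.exp (((t * ((j : ℝ) - s) : ℝ) : ℂ) * Complex.I) := by
  set L := Real.pi / d with hL
  set F : ℕ → ℝ → ℂ := fun k t => (walkProb p j k : ℂ) *
    Complex.exp (((t * ((k : ℝ) - s) : ℝ) : ℂ) * Complex.I) with hF
  have hsum : ∀ t, HasSum (fun k => F k t) (centeredChar p t ^ j *
        Complex.exp (((t * ((j : ℝ) - s) : ℝ) : ℂ) * Complex.I)) := by
    intro t
    obtain ⟨h1, h2⟩ := summable_norm_mul_pow p (norm_cexp_eq t) j
    have h3 := h1.of_norm.hasSum
    rw [h2, tsum_mul_pow_eq, mul_pow] at h3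
    have h4 := h3.mul_right (Complex.exp (((-t * s : ℝ) : ℂ) * Complex.I))
    have e1 : (fun k => F k t) = fun k => (walkProb p j k : ℂ) *
        Complex.exp ((t : ℂ) * Complex.I) ^ k *
          Complex.exp (((-t * s : ℝ) : ℂ) * Complex.I) := by
      ext k
      rw [mul_assoc, ← Complex.exp_nat_mul, ← Complex.exp_add]
      simp only [hF]
      congr 2; push_cast; ring
    have e2 : Complex.exp (((t * ((j : ℝ) - s) : ℝ) : ℂ) * Complex.I)
        = Complex.exp ((t : ℂ) * Complex.I) ^ j *
          Complex.exp (((-t * s : ℝ) : ℂ) * Complex.I) := by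
      rw [← Complex.exp_nat_mul, ← Complex.exp_add]
      congr 1; push_cast; ring
    rw [e1, e2, ← mul_assoc, mul_comm (centeredChar p t ^ j)]
    exact h4
  have hint := intervalIntegral.hasSum_integral_of_dominated_convergence
    (μ := volume) (a := -L) (b := L) (F := F) (fun k _ => walkProb p j k)
    (fun k => by
      apply Continuous.aestronglyMeasurable
      simp only [hF]; fun_prop)
    (fun k => Filter.Eventually.of_forall fun t _ => by
      simp only [hF]
      rw [norm_mul, norm_cexp_eq, mul_one, Complex.norm_real,
        Real.norm_of_nonneg (walkProb_nonneg p j k)])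
    (Filter.Eventually.of_forall fun t _ => by
      have := (summable_norm_mul_pow p (z := 1) (by simp) j).1
      simp only [one_pow, mul_one, Complex.norm_real] at this
      exact this.of_norm)
    (by simp)
    (Filter.Eventually.of_forall fun t _ => hsum t)
  rw [← hint.tsum_eq, tsum_eq_single s]
  · simp only [hF, sub_self, mul_zero, Complex.ofReal_zero, zero_mul, Complex.exp_zero, mul_one]
    rw [intervalIntegral.integral_const, Complex.real_smul, hL]
    push_cast; ring
  · intro k hk
    simp only [hF]
    by_cases h0 : walkProb p j k = 0
    · simp [h0]
    · obtain ⟨a, ha⟩ := dvd_of_walkProb_ne_zero p hdvd h0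
      obtain ⟨b, hb⟩ := hs
      have h1 : ((k : ℝ) - s) = d * ((a - b : ℤ) : ℝ) := by
        rw [ha, hb]; push_cast; ring
      rw [intervalIntegral.integral_const_mul, h1, integral_cexp_eq_zero hd, mul_zero]
      intro h
      apply hk
      rw [ha, hb]
      have : (a : ℤ) = b := by omega
      norm_cast at this
      rw [this]

end PlaneTree

namespace PlaneTree

variable (p : PMF ℕ)

/-! ### The characteristic function of the offspring distribution -/

/-- For `|x| ≤ 1` the remainder is cubic, for `|x| ≥ 1` it is at most quadratic; both are dominated
by `|x| ^ (2 + η)` when `0 ≤ η ≤ 1`. -/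
lemma norm_cexp_sub_taylor_le {η : ℝ} (h0 : 0 ≤ η) (h1 : η ≤ 1) (x : ℝ) :
    ‖Complex.exp ((x : ℂ) * Complex.I) - 1 - x * Complex.I + x ^ 2 / 2‖ ≤ 4 * |x| ^ (2 + η) := by
  rcases le_total |x| 1 with hx | hx
  · have hb := Complex.exp_bound (x := (x : ℂ) * Complex.I) (by simpa using hx)
      (n := 3) (by norm_num)
    have e : Complex.exp ((x : ℂ) * Complex.I) - 1 - x * Complex.I + x ^ 2 / 2
        = Complex.exp ((x : ℂ) * Complex.I)
          - ∑ m ∈ Finset.range 3, ((x : ℂ) * Complex.I) ^ m / (m.factorial : ℂ) := by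
      simp [Finset.sum_range_succ, Nat.factorial, mul_pow]
      ring
    rw [e]
    refine hb.trans ?_
    have h3 : |x| ^ (3 : ℕ) ≤ |x| ^ (2 + η) := by
      rw [← Real.rpow_natCast]
      rcases (abs_nonneg x).eq_or_lt with h | h
      · rw [← h, Real.zero_rpow (by norm_num), Real.zero_rpow (by linarith)]
      · exact Real.rpow_le_rpow_of_exponent_ge h hx (by push_cast; linarith)
    have h4 : 0 ≤ |x| ^ (3 : ℕ) := by positivity
    have h5 : ‖(x : ℂ) * Complex.I‖ = |x| := by simp
    rw [h5]
    norm_num [Nat.factorial]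
    linarith
  · have h2 : |x| ^ (2 : ℕ) ≤ |x| ^ (2 + η) := by
      rw [← Real.rpow_natCast]
      exact Real.rpow_le_rpow_of_exponent_le hx (by push_cast; linarith)
    have h5 : ‖(x : ℂ) ^ 2 / 2‖ = |x| ^ 2 / 2 := by simp
    calc _ ≤ ‖Complex.exp ((x : ℂ) * Complex.I)‖ + ‖(1 : ℂ)‖ + ‖(x : ℂ) * Complex.I‖
          + ‖(x : ℂ) ^ 2 / 2‖ :=
          (norm_add_le _ _).trans (add_le_add_left ((norm_sub_le _ _).trans
            (add_le_add_left (norm_sub_le _ _) _)) _)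
      _ = 1 + 1 + |x| + |x| ^ 2 / 2 := by rw [norm_cexp_eq, h5]; simp
      _ ≤ 4 * |x| ^ 2 := by nlinarith
      _ ≤ _ := by linarith

lemma exists_char_expansion {δ : ℝ} (hδ : 0 < δ)
    (hmean : ∫ k : ℕ, (k : ℝ) ∂p.toMeasure = 1)
    (hvar : 0 < Var[fun k : ℕ => (k : ℝ); p.toMeasure])
    (hmom : Integrable (fun k : ℕ => (k : ℝ) ^ (2 + δ)) p.toMeasure) :
    ∃ σ2 η K : ℝ, 0 < σ2 ∧ 0 < η ∧ η ≤ 1 ∧ 0 ≤ K ∧ ∀ t : ℝ,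
      ‖centeredChar p t - (1 - σ2 * t ^ 2 / 2 : ℝ)‖ ≤ K * |t| ^ (2 + η) := by
  -- The second-order Taylor remainder is cubic near zero, so no exponent above 3 can be exploited.
  set η := min δ 1 with hη
  have hη0 : 0 < η := lt_min hδ one_pos
  have hη1 : η ≤ 1 := min_le_right _ _
  have hmeas : ∀ f : ℕ → ℝ, AEStronglyMeasurable f p.toMeasure :=
    fun f => measurable_from_top.aestronglyMeasurable
  set X : ℕ → ℝ := fun k => (k : ℝ) - 1 with hX
  have hI : Integrable (fun k => |X k| ^ (2 + η)) p.toMeasure := by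
    refine Integrable.mono' (hmom.add (integrable_const 1)) (hmeas _)
      (Filter.Eventually.of_forall fun k => ?_)
    have h0 : 0 ≤ |X k| ^ (2 + η) := by positivity
    rw [Real.norm_of_nonneg h0, Pi.add_apply]
    rcases k with _ | k
    · simp only [hX]; norm_num; positivity
    · have h1 : X (k + 1) = k := by simp [hX]
      rw [h1, abs_of_nonneg (by positivity)]
      have h2 : (k : ℝ) ^ (2 + η) ≤ ((k + 1 : ℕ) : ℝ) ^ (2 + η) :=
        Real.rpow_le_rpow (by positivity) (by push_cast; linarith) (by linarith)
      have h3 : ((k + 1 : ℕ) : ℝ) ^ (2 + η) ≤ ((k + 1 : ℕ) : ℝ) ^ (2 + δ) :=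
        Real.rpow_le_rpow_of_exponent_le (by push_cast; linarith [k.cast_nonneg (α := ℝ)])
          (by linarith [min_le_left δ 1])
      linarith
  have hpow : ∀ k, |X k| ^ (2 : ℕ) ≤ 1 + |X k| ^ (2 + η) := by
    intro k
    have h0 : 0 ≤ |X k| ^ (2 + η) := by positivity
    rcases le_total |X k| 1 with h | h
    · have := pow_le_one₀ (n := 2) (abs_nonneg (X k)) h; linarith
    · have : |X k| ^ (2 : ℕ) ≤ |X k| ^ (2 + η) := by
        rw [← Real.rpow_natCast]
        exact Real.rpow_le_rpow_of_exponent_le h (by push_cast; linarith)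
      linarith
  have hI2 : Integrable (fun k => X k ^ 2) p.toMeasure := by
    refine Integrable.mono' ((integrable_const 1).add hI) (hmeas _)
      (Filter.Eventually.of_forall fun k => ?_)
    rw [norm_pow, Real.norm_eq_abs]
    exact hpow k
  have hI1 : Integrable X p.toMeasure := by
    refine Integrable.mono' ((integrable_const 2).add hI) (hmeas _)
      (Filter.Eventually.of_forall fun k => ?_)
    rw [Real.norm_eq_abs, Pi.add_apply]
    nlinarith [hpow k, abs_nonneg (X k), sq_nonneg (|X k| - 1)]
  have hX0 : ∫ k, X k ∂p.toMeasure = 0 := by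
    have hk : Integrable (fun k : ℕ => (k : ℝ)) p.toMeasure := by
      have := hI1.add (integrable_const 1)
      refine this.congr (Filter.Eventually.of_forall fun k => ?_)
      simp [hX]
    simp only [hX]
    rw [integral_sub hk (integrable_const 1), hmean]; simp
  have hX2 : ∫ k, X k ^ 2 ∂p.toMeasure = Var[fun k : ℕ => (k : ℝ); p.toMeasure] := by
    rw [variance_eq_integral measurable_from_top.aemeasurable, hmean]
  refine ⟨Var[fun k : ℕ => (k : ℝ); p.toMeasure], η, 4 * ∫ k, |X k| ^ (2 + η) ∂p.toMeasure,
    hvar, hη0, hη1, by positivity, fun t => ?_⟩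
  have e : centeredChar p t - (1 - Var[fun k : ℕ => (k : ℝ); p.toMeasure] * t ^ 2 / 2 : ℝ)
      = ∫ k, (Complex.exp (((t * X k : ℝ) : ℂ) * Complex.I) - 1
        - (t * X k : ℝ) * Complex.I + (t * X k : ℝ) ^ 2 / 2) ∂p.toMeasure := by
    have i1 := integrable_cexp p t
    have i2 : Integrable (fun _ : ℕ => (1 : ℂ)) p.toMeasure := integrable_const 1
    have i3 : Integrable (fun k : ℕ => ((t * X k : ℝ) : ℂ) * Complex.I) p.toMeasure :=
      ((hI1.const_mul t).ofReal).mul_const _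
    have i4 : Integrable (fun k : ℕ => ((t * X k : ℝ) : ℂ) ^ 2 / 2) p.toMeasure := by
      have := ((hI2.const_mul (t ^ 2 / 2)).ofReal (𝕜 := ℂ))
      refine this.congr (Filter.Eventually.of_forall fun k => ?_)
      simp only [RCLike.ofReal_mul, RCLike.ofReal_pow]
      push_cast; simp; ring
    have e4 : ∫ k, ((t * X k : ℝ) : ℂ) ^ 2 / 2 ∂p.toMeasure
        = ((∫ k, t ^ 2 / 2 * X k ^ 2 ∂p.toMeasure : ℝ) : ℂ) := by
      rw [← integral_complex_ofReal]
      refine integral_congr_ae (Filter.Eventually.of_forall fun k => ?_)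
      push_cast; ring
    have e3 : ∫ k, ((t * X k : ℝ) : ℂ) * Complex.I ∂p.toMeasure = 0 := by
      rw [integral_mul_const, integral_complex_ofReal, integral_const_mul, hX0]; simp
    have i12 := i1.sub i2
    have i123 := i12.sub i3
    have s1 := integral_add i123 i4
    have s2 := integral_sub i12 i3
    have s3 := integral_sub i1 i2
    simp only [Pi.sub_apply] at s1 s2 s3
    rw [s1, s2, s3, e3, e4, integral_const_mul, hX2, centeredChar]
    simp
    ring
  rw [e]
  refine (norm_integral_le_of_norm_le ((hI.const_mul (4 * |t| ^ (2 + η))))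
    (Filter.Eventually.of_forall fun k => ?_)).trans (le_of_eq ?_)
  · refine (norm_cexp_sub_taylor_le hη0.le hη1 (t * X k)).trans (le_of_eq ?_)
    rw [abs_mul, Real.mul_rpow (abs_nonneg _) (abs_nonneg _)]; ring
  · rw [integral_const_mul]; ring

/-- The support of the offspring distribution spans a lattice on which the characteristic
function is aperiodic. -/
lemma exists_span (hmean : ∫ k : ℕ, (k : ℝ) ∂p.toMeasure = 1) :
    ∃ d : ℕ, 0 < d ∧ (∀ k, p k ≠ 0 → d ∣ k) ∧ ∀ t : ℝ, |t| ≤ Real.pi / d →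
      (∀ k, p k ≠ 0 → ∃ m : ℤ, t * k = 2 * Real.pi * m) → t = 0 := by
  -- The span is the generator of the subgroup generated by the support. It is nonzero because the
  -- mean is 1.
  set H : AddSubgroup ℤ := AddSubgroup.closure {z | ∃ k : ℕ, p k ≠ 0 ∧ z = k} with hH
  obtain ⟨a, ha⟩ := Int.subgroup_cyclic H
  have hmem : ∀ k : ℕ, p k ≠ 0 → (a : ℤ) ∣ k := by
    intro k hk
    have : (k : ℤ) ∈ H := AddSubgroup.subset_closure ⟨k, hk, rfl⟩
    rw [ha, AddSubgroup.mem_closure_singleton] at this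
    obtain ⟨n, hn⟩ := this
    exact ⟨n, by rw [← hn]; simp [mul_comm]⟩
  have ha0 : a ≠ 0 := by
    rintro rfl
    have h0 : ∀ k : ℕ, p k ≠ 0 → k = 0 := fun k hk => by simpa using hmem k hk
    have : ∫ k : ℕ, (k : ℝ) ∂p.toMeasure = 0 := by
      refine integral_eq_zero_of_ae ?_
      rw [Filter.EventuallyEq, ae_iff]
      rw [PMF.toMeasure_apply_eq_zero_iff _ (by trivial)]
      rw [Set.disjoint_left]
      intro k hk h
      rw [PMF.mem_support_iff] at hk
      simp [h0 k hk] at h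
    linarith
  refine ⟨a.natAbs, Int.natAbs_pos.2 ha0, fun k hk => by
    have := hmem k hk; exact Int.natAbs_dvd_natAbs.2 this, fun t ht h => ?_⟩
  have hsub : ∀ z ∈ H, ∃ m : ℤ, t * z = 2 * Real.pi * m := by
    intro z hz
    refine AddSubgroup.closure_induction (p := fun (z : ℤ) _ => ∃ m : ℤ, t * (z : ℝ) = 2 * Real.pi * m)
      ?_ ?_ ?_ ?_ hz
    · rintro _ ⟨k, hk, rfl⟩; simpa using h k hk
    · exact ⟨0, by simp⟩
    · rintro x y _ _ ⟨m, hm⟩ ⟨n, hn⟩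
      exact ⟨m + n, by push_cast; linear_combination hm + hn⟩
    · rintro x _ ⟨m, hm⟩
      exact ⟨-m, by push_cast; linear_combination -hm⟩
  have haH : a ∈ H := by rw [ha]; exact AddSubgroup.mem_closure_singleton_self a
  obtain ⟨m, hm⟩ := hsub a haH
  have hd : (0 : ℝ) < a.natAbs := by exact_mod_cast Int.natAbs_pos.2 ha0
  have h1 : |t * a| ≤ Real.pi := by
    have e : |(a : ℝ)| = a.natAbs := by
      rw [← Int.cast_abs, Int.abs_eq_natAbs, Int.cast_natCast]
    rw [abs_mul, e]
    exact (le_div_iff₀ hd).1 ht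
  rw [hm, abs_mul, abs_of_pos (by positivity)] at h1
  -- `t a = 2πm` with `|t a| ≤ π` leaves only `m = 0`.
  have h2 : m = 0 := by
    by_contra hne
    have : (1 : ℝ) ≤ |(m : ℝ)| := by exact_mod_cast Int.one_le_abs hne
    nlinarith [Real.pi_pos]
  rw [h2] at hm
  have ha' : (a : ℝ) ≠ 0 := by exact_mod_cast ha0
  simpa [ha'] using hm

/-- Otherwise the offspring number is at least 1 with mean 1, hence almost surely 1, and the
variance vanishes. -/
lemma apply_zero_ne_zero (hmean : ∫ k : ℕ, (k : ℝ) ∂p.toMeasure = 1)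
    (hvar : 0 < Var[fun k : ℕ => (k : ℝ); p.toMeasure]) : p 0 ≠ 0 := by
  intro h0
  have hint : Integrable (fun k : ℕ => (k : ℝ)) p.toMeasure := by
    by_contra h; rw [integral_undef h] at hmean; norm_num at hmean
  have hae : ∀ᵐ k ∂p.toMeasure, k ≠ 0 := by
    rw [ae_iff, PMF.toMeasure_apply_eq_zero_iff _ (by trivial), Set.disjoint_left]
    intro k hk h
    simp only [ne_eq, not_not, Set.mem_ofPred_eq] at h
    rw [h, PMF.mem_support_iff] at hk
    exact hk h0
  have h1 : ∫ k : ℕ, ((k : ℝ) - 1) ∂p.toMeasure = 0 := by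
    rw [integral_sub hint (integrable_const 1), hmean]; simp
  have h2 : 0 ≤ᵐ[p.toMeasure] fun k : ℕ => (k : ℝ) - 1 := by
    filter_upwards [hae] with k hk
    have : (1 : ℝ) ≤ k := by exact_mod_cast Nat.one_le_iff_ne_zero.2 hk
    simpa using this
  have h3 := (integral_eq_zero_iff_of_nonneg_ae h2 (hint.sub (integrable_const 1))).1 h1
  rw [variance_eq_integral measurable_from_top.aemeasurable, hmean] at hvar
  have h4 : ∫ k : ℕ, ((k : ℝ) - 1) ^ 2 ∂p.toMeasure = 0 := by
    refine integral_eq_zero_of_ae ?_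
    filter_upwards [h3] with k hk
    simp only [Pi.zero_apply] at hk ⊢
    rw [hk]; norm_num
  linarith

/-- Equality in the triangle inequality would make `e^{it(k-1)}` constant on the support. Since 0 is
in the support, `tk` would then lie in `2πℤ` for every `k` there, which the span forbids for `t ≠
0`. -/
lemma norm_centeredChar_lt_one (hmean : ∫ k : ℕ, (k : ℝ) ∂p.toMeasure = 1)
    (hvar : 0 < Var[fun k : ℕ => (k : ℝ); p.toMeasure]) {d : ℕ}
    (hd : ∀ t : ℝ, |t| ≤ Real.pi / d →
      (∀ k, p k ≠ 0 → ∃ m : ℤ, t * k = 2 * Real.pi * m) → t = 0)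
    {t : ℝ} (ht : |t| ≤ Real.pi / d) (ht0 : t ≠ 0) : ‖centeredChar p t‖ < 1 := by
  refine lt_of_le_of_ne (norm_centeredChar_le_one p t) fun h1 => ht0 (hd t ht ?_)
  set u := centeredChar p t with hu
  set E : ℕ → ℂ := fun k => Complex.exp (((t * ((k : ℝ) - 1) : ℝ) : ℂ) * Complex.I) with hE
  have hEn : ∀ k, ‖E k‖ = 1 := fun k => norm_cexp_eq _
  have hi : Integrable (fun k => (starRingEnd ℂ u) * E k) p.toMeasure :=
    (integrable_cexp p t).const_mul _
  have hle : ∀ k, ((starRingEnd ℂ u) * E k).re ≤ 1 := fun k => by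
    refine (Complex.re_le_norm _).trans ?_
    rw [norm_mul, hEn, mul_one, RCLike.norm_conj, h1]
  have hint : ∫ k, ((starRingEnd ℂ u) * E k).re ∂p.toMeasure = 1 := by
    have := integral_re hi
    simp only [RCLike.re_eq_complex_re] at this
    rw [this, integral_const_mul]
    change ((starRingEnd ℂ u) * u).re = 1
    rw [mul_comm, Complex.mul_conj, Complex.normSq_eq_norm_sq, h1]; simp
  have hre : Integrable (fun k => ((starRingEnd ℂ u) * E k).re) p.toMeasure := hi.re
  have hz : ∫ k, (1 - ((starRingEnd ℂ u) * E k).re) ∂p.toMeasure = 0 := by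
    rw [integral_sub (integrable_const 1) hre, hint]; simp
  have hae := (integral_eq_zero_iff_of_nonneg (fun k => sub_nonneg.2 (hle k))
    ((integrable_const 1).sub hre)).1 hz
  have hall : ∀ k, p k ≠ 0 → E k = u := by
    intro k hk
    have h2 : ((starRingEnd ℂ u) * E k).re = 1 := by
      by_contra hne
      rw [Filter.EventuallyEq, ae_iff, PMF.toMeasure_apply_eq_zero_iff _ (by trivial),
        Set.disjoint_left] at hae
      refine hae ((PMF.mem_support_iff _ _).2 hk) ?_
      simp only [Set.mem_ofPred_eq, Pi.zero_apply]
      intro h; apply hne; linarith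
    have h3 : ‖E k - u‖ ^ 2 = 0 := by
      have e1 : ‖E k‖ ^ 2 = 1 := by rw [hEn]; norm_num
      have e2 : ‖u‖ ^ 2 = 1 := by rw [h1]; norm_num
      rw [← Complex.normSq_eq_norm_sq, Complex.normSq_apply] at e1 e2 ⊢
      simp only [Complex.mul_re, Complex.conj_re, Complex.conj_im] at h2
      simp only [Complex.sub_re, Complex.sub_im]
      nlinarith
    exact sub_eq_zero.1 (norm_eq_zero.1 (pow_eq_zero_iff (by norm_num) |>.1 h3))
  intro k hk
  have h4 : E k = E 0 := (hall k hk).trans (hall 0 (apply_zero_ne_zero p hmean hvar)).symm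
  simp only [hE] at h4
  rw [Complex.exp_eq_exp_iff_exists_int] at h4
  obtain ⟨m, hm⟩ := h4
  refine ⟨m, ?_⟩
  have h5 := congrArg Complex.im hm
  simp at h5
  linarith

/-- The estimates on the characteristic function used in the local limit estimates. -/
structure CharBounds (d : ℕ) (c σ2 η K : ℝ) : Prop where
  d_pos : 0 < d
  c_pos : 0 < c
  η_pos : 0 < η
  η_le : η ≤ 1
  K_pos : 0 < K
  c_le : c ≤ σ2 / 2
  dvd : ∀ k, p k ≠ 0 → d ∣ k
  norm_le : ∀ t : ℝ, |t| ≤ Real.pi / d → ‖centeredChar p t‖ ≤ Real.exp (-c * t ^ 2)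
  one_sub_le : ∀ t : ℝ, |t| ≤ Real.pi / d → ‖1 - centeredChar p t‖ ≤ K * t ^ 2
  sub_gauss_le : ∀ t : ℝ, |t| ≤ Real.pi / d →
    ‖centeredChar p t - Real.exp (-(σ2 / 2) * t ^ 2)‖ ≤ K * |t| ^ (2 + η)

/-- The expansion at zero controls small `t`; compactness together with aperiodicity gives a uniform
gap below 1 on the rest of the interval. -/
lemma exists_charBounds {δ : ℝ} (hδ : 0 < δ)
    (hmean : ∫ k : ℕ, (k : ℝ) ∂p.toMeasure = 1)
    (hvar : 0 < Var[fun k : ℕ => (k : ℝ); p.toMeasure])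
    (hmom : Integrable (fun k : ℕ => (k : ℝ) ^ (2 + δ)) p.toMeasure) :
    ∃ (d : ℕ) (c σ2 η K : ℝ), CharBounds p d c σ2 η K := by
  obtain ⟨σ2, η, K, hσ, hη, hη1, hK, hexp⟩ := exists_char_expansion p hδ hmean hvar hmom
  obtain ⟨d, hd, hdvd, hspan⟩ := exists_span p hmean
  have hdR : (0 : ℝ) < d := by exact_mod_cast hd
  set L := Real.pi / d with hL
  have hL0 : 0 < L := by positivity
  -- behaviour near zero
  obtain ⟨ε, hε0, hε⟩ : ∃ ε > 0, ∀ t : ℝ, |t| ≤ ε →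
      K * |t| ^ (2 + η) ≤ σ2 / 4 * t ^ 2 ∧ σ2 * t ^ 2 / 2 ≤ 1 := by
    have hlim : Filter.Tendsto (fun x : ℝ => K * |x| ^ η) (nhds 0) (nhds 0) := by
      have : Continuous fun x : ℝ => K * |x| ^ η :=
        continuous_const.mul (continuous_abs.rpow_const fun _ => Or.inr hη.le)
      simpa [Real.zero_rpow hη.ne'] using this.tendsto 0
    have hlim2 : Filter.Tendsto (fun x : ℝ => σ2 * x ^ 2 / 2) (nhds 0) (nhds 0) := by
      have : Continuous fun x : ℝ => σ2 * x ^ 2 / 2 := by fun_prop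
      simpa using this.tendsto 0
    have hev := (hlim.eventually_le_const (show (0 : ℝ) < σ2 / 4 by positivity)).and
      (hlim2.eventually_le_const one_pos)
    obtain ⟨ε, hε0, hε⟩ := Metric.eventually_nhds_iff.1 hev
    refine ⟨ε / 2, by positivity, fun t ht => ?_⟩
    obtain ⟨h1, h2⟩ := hε (y := t) (by rw [Real.dist_eq, sub_zero]; linarith)
    refine ⟨?_, h2⟩
    rw [Real.rpow_add_of_nonneg (abs_nonneg t) (by norm_num) hη.le]
    have : |t| ^ (2 : ℝ) = t ^ 2 := by rw [Real.rpow_two, sq_abs]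
    rw [this]
    nlinarith [sq_nonneg t]
  have hnear : ∀ t : ℝ, |t| ≤ ε → ‖centeredChar p t‖ ≤ 1 - σ2 / 4 * t ^ 2 := by
    intro t ht
    obtain ⟨h1, h2⟩ := hε t ht
    have h3 : ‖((1 - σ2 * t ^ 2 / 2 : ℝ) : ℂ)‖ = 1 - σ2 * t ^ 2 / 2 := by
      rw [Complex.norm_real, Real.norm_of_nonneg (by linarith)]
    have h4 := norm_add_le (centeredChar p t - (1 - σ2 * t ^ 2 / 2 : ℝ))
      ((1 - σ2 * t ^ 2 / 2 : ℝ) : ℂ)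
    rw [sub_add_cancel, h3] at h4
    linarith [hexp t]
  -- behaviour away from zero
  obtain ⟨ρ, hρ1, hρ⟩ : ∃ ρ < 1, ∀ t : ℝ, |t| ≤ L → ε ≤ |t| → ‖centeredChar p t‖ ≤ ρ := by
    have hcomp : IsCompact {t : ℝ | |t| ≤ L ∧ ε ≤ |t|} := by
      refine Metric.isCompact_of_isClosed_isBounded ?_ ?_
      · exact (isClosed_le continuous_abs continuous_const).inter
          (isClosed_le continuous_const continuous_abs)
      · refine (Metric.isBounded_closedBall (x := (0 : ℝ)) (r := L)).subset fun t ht => ?_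
        simpa using ht.1
    rcases Set.eq_empty_or_nonempty {t : ℝ | |t| ≤ L ∧ ε ≤ |t|} with he | hne
    · refine ⟨0, one_pos, fun t h1 h2 => ?_⟩
      have : t ∈ ({t : ℝ | |t| ≤ L ∧ ε ≤ |t|}) := ⟨h1, h2⟩
      rw [he] at this; exact this.elim
    · obtain ⟨t0, ht0, hmax⟩ := hcomp.exists_isMaxOn hne
        (continuous_centeredChar p).norm.continuousOn
      refine ⟨_, norm_centeredChar_lt_one p hmean hvar hspan ht0.1 ?_, fun t h1 h2 => hmax ⟨h1, h2⟩⟩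
      rintro rfl
      have := ht0.2
      simp at this; linarith
  -- The first entry serves `|t| ≤ ε`; the second gives `c t² ≤ 1 - ρ` on the whole interval.
  set c := min (σ2 / 4) ((1 - ρ) / L ^ 2) with hc
  have hc0 : 0 < c := lt_min (by positivity) (div_pos (by linarith) (by positivity))
  have hL2 : ∀ t : ℝ, |t| ≤ L → t ^ 2 ≤ L ^ 2 := fun t ht => by
    rw [← sq_abs]; exact pow_le_pow_left₀ (abs_nonneg t) ht 2
  -- A sum of the constants needed separately for `1 - ψ` and for the Gaussian comparison.
  set K1 := K + σ2 ^ 2 * (1 + L ^ 2) + K * (1 + L) + σ2 with hK1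
  refine ⟨d, c, σ2, η, K1, hd, hc0, hη, hη1, by positivity, ?_, hdvd, ?_, ?_, ?_⟩
  · linarith [min_le_left (σ2 / 4) ((1 - ρ) / L ^ 2)]
  · intro t ht
    have h1 : 1 - c * t ^ 2 ≤ Real.exp (-c * t ^ 2) := by
      have := Real.add_one_le_exp (-c * t ^ 2); linarith
    refine le_trans ?_ h1
    rcases le_total |t| ε with h | h
    · have := min_le_left (σ2 / 4) ((1 - ρ) / L ^ 2)
      nlinarith [hnear t h, sq_nonneg t]
    · have h2 : c * t ^ 2 ≤ 1 - ρ := by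
        calc c * t ^ 2 ≤ (1 - ρ) / L ^ 2 * L ^ 2 :=
              mul_le_mul (min_le_right _ _) (hL2 t ht) (sq_nonneg t)
                (div_nonneg (by linarith) (by positivity))
          _ = 1 - ρ := div_mul_cancel₀ _ (by positivity)
      linarith [hρ t ht h]
  · intro t ht
    have h1 : |t| ^ (2 + η) ≤ (1 + L) * t ^ 2 := by
      rw [Real.rpow_add_of_nonneg (abs_nonneg t) (by norm_num) hη.le, Real.rpow_two, sq_abs,
        mul_comm]
      refine mul_le_mul_of_nonneg_right ?_ (sq_nonneg t)
      rcases le_total |t| 1 with h | h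
      · linarith [Real.rpow_le_one (abs_nonneg t) h hη.le]
      · have := Real.rpow_le_rpow_of_exponent_le h hη1
        rw [Real.rpow_one] at this; linarith
    have h2 := norm_sub_le (((1 : ℝ) : ℂ) - (1 - σ2 * t ^ 2 / 2 : ℝ))
      (centeredChar p t - (1 - σ2 * t ^ 2 / 2 : ℝ))
    have h3 : ‖((1 : ℝ) : ℂ) - (1 - σ2 * t ^ 2 / 2 : ℝ)‖ = σ2 * t ^ 2 / 2 := by
      rw [← Complex.ofReal_sub, Complex.norm_real, Real.norm_of_nonneg (by ring_nf; positivity)]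
      ring
    rw [sub_sub_sub_cancel_right, h3, Complex.ofReal_one] at h2
    have h4 := mul_le_mul_of_nonneg_left h1 hK
    have h5 : 0 ≤ (K + σ2 ^ 2 * (1 + L ^ 2) + σ2 / 2) * t ^ 2 := by positivity
    rw [hK1]
    linarith [hexp t]
  · intro t ht
    set y := σ2 / 2 * t ^ 2 with hy
    have hy0 : 0 ≤ y := by positivity
    have h1 : |Real.exp (-(σ2 / 2) * t ^ 2) - (1 - σ2 * t ^ 2 / 2)| ≤ y ^ 2 := by
      have e1 : -(σ2 / 2) * t ^ 2 = -y := by rw [hy]; ring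
      have e2 : σ2 * t ^ 2 / 2 = y := by rw [hy]; ring
      rw [e1, e2]
      rcases le_total y 1 with h | h
      · have := Real.abs_exp_sub_one_sub_id_le (x := -y) (by rw [abs_neg, abs_of_nonneg hy0]; exact h)
        rw [neg_sq] at this
        convert this using 2; ring
      · have h6 := Real.exp_pos (-y)
        have h7 : Real.exp (-y) ≤ 1 := Real.exp_le_one_iff.2 (by linarith)
        rw [abs_le]; constructor <;> nlinarith
    have h2 : y ^ 2 ≤ σ2 ^ 2 * (1 + L ^ 2) * |t| ^ (2 + η) := by
      have e : y ^ 2 = σ2 ^ 2 / 4 * (t ^ 2 * t ^ 2) := by rw [hy]; ring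
      rw [e, Real.rpow_add_of_nonneg (abs_nonneg t) (by norm_num) hη.le, Real.rpow_two, sq_abs]
      have h3 : t ^ 2 ≤ (1 + L ^ 2) * |t| ^ η := by
        rcases le_total |t| 1 with h | h
        · rcases (abs_nonneg t).eq_or_lt with h0 | h0
          · have : t = 0 := abs_eq_zero.1 h0.symm
            simp [this]; positivity
          · have h8 : |t| ^ (2 : ℝ) ≤ |t| ^ η := Real.rpow_le_rpow_of_exponent_ge h0 h (by linarith)
            rw [Real.rpow_two, sq_abs] at h8
            have : 0 ≤ L ^ 2 * |t| ^ η := by positivity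
            linarith
        · have h8 : 1 ≤ |t| ^ η := Real.one_le_rpow h hη.le
          nlinarith [hL2 t ht, sq_nonneg L]
      have h9 := mul_le_mul_of_nonneg_left h3 (show 0 ≤ σ2 ^ 2 * t ^ 2 by positivity)
      have h10 : 0 ≤ σ2 ^ 2 * (t ^ 2 * t ^ 2) := by positivity
      nlinarith
    have h3 := norm_sub_le (centeredChar p t - (1 - σ2 * t ^ 2 / 2 : ℝ))
      ((Real.exp (-(σ2 / 2) * t ^ 2) : ℂ) - (1 - σ2 * t ^ 2 / 2 : ℝ))
    rw [sub_sub_sub_cancel_right, ← Complex.ofReal_sub, Complex.norm_real, Real.norm_eq_abs] at h3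
    have h5 : 0 ≤ (K * (1 + L) + σ2) * |t| ^ (2 + η) := by positivity
    rw [hK1]
    linarith [hexp t]

end PlaneTree

namespace PlaneTree

/-! ### Integrals against powers of a subgaussian function -/

/-- Bound `y ^ r` by `exp (r y)` and complete the square. -/
lemma rpow_mul_exp_neg_le {c r y : ℝ} (hc : 0 < c) (hr : 0 ≤ r) (hy : 0 ≤ y) :
    y ^ r * Real.exp (-(c / 2) * y ^ 2) ≤ Real.exp (r ^ 2 / (2 * c)) := by
  have h1 : y ^ r ≤ Real.exp (r * y) := by
    rcases hy.eq_or_lt with rfl | h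
    · rcases hr.eq_or_lt with rfl | h'
      · simp
      · rw [Real.zero_rpow h'.ne']; positivity
    · rw [Real.rpow_def_of_pos h]
      refine Real.exp_le_exp.2 ?_
      nlinarith [Real.log_le_sub_one_of_pos h]
  calc _ ≤ Real.exp (r * y) * Real.exp (-(c / 2) * y ^ 2) := by gcongr
    _ = Real.exp (r * y - c / 2 * y ^ 2) := by rw [← Real.exp_add]; ring_nf
    _ ≤ _ := by
      refine Real.exp_le_exp.2 ?_
      rw [le_div_iff₀ (by positivity)]
      nlinarith [sq_nonneg (r - c * y)]

/-- Rescale by `s = √(j + 1)`: half of the Gaussian absorbs `(s|t|) ^ r`, the other half is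
integrated over the line. Using `j + 1` includes `j = 0`, at the price of the factor `exp (c L²)`.
-/
lemma exists_norm_integral_le_rpow {c L r : ℝ} (hc : 0 < c) (hL : 0 ≤ L) (hr : 0 ≤ r) :
    ∃ C : ℝ, 0 < C ∧ ∀ (j : ℕ) (F : ℝ → ℂ) (B : ℝ), 0 ≤ B →
      (∀ t, |t| ≤ L → ‖F t‖ ≤ B * (|t| ^ r * Real.exp (-c * t ^ 2) ^ j)) →
      ‖∫ t in (-L)..L, F t‖ ≤ C * B * √(j + 1) ^ (-(r + 1)) := by
  refine ⟨Real.exp (c * L ^ 2) * Real.exp (r ^ 2 / (2 * c)) * √(Real.pi / (c / 2)),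
    by positivity, fun j F B hB hF => ?_⟩
  set s := √((j : ℝ) + 1) with hs
  have hs0 : 0 < s := by positivity
  have hs2 : s ^ 2 = j + 1 := Real.sq_sqrt (by positivity)
  set A := Real.exp (c * L ^ 2) * Real.exp (r ^ 2 / (2 * c)) * s ^ (-r) with hA
  have hbound : ∀ t, |t| ≤ L → ‖F t‖ ≤ B * A * Real.exp (-(c / 2 * s ^ 2) * t ^ 2) := by
    intro t ht
    refine (hF t ht).trans ?_
    rw [mul_assoc B A]
    refine mul_le_mul_of_nonneg_left ?_ hB
    have h1 : |t| ^ r = s ^ (-r) * (s * |t|) ^ r := by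
      rw [Real.mul_rpow hs0.le (abs_nonneg t), ← mul_assoc, ← Real.rpow_add hs0]; simp
    have ht2 : t ^ 2 ≤ L ^ 2 := by rw [← sq_abs]; exact pow_le_pow_left₀ (abs_nonneg t) ht 2
    have h2 : Real.exp (-c * t ^ 2) ^ j ≤ Real.exp (c * L ^ 2) *
        (Real.exp (-(c / 2) * (s * |t|) ^ 2) * Real.exp (-(c / 2 * s ^ 2) * t ^ 2)) := by
      rw [← Real.exp_nat_mul, ← Real.exp_add, ← Real.exp_add]
      refine Real.exp_le_exp.2 ?_
      rw [mul_pow, sq_abs, hs2]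
      nlinarith
    have h3 := rpow_mul_exp_neg_le hc hr (show 0 ≤ s * |t| by positivity)
    calc |t| ^ r * Real.exp (-c * t ^ 2) ^ j
        ≤ (s ^ (-r) * (s * |t|) ^ r) * (Real.exp (c * L ^ 2) *
          (Real.exp (-(c / 2) * (s * |t|) ^ 2) * Real.exp (-(c / 2 * s ^ 2) * t ^ 2))) := by
          rw [h1]; gcongr
      _ = Real.exp (c * L ^ 2) * s ^ (-r) * Real.exp (-(c / 2 * s ^ 2) * t ^ 2) *
          ((s * |t|) ^ r * Real.exp (-(c / 2) * (s * |t|) ^ 2)) := by ring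
      _ ≤ Real.exp (c * L ^ 2) * s ^ (-r) * Real.exp (-(c / 2 * s ^ 2) * t ^ 2) *
          Real.exp (r ^ 2 / (2 * c)) := by gcongr
      _ = _ := by rw [hA]; ring
  have hcs : 0 < c / 2 * s ^ 2 := by positivity
  have hgi := integrable_exp_neg_mul_sq hcs
  have h1 := intervalIntegral.norm_integral_le_of_norm_le (μ := volume) (f := F)
    (g := fun t => B * A * Real.exp (-(c / 2 * s ^ 2) * t ^ 2)) (show -L ≤ L by linarith)
    (Filter.Eventually.of_forall fun t ht => hbound t (abs_le.2 ⟨ht.1.le, ht.2⟩))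
    ((hgi.const_mul _).intervalIntegrable)
  refine h1.trans ?_
  rw [intervalIntegral.integral_const_mul, intervalIntegral.integral_of_le (by linarith)]
  have h2 := setIntegral_le_integral (s := Set.Ioc (-L) L) hgi
    (Filter.Eventually.of_forall fun t => (Real.exp_pos _).le)
  rw [integral_gaussian] at h2
  have h3 : √(Real.pi / (c / 2 * s ^ 2)) = √(Real.pi / (c / 2)) * s⁻¹ := by
    rw [← div_div, Real.sqrt_div (by positivity), Real.sqrt_sq hs0.le, div_eq_mul_inv]
  rw [h3] at h2
  have h4 : s ^ (-(r + 1)) = s ^ (-r) * s⁻¹ := by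
    rw [neg_add, Real.rpow_add hs0, Real.rpow_neg_one]
  have hA0 : 0 ≤ A := by positivity
  calc _ ≤ B * A * (√(Real.pi / (c / 2)) * s⁻¹) := mul_le_mul_of_nonneg_left h2 (by positivity)
    _ = _ := by rw [h4, hA]; ring

lemma exists_norm_integral_le_pow {c L : ℝ} (hc : 0 < c) (hL : 0 ≤ L) :
    ∃ C : ℝ, 0 < C ∧ ∀ r : ℕ, r ≤ 4 → ∀ (j : ℕ) (F : ℝ → ℂ) (B : ℝ), 0 ≤ B →
      (∀ t, |t| ≤ L → ‖F t‖ ≤ B * (|t| ^ r * Real.exp (-c * t ^ 2) ^ j)) →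
      ‖∫ t in (-L)..L, F t‖ ≤ C * B / √(j + 1) ^ (r + 1) := by
  choose C hC0 hC using fun r : ℕ =>
    exists_norm_integral_le_rpow hc hL (r := (r : ℝ)) (by positivity)
  refine ⟨∑ r ∈ Finset.range 5, C r, Finset.sum_pos (fun r _ => hC0 r) (by simp),
    fun r hr j F B hB hF => ?_⟩
  have h1 := hC r j F B hB (fun t ht => by simpa using hF t ht)
  have h2 : √((j : ℝ) + 1) ^ (-((r : ℝ) + 1)) = 1 / √((j : ℝ) + 1) ^ (r + 1) := by
    rw [Real.rpow_neg (by positivity), show ((r : ℝ) + 1) = ((r + 1 : ℕ) : ℝ) by push_cast; rfl,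
      Real.rpow_natCast, one_div]
  rw [h2, mul_one_div] at h1
  refine h1.trans ?_
  gcongr
  exact Finset.single_le_sum (fun r _ => (hC0 r).le) (Finset.mem_range.2 (by omega))

lemma norm_pow_sub_pow_le {a b : ℂ} {ρ : ℝ} (ha : ‖a‖ ≤ ρ) (hb : ‖b‖ ≤ ρ) (n : ℕ) :
    ‖a ^ (n + 1) - b ^ (n + 1)‖ ≤ (n + 1) * ρ ^ n * ‖a - b‖ := by
  have hρ : 0 ≤ ρ := (norm_nonneg a).trans ha
  induction n with
  | zero => simp
  | succ n ih =>
    have e : a ^ (n + 1 + 1) - b ^ (n + 1 + 1)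
        = a * (a ^ (n + 1) - b ^ (n + 1)) + (a - b) * b ^ (n + 1) := by ring
    rw [e]
    have h1 : ‖b ^ (n + 1)‖ ≤ ρ ^ (n + 1) := by
      rw [norm_pow]; exact pow_le_pow_left₀ (norm_nonneg b) hb _
    calc _ ≤ ‖a‖ * ‖a ^ (n + 1) - b ^ (n + 1)‖ + ‖a - b‖ * ‖b ^ (n + 1)‖ :=
          (norm_add_le _ _).trans (by rw [norm_mul, norm_mul])
      _ ≤ ρ * ((n + 1) * ρ ^ n * ‖a - b‖) + ‖a - b‖ * ρ ^ (n + 1) := by gcongr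
      _ = _ := by push_cast; ring

lemma norm_one_sub_pow_le {a : ℂ} (ha : ‖a‖ ≤ 1) (n : ℕ) : ‖1 - a ^ n‖ ≤ n * ‖1 - a‖ := by
  cases n with
  | zero => simp
  | succ n =>
    have := norm_pow_sub_pow_le (a := 1) (b := a) (ρ := 1) (by simp) ha n
    simpa using this

lemma norm_cexp_sub_one_le (x : ℝ) : ‖Complex.exp ((x : ℂ) * Complex.I) - 1‖ ≤ |x| := by
  rw [mul_comm]; exact Real.norm_exp_I_mul_ofReal_sub_one_le

lemma norm_cexp_add_cexp_sub_two_le (x : ℝ) :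
    ‖Complex.exp ((x : ℂ) * Complex.I) + Complex.exp (((-x : ℝ) : ℂ) * Complex.I) - 2‖
      ≤ x ^ 2 := by
  have e : Complex.exp ((x : ℂ) * Complex.I) + Complex.exp (((-x : ℝ) : ℂ) * Complex.I) - 2
      = ((2 * Real.cos x - 2 : ℝ) : ℂ) := by
    push_cast
    rw [Complex.two_cos]
  rw [e, Complex.norm_real, Real.norm_eq_abs, abs_le]
  constructor <;> nlinarith [Real.one_sub_sq_div_two_le_cos (x := x), Real.cos_le_one x]

lemma norm_cexp_sub_one_sub_le (x : ℝ) :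
    ‖Complex.exp ((x : ℂ) * Complex.I) - 1 - x * Complex.I‖ ≤ 5 * x ^ 2 := by
  have h := norm_cexp_sub_taylor_le (η := 0) le_rfl zero_le_one x
  have e : Complex.exp ((x : ℂ) * Complex.I) - 1 - x * Complex.I
      = (Complex.exp ((x : ℂ) * Complex.I) - 1 - x * Complex.I + x ^ 2 / 2) - (x : ℂ) ^ 2 / 2 := by
    ring
  have h2 : ‖(x : ℂ) ^ 2 / 2‖ = x ^ 2 / 2 := by simp
  rw [add_zero, Real.rpow_two, sq_abs] at h
  rw [e]
  refine (norm_sub_le _ _).trans ?_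
  rw [h2]; nlinarith [sq_nonneg x]

lemma intervalIntegral_odd_eq_zero {F : ℝ → ℂ} (h : ∀ t, F (-t) = -F t) (L : ℝ) :
    ∫ t in (-L)..L, F t = 0 := by
  have h1 := intervalIntegral.integral_comp_neg (a := -L) (b := L) F
  simp only [h, neg_neg, intervalIntegral.integral_neg] at h1
  exact self_eq_neg.1 h1.symm

end PlaneTree

namespace PlaneTree

variable (p : PMF ℕ)

/-! ### Local limit estimates -/

/-- Integration over a symmetric interval. -/
noncomputable def symmIntegral (L : ℝ) : C(ℝ, ℂ) →ₗ[ℂ] ℂ where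
  toFun F := ∫ t in (-L)..L, F t
  map_add' F G := intervalIntegral.integral_add (F.continuous.intervalIntegrable _ _)
    (G.continuous.intervalIntegrable _ _)
  map_smul' a _ := intervalIntegral.integral_smul a _

/-- The characteristic function as a continuous function. -/
noncomputable def charMap : C(ℝ, ℂ) := ⟨centeredChar p, continuous_centeredChar p⟩

/-- The character of frequency `θ`. -/
noncomputable def twist (θ : ℝ) : C(ℝ, ℂ) :=
  ⟨fun t => Complex.exp (((t * θ : ℝ) : ℂ) * Complex.I), by fun_prop⟩

lemma twist_apply (θ t : ℝ) : twist θ t = Complex.exp (((t * θ : ℝ) : ℂ) * Complex.I) := rfl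

lemma twist_zero : twist 0 = 1 := by ext t; simp [twist_apply]

variable {p} {d : ℕ} {c σ2 η K : ℝ}

lemma CharBounds.walkProb_mul (H : CharBounds p d c σ2 η K) (j : ℕ) {s : ℕ} (hs : d ∣ s) :
    (walkProb p j s : ℂ) * (2 * Real.pi / d)
      = symmIntegral (Real.pi / d) (charMap p ^ j * twist ((j : ℝ) - s)) :=
  integral_walk p H.d_pos H.dvd j hs

/-- The workhorse of the local estimates: each factor `|t|` in the integrand gains `(j + 1)^{-1/2}`.
-/
lemma CharBounds.exists_symmIntegral_le (H : CharBounds p d c σ2 η K) :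
    ∃ C : ℝ, 0 < C ∧ ∀ (r : ℕ), r ≤ 4 → ∀ (j : ℕ) (h : C(ℝ, ℂ)) (B : ℝ), 0 ≤ B →
      (∀ t, |t| ≤ Real.pi / d → ‖h t‖ ≤ B * |t| ^ r) →
      ‖symmIntegral (Real.pi / d) (charMap p ^ j * h)‖ ≤ C * B / √(j + 1) ^ (r + 1) := by
  obtain ⟨C, hC0, hC⟩ := exists_norm_integral_le_pow (L := Real.pi / d) H.c_pos (by positivity)
  refine ⟨C, hC0, fun r hr j h B hB hh => hC r hr j _ B hB fun t ht => ?_⟩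
  have h1 : ‖(charMap p ^ j * h) t‖ = ‖centeredChar p t‖ ^ j * ‖h t‖ := by
    rw [ContinuousMap.mul_apply, ContinuousMap.pow_apply, norm_mul, norm_pow]; rfl
  rw [h1]
  calc _ ≤ Real.exp (-c * t ^ 2) ^ j * (B * |t| ^ r) := by
        gcongr
        · exact H.norm_le t ht
        · exact hh t ht
    _ = _ := by ring

lemma norm_charMap_pow_le (n : ℕ) (t : ℝ) : ‖(charMap p ^ n) t‖ ≤ 1 := by
  rw [ContinuousMap.pow_apply, norm_pow]
  exact pow_le_one₀ (norm_nonneg _) (norm_centeredChar_le_one p t)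

lemma CharBounds.norm_one_sub_charMap_pow_le (H : CharBounds p d c σ2 η K) (n : ℕ) {t : ℝ}
    (ht : |t| ≤ Real.pi / d) : ‖(1 - charMap p ^ n) t‖ ≤ n * K * |t| ^ 2 := by
  rw [ContinuousMap.sub_apply, ContinuousMap.pow_apply, ContinuousMap.one_apply, mul_assoc, sq_abs]
  exact (norm_one_sub_pow_le (norm_centeredChar_le_one p t) n).trans
    (mul_le_mul_of_nonneg_left (H.one_sub_le t ht) (by positivity))

lemma norm_twist_sub_one_le (θ t : ℝ) : ‖(twist θ - 1) t‖ ≤ |θ| * |t| := by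
  rw [ContinuousMap.sub_apply, ContinuousMap.one_apply, twist_apply]
  refine (norm_cexp_sub_one_le _).trans ?_
  rw [abs_mul, mul_comm]

lemma norm_twist_add_sub_two_le (t : ℝ) : ‖(twist 1 + twist (-1) - 2) t‖ ≤ |t| ^ 2 := by
  have h := norm_cexp_add_cexp_sub_two_le t
  rw [sq_abs]
  convert h using 3
  simp [twist_apply]
  rfl

/-- With `j = n - k - m` the two products are, up to normalisation, `c_j · n p_n` and `a_{n-k}
a_{n-m}`. Each single difference is too large; the point is to rewrite the difference of products so
that only second-order quantities, or products of two first-order ones, remain. -/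
lemma CharBounds.exists_product_estimate (H : CharBounds p d c σ2 η K) :
    ∃ C : ℝ, 0 < C ∧ ∀ j k m : ℕ,
      ‖symmIntegral (Real.pi / d) (charMap p ^ j * twist (-1)) *
          symmIntegral (Real.pi / d) (charMap p ^ (j + k + m) * twist 1)
        - symmIntegral (Real.pi / d) (charMap p ^ (j + m)) *
          symmIntegral (Real.pi / d) (charMap p ^ (j + k))‖
      ≤ C * (1 / √(j + 1) ^ 4 + (k + m) / √(j + 1) ^ 5 + k * m / √(j + 1) ^ 6) := by
  obtain ⟨C, hC0, hC⟩ := H.exists_symmIntegral_le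
  have hK := H.K_pos
  refine ⟨C ^ 2 * (2 + 2 * K + 2 * K ^ 2), by positivity, fun j k m => ?_⟩
  set L := Real.pi / d with hL
  set s := √((j : ℝ) + 1) with hs
  have hs0 : 0 < s := by positivity
  set T : C(ℝ, ℂ) → ℂ := fun h => symmIntegral L (charMap p ^ j * h) with hT
  have hTadd : ∀ g h, T (g + h) = T g + T h := fun g h => by simp only [hT, mul_add, map_add]
  have hTsub : ∀ g h, T (g - h) = T g - T h := fun g h => by simp only [hT, mul_sub, map_sub]
  set ψ := charMap p with hψ
  have e1 : symmIntegral L (ψ ^ j * twist (-1)) = T 1 + T (twist (-1) - 1) := by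
    rw [← hTadd]; simp only [hT]; ring_nf
  have e2 : symmIntegral L (ψ ^ (j + k + m) * twist 1)
      = T (ψ ^ (k + m)) + T (ψ ^ (k + m) * (twist 1 - 1)) := by
    rw [← hTadd]; simp only [hT]; ring_nf
  have e3 : symmIntegral L (ψ ^ (j + m)) = T (ψ ^ m) := by simp only [hT]; ring_nf
  have e4 : symmIntegral L (ψ ^ (j + k)) = T (ψ ^ k) := by simp only [hT]; ring_nf
  -- The opposite twists cancel to first order, leaving the second difference `e^{it} + e^{-it} - 2
  -- = O(t²)`.
  have e5 : T (twist (-1) - 1) + T (ψ ^ (k + m) * (twist 1 - 1))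
      = T (twist 1 + twist (-1) - 2) - T ((1 - ψ ^ (k + m)) * (twist 1 - 1)) := by
    rw [← hTadd, ← hTsub]; congr 1; ring
  have e6 : T 1 - T (ψ ^ (k + m)) = T (1 - ψ ^ (k + m)) := by rw [hTsub]
  have e7 : T 1 - T (ψ ^ m) - T (ψ ^ k) + T (ψ ^ (k + m)) = T ((1 - ψ ^ k) * (1 - ψ ^ m)) := by
    rw [← hTsub, ← hTsub, ← hTadd]; congr 1; ring
  have e8 : T (ψ ^ m) - T (ψ ^ (k + m)) = T (ψ ^ m * (1 - ψ ^ k)) := by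
    rw [← hTsub]; congr 1; ring
  have e9 : T (ψ ^ k) - T (ψ ^ (k + m)) = T (ψ ^ k * (1 - ψ ^ m)) := by
    rw [← hTsub]; congr 1; ring
  -- The first two terms on the right are the mixed difference in `k` and `m` and the product of the
  -- separate differences, both of size `km / s^6`. The remaining terms involve the twists and are
  -- of size `1 / s^4` or `(k + m) / s^5`.
  have key : (T 1 + T (twist (-1) - 1)) * (T (ψ ^ (k + m)) + T (ψ ^ (k + m) * (twist 1 - 1)))
        - T (ψ ^ m) * T (ψ ^ k)
      = T ((1 - ψ ^ k) * (1 - ψ ^ m)) * T (ψ ^ (k + m))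
        - T (ψ ^ m * (1 - ψ ^ k)) * T (ψ ^ k * (1 - ψ ^ m))
        + T (twist 1 + twist (-1) - 2) * T (ψ ^ (k + m))
        - T ((1 - ψ ^ (k + m)) * (twist 1 - 1)) * T (ψ ^ (k + m))
        + T (1 - ψ ^ (k + m)) * T (ψ ^ (k + m) * (twist 1 - 1))
        + T (twist (-1) - 1) * T (ψ ^ (k + m) * (twist 1 - 1)) := by
    rw [← e6, ← e7, ← e8, ← e9]
    linear_combination (T (ψ ^ (k + m))) * e5
  rw [e1, e2, e3, e4, key]
  have hmul : ∀ (f g : C(ℝ, ℂ)) (t : ℝ), ‖(f * g) t‖ = ‖f t‖ * ‖g t‖ := fun f g t => by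
    rw [ContinuousMap.mul_apply, norm_mul]
  have ht1 : ∀ t : ℝ, ‖(twist 1 - 1) t‖ ≤ |t| := fun t => by
    simpa using norm_twist_sub_one_le 1 t
  have ht2 : ∀ t : ℝ, ‖(twist (-1) - 1) t‖ ≤ |t| := fun t => by
    simpa using norm_twist_sub_one_le (-1) t
  have hp : ∀ (n : ℕ) (f : C(ℝ, ℂ)) (t b : ℝ), ‖f t‖ ≤ b → ‖(ψ ^ n * f) t‖ ≤ b := by
    intro n f t b hb
    rw [hmul]
    exact (mul_le_of_le_one_left (norm_nonneg _) (norm_charMap_pow_le n t)).trans hb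
  have b1 : ‖T ((1 - ψ ^ k) * (1 - ψ ^ m))‖ ≤ C * (k * m * K ^ 2) / s ^ 5 := by
    refine hC 4 le_rfl j _ _ (by positivity) fun t ht => ?_
    rw [hmul]
    refine (mul_le_mul (H.norm_one_sub_charMap_pow_le k ht) (H.norm_one_sub_charMap_pow_le m ht)
      (norm_nonneg _) (by positivity)).trans (le_of_eq (by ring))
  have b2 : ‖T (ψ ^ (k + m))‖ ≤ C * 1 / s ^ 1 := by
    refine hC 0 (by norm_num) j _ _ zero_le_one fun t ht => ?_
    simpa using norm_charMap_pow_le (p := p) (k + m) t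
  have b3 : ‖T (ψ ^ m * (1 - ψ ^ k))‖ ≤ C * (k * K) / s ^ 3 :=
    hC 2 (by norm_num) j _ _ (by positivity) fun t ht =>
      hp _ _ _ _ (H.norm_one_sub_charMap_pow_le k ht)
  have b4 : ‖T (ψ ^ k * (1 - ψ ^ m))‖ ≤ C * (m * K) / s ^ 3 :=
    hC 2 (by norm_num) j _ _ (by positivity) fun t ht =>
      hp _ _ _ _ (H.norm_one_sub_charMap_pow_le m ht)
  have b5 : ‖T (twist 1 + twist (-1) - 2)‖ ≤ C * 1 / s ^ 3 := by
    refine hC 2 (by norm_num) j _ _ zero_le_one fun t ht => ?_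
    rw [one_mul]; exact norm_twist_add_sub_two_le t
  have b6 : ‖T ((1 - ψ ^ (k + m)) * (twist 1 - 1))‖ ≤ C * ((k + m) * K) / s ^ 4 := by
    refine hC 3 (by norm_num) j _ _ (by positivity) fun t ht => ?_
    rw [hmul]
    refine (mul_le_mul (H.norm_one_sub_charMap_pow_le _ ht) (ht1 t)
      (norm_nonneg _) (by positivity)).trans (le_of_eq (by push_cast; ring))
  have b7 : ‖T (1 - ψ ^ (k + m))‖ ≤ C * ((k + m) * K) / s ^ 3 := by
    refine hC 2 (by norm_num) j _ _ (by positivity) fun t ht => ?_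
    simpa using H.norm_one_sub_charMap_pow_le (k + m) ht
  have b8 : ‖T (ψ ^ (k + m) * (twist 1 - 1))‖ ≤ C * 1 / s ^ 2 :=
    hC 1 (by norm_num) j _ _ zero_le_one fun t ht =>
      hp _ _ _ _ (by rw [one_mul, pow_one]; exact ht1 t)
  have b9 : ‖T (twist (-1) - 1)‖ ≤ C * 1 / s ^ 2 :=
    hC 1 (by norm_num) j _ _ zero_le_one fun t ht => by rw [one_mul, pow_one]; exact ht2 t
  clear_value T
  calc _ ≤ ‖T ((1 - ψ ^ k) * (1 - ψ ^ m))‖ * ‖T (ψ ^ (k + m))‖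
        + ‖T (ψ ^ m * (1 - ψ ^ k))‖ * ‖T (ψ ^ k * (1 - ψ ^ m))‖
        + ‖T (twist 1 + twist (-1) - 2)‖ * ‖T (ψ ^ (k + m))‖
        + ‖T ((1 - ψ ^ (k + m)) * (twist 1 - 1))‖ * ‖T (ψ ^ (k + m))‖
        + ‖T (1 - ψ ^ (k + m))‖ * ‖T (ψ ^ (k + m) * (twist 1 - 1))‖
        + ‖T (twist (-1) - 1)‖ * ‖T (ψ ^ (k + m) * (twist 1 - 1))‖ := by
        simp only [← norm_mul]
        refine (norm_add_le _ _).trans (add_le_add_left ?_ _)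
        refine (norm_add_le _ _).trans (add_le_add_left ?_ _)
        refine (norm_sub_le _ _).trans (add_le_add_left ?_ _)
        refine (norm_add_le _ _).trans (add_le_add_left ?_ _)
        exact norm_sub_le _ _
    _ ≤ (C * (k * m * K ^ 2) / s ^ 5) * (C * 1 / s ^ 1)
        + (C * (k * K) / s ^ 3) * (C * (m * K) / s ^ 3)
        + (C * 1 / s ^ 3) * (C * 1 / s ^ 1)
        + (C * ((k + m) * K) / s ^ 4) * (C * 1 / s ^ 1)
        + (C * ((k + m) * K) / s ^ 3) * (C * 1 / s ^ 2)
        + (C * 1 / s ^ 2) * (C * 1 / s ^ 2) := by gcongr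
    _ = C ^ 2 * (2 * (1 / s ^ 4) + 2 * K * ((k + m) / s ^ 5) + 2 * K ^ 2 * (k * m / s ^ 6)) := by
        field_simp
        ring
    _ ≤ _ := by
        rw [mul_assoc (C ^ 2) (2 + 2 * K + 2 * K ^ 2)]
        refine mul_le_mul_of_nonneg_left ?_ (by positivity)
        have h1 : 0 ≤ 1 / s ^ 4 := by positivity
        have h2 : 0 ≤ ((k : ℝ) + m) / s ^ 5 := by positivity
        have h3 : 0 ≤ (k : ℝ) * m / s ^ 6 := by positivity
        have hK2 : 0 ≤ K ^ 2 := by positivity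
        nlinarith [mul_nonneg hK.le h1, mul_nonneg hK.le h2, mul_nonneg hK.le h3,
          mul_nonneg hK2 h1, mul_nonneg hK2 h2, mul_nonneg hK2 h3]

/-- Here one factor `|t|` from the twist and `m |t|²` from the missing power of `ψ` are enough. -/
lemma CharBounds.exists_diff_estimate (H : CharBounds p d c σ2 η K) :
    ∃ C : ℝ, 0 < C ∧ ∀ j m : ℕ,
      ‖symmIntegral (Real.pi / d) (charMap p ^ (j + m))
        - symmIntegral (Real.pi / d) (charMap p ^ j * twist (-1))‖
      ≤ C * (1 / √(j + 1) ^ 2 + m / √(j + 1) ^ 3) := by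
  obtain ⟨C, hC0, hC⟩ := H.exists_symmIntegral_le
  have hK := H.K_pos
  refine ⟨C * (1 + K), by positivity, fun j m => ?_⟩
  set L := Real.pi / d with hL
  set s := √((j : ℝ) + 1) with hs
  have hs0 : 0 < s := by positivity
  have e : symmIntegral L (charMap p ^ (j + m)) - symmIntegral L (charMap p ^ j * twist (-1))
      = -symmIntegral L (charMap p ^ j * (twist (-1) - 1))
        - symmIntegral L (charMap p ^ j * (1 - charMap p ^ m)) := by
    rw [← map_sub, ← map_neg, ← map_sub]; congr 1; ring
  have b1 : ‖symmIntegral L (charMap p ^ j * (twist (-1) - 1))‖ ≤ C * 1 / s ^ 2 :=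
    hC 1 (by norm_num) j _ _ zero_le_one fun t ht => by
      simpa using norm_twist_sub_one_le (-1) t
  have b2 : ‖symmIntegral L (charMap p ^ j * (1 - charMap p ^ m))‖ ≤ C * (m * K) / s ^ 3 :=
    hC 2 (by norm_num) j _ _ (by positivity) fun t ht => H.norm_one_sub_charMap_pow_le m ht
  rw [e]
  refine (norm_sub_le _ _).trans ?_
  rw [norm_neg]
  refine (add_le_add b1 b2).trans ?_
  have h1 : 0 ≤ C * K * (1 / s ^ 2) := by positivity
  have h2 : 0 ≤ C * (m / s ^ 3) := by positivity
  calc C * 1 / s ^ 2 + C * (m * K) / s ^ 3 = C * (1 / s ^ 2) + C * K * (m / s ^ 3) := by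
        field_simp
    _ ≤ _ := by linarith

end PlaneTree

/-! ### Comparison of the walk with a Gaussian. -/

namespace PlaneTree

variable {p : PMF ℕ} {d : ℕ} {c σ2 η K : ℝ}

/-- The Gaussian comparison function. -/
noncomputable def gaussMap (σ2 : ℝ) : C(ℝ, ℂ) :=
  ⟨fun t => ((Real.exp (-(σ2 / 2) * t ^ 2) : ℝ) : ℂ), by fun_prop⟩

lemma gaussMap_apply (σ2 t : ℝ) :
    gaussMap σ2 t = ((Real.exp (-(σ2 / 2) * t ^ 2) : ℝ) : ℂ) := rfl

/-- The inclusion of the real line into the complex plane. -/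
noncomputable def ofRealMap : C(ℝ, ℂ) := ⟨fun t => (t : ℂ), by fun_prop⟩

lemma ofRealMap_apply (t : ℝ) : ofRealMap t = (t : ℂ) := rfl

lemma CharBounds.norm_pow_sub_gaussMap_pow_le (H : CharBounds p d c σ2 η K) (j : ℕ) {t : ℝ}
    (ht : |t| ≤ Real.pi / d) : ‖(charMap p ^ (j + 1) - gaussMap σ2 ^ (j + 1)) t‖
      ≤ (j + 1) * K * (|t| ^ (2 + η) * Real.exp (-c * t ^ 2) ^ j) := by
  have hg : ‖gaussMap σ2 t‖ ≤ Real.exp (-c * t ^ 2) := by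
    rw [gaussMap_apply, Complex.norm_real, Real.norm_of_nonneg (Real.exp_pos _).le]
    refine Real.exp_le_exp.2 ?_
    nlinarith [H.c_le, sq_nonneg t]
  have h1 := norm_pow_sub_pow_le (a := centeredChar p t) (b := gaussMap σ2 t)
    (H.norm_le t ht) hg j
  have h2 : ‖centeredChar p t - gaussMap σ2 t‖ ≤ K * |t| ^ (2 + η) := by
    rw [gaussMap_apply]; exact H.sub_gauss_le t ht
  rw [ContinuousMap.sub_apply, ContinuousMap.pow_apply, ContinuousMap.pow_apply]
  refine h1.trans ?_
  calc _ ≤ ((j : ℝ) + 1) * Real.exp (-c * t ^ 2) ^ j * (K * |t| ^ (2 + η)) := by gcongr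
    _ = _ := by ring

/-- Telescoping the power costs `j + 1` and leaves `|t| ^ (2 + η)`, which integrates to `(j + 1) ^
(-(3 + η) / 2)`. -/
lemma CharBounds.exists_sub_gauss_estimate (H : CharBounds p d c σ2 η K) :
    ∃ C : ℝ, 0 < C ∧ ∀ j : ℕ,
      ‖symmIntegral (Real.pi / d) (charMap p ^ (j + 1) - gaussMap σ2 ^ (j + 1))‖
        ≤ C * ((j : ℝ) + 1) ^ (-((1 + η) / 2)) := by
  have hη := H.η_pos
  have hK := H.K_pos
  obtain ⟨C, hC0, hC⟩ := exists_norm_integral_le_rpow (L := Real.pi / d) (r := 2 + η) H.c_pos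
    (by positivity) (by positivity)
  refine ⟨C * K, by positivity, fun j => ?_⟩
  have hj : (0 : ℝ) < (j : ℝ) + 1 := by positivity
  refine (hC j _ ((j + 1) * K) (by positivity)
    fun t ht => H.norm_pow_sub_gaussMap_pow_le j ht).trans (le_of_eq ?_)
  rw [Real.sqrt_eq_rpow, ← Real.rpow_mul hj.le]
  have : ((j : ℝ) + 1) ^ (-((1 + η) / 2))
      = ((j : ℝ) + 1) * ((j : ℝ) + 1) ^ (1 / 2 * -(2 + η + 1)) := by
    rw [← Real.rpow_one_add' hj.le (by linarith)]
    congr 1; ring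
  rw [this]; ring

/-- Bounding the integrand directly would give only `1 / (j + 1)`. The extra power `η / 2` comes
from replacing `ψ` by a Gaussian in the linear term of `e^{it} - 1`; it is what later makes a sum
over orders converge. -/
lemma CharBounds.exists_twist_sub_one_estimate (H : CharBounds p d c σ2 η K) :
    ∃ C : ℝ, 0 < C ∧ ∀ j : ℕ,
      ‖symmIntegral (Real.pi / d) (charMap p ^ (j + 1) * (twist 1 - 1))‖
        ≤ C * ((j : ℝ) + 1) ^ (-(1 + η / 2)) := by
  have hη := H.η_pos
  have hK := H.K_pos
  obtain ⟨C, hC0, hC⟩ := exists_norm_integral_le_rpow (L := Real.pi / d) (r := 3 + η) H.c_pos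
    (by positivity) (by positivity)
  obtain ⟨C', hC0', hC'⟩ := H.exists_symmIntegral_le
  refine ⟨C * K + C' * 5, by positivity, fun j => ?_⟩
  have hj : (0 : ℝ) < (j : ℝ) + 1 := by positivity
  set L := Real.pi / d with hL
  set ψ := charMap p with hψ
  -- The linear term is odd against the even Gaussian, so the Gaussian may be subtracted for free.
  have hodd : symmIntegral L (gaussMap σ2 ^ (j + 1) * ofRealMap) = 0 := by
    refine intervalIntegral_odd_eq_zero (fun t => ?_) L
    simp only [ContinuousMap.mul_apply, ContinuousMap.pow_apply, gaussMap_apply, ofRealMap_apply,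
      neg_sq, Complex.ofReal_neg, mul_neg]
  have e : symmIntegral L (ψ ^ (j + 1) * (twist 1 - 1))
      = symmIntegral L (ψ ^ j * (ψ * (twist 1 - 1 - Complex.I • ofRealMap)))
        + Complex.I * symmIntegral L ((ψ ^ (j + 1) - gaussMap σ2 ^ (j + 1)) * ofRealMap) := by
    have h1 : symmIntegral L ((ψ ^ (j + 1) - gaussMap σ2 ^ (j + 1)) * ofRealMap)
        = symmIntegral L (ψ ^ (j + 1) * ofRealMap) := by
      rw [sub_mul, map_sub, hodd, sub_zero]
    rw [h1, ← smul_eq_mul Complex.I, ← map_smul, ← map_add]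
    congr 1
    rw [← mul_assoc, ← pow_succ, mul_sub _ (twist 1 - 1), mul_smul_comm, sub_add_cancel]
  rw [e]
  have b1 : ‖symmIntegral L (ψ ^ j * (ψ * (twist 1 - 1 - Complex.I • ofRealMap)))‖
      ≤ C' * 5 / √(j + 1) ^ 3 := by
    refine hC' 2 (by norm_num) j _ 5 (by norm_num) fun t ht => ?_
    rw [ContinuousMap.mul_apply, norm_mul]
    refine (mul_le_of_le_one_left (norm_nonneg _) (norm_centeredChar_le_one p t)).trans ?_
    have := norm_cexp_sub_one_sub_le t
    rw [sq_abs]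
    have e2 : (twist 1 - 1 - Complex.I • ofRealMap) t
        = Complex.exp ((t : ℂ) * Complex.I) - 1 - t * Complex.I := by
      simp [twist_apply, ofRealMap_apply, mul_comm]
    rw [e2]
    exact this
  have b2 : ‖symmIntegral L ((ψ ^ (j + 1) - gaussMap σ2 ^ (j + 1)) * ofRealMap)‖
      ≤ C * ((j + 1) * K) * √(j + 1) ^ (-(3 + η + 1)) := by
    refine hC j _ ((j + 1) * K) (by positivity) fun t ht => ?_
    have h1 := H.norm_pow_sub_gaussMap_pow_le j ht
    have h2 : ‖ofRealMap t‖ = |t| := by rw [ofRealMap_apply, Complex.norm_real, Real.norm_eq_abs]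
    have h3 : |t| ^ (3 + η) = |t| ^ (2 + η) * |t| := by
      rw [← Real.rpow_add_one' (abs_nonneg t) (by linarith)]; congr 1; ring
    change ‖((ψ ^ (j + 1) - gaussMap σ2 ^ (j + 1)) * ofRealMap) t‖ ≤ _
    rw [ContinuousMap.mul_apply, norm_mul, h2, h3]
    calc _ ≤ ((j : ℝ) + 1) * K * (|t| ^ (2 + η) * Real.exp (-c * t ^ 2) ^ j) * |t| :=
          mul_le_mul_of_nonneg_right h1 (abs_nonneg t)
      _ = _ := by ring
  have c1 : C' * 5 / √((j : ℝ) + 1) ^ 3 ≤ C' * 5 * ((j : ℝ) + 1) ^ (-(1 + η / 2)) := by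
    rw [div_eq_mul_inv]
    refine mul_le_mul_of_nonneg_left ?_ (by positivity)
    rw [Real.sqrt_eq_rpow, ← Real.rpow_natCast, ← Real.rpow_mul hj.le, ← Real.rpow_neg hj.le]
    refine Real.rpow_le_rpow_of_exponent_le (by linarith [j.cast_nonneg (α := ℝ)]) ?_
    push_cast; linarith [H.η_le]
  have c2 : C * (((j : ℝ) + 1) * K) * √((j : ℝ) + 1) ^ (-(3 + η + 1))
      = C * K * ((j : ℝ) + 1) ^ (-(1 + η / 2)) := by
    rw [Real.sqrt_eq_rpow, ← Real.rpow_mul hj.le]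
    have : ((j : ℝ) + 1) ^ (-(1 + η / 2))
        = ((j : ℝ) + 1) * ((j : ℝ) + 1) ^ (1 / 2 * -(3 + η + 1)) := by
      rw [← Real.rpow_one_add' hj.le (by linarith)]
      congr 1; ring
    rw [this]; ring
  refine (norm_add_le _ _).trans ?_
  rw [norm_mul, Complex.norm_I, one_mul]
  linarith

/-- Keep only `0 ≤ t ≤ L / √(j + 1)`, where the integrand is at least `exp (-(σ2 / 2) L²)`. -/
lemma CharBounds.exists_gauss_lower (H : CharBounds p d c σ2 η K) :
    ∃ a : ℝ, 0 < a ∧ ∀ j : ℕ,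
      a / √(j + 1) ≤ (symmIntegral (Real.pi / d) (gaussMap σ2 ^ (j + 1))).re := by
  have hd : (0 : ℝ) < d := by exact_mod_cast H.d_pos
  have hσ : 0 < σ2 := by linarith [H.c_pos, H.c_le]
  set L := Real.pi / d with hL
  have hL0 : 0 < L := by positivity
  refine ⟨L * Real.exp (-(σ2 / 2) * L ^ 2), by positivity, fun j => ?_⟩
  set s := √((j : ℝ) + 1) with hs
  have hs2 : s ^ 2 = j + 1 := Real.sq_sqrt (by positivity)
  have hs1 : 1 ≤ s := by rw [hs, Real.one_le_sqrt]; linarith [j.cast_nonneg (α := ℝ)]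
  have e : symmIntegral L (gaussMap σ2 ^ (j + 1))
      = ((∫ t in (-L)..L, Real.exp (-(σ2 / 2) * t ^ 2) ^ (j + 1) : ℝ) : ℂ) := by
    rw [← intervalIntegral.integral_ofReal]
    refine intervalIntegral.integral_congr fun t _ => ?_
    simp only [ContinuousMap.coe_pow, Pi.pow_apply, gaussMap_apply]
    push_cast; rfl
  rw [e, Complex.ofReal_re]
  have hcont : Continuous fun t : ℝ => Real.exp (-(σ2 / 2) * t ^ 2) ^ (j + 1) := by fun_prop
  have hLs : L / s ≤ L := div_le_self hL0.le hs1
  have hLs0 : 0 < L / s := by positivity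
  have h1 := intervalIntegral.integral_mono_interval (μ := volume)
    (show -L ≤ 0 by linarith) hLs0.le hLs
    (Filter.Eventually.of_forall fun t => by positivity) (hcont.intervalIntegrable (-L) L)
  refine le_trans ?_ h1
  have h2 : ∫ _ in (0 : ℝ)..(L / s), Real.exp (-(σ2 / 2) * L ^ 2)
      = L * Real.exp (-(σ2 / 2) * L ^ 2) / s := by
    rw [intervalIntegral.integral_const, smul_eq_mul]; ring
  rw [← h2]
  refine intervalIntegral.integral_mono_on hLs0.le
    (intervalIntegrable_const) (hcont.intervalIntegrable _ _) fun t ht => ?_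
  rw [← Real.exp_nat_mul]
  refine Real.exp_le_exp.2 ?_
  have h3 : t ^ 2 * s ^ 2 ≤ L ^ 2 := by
    rw [← mul_pow]
    exact pow_le_pow_left₀ (mul_nonneg ht.1 (by positivity)) ((le_div_iff₀ (by positivity)).1 ht.2) 2
  push_cast
  rw [← hs2]
  nlinarith

end PlaneTree

/-! ### Local limit bounds in terms of tree orders. -/

namespace PlaneTree

variable {p : PMF ℕ} {d : ℕ} {c σ2 η K : ℝ}

lemma pos_of_mem_gwSizes {n : ℕ} (hn : n ∈ gwSizes p) : 1 ≤ n := by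
  rcases n with _ | n
  · rw [mem_gwSizes_iff, sizeProb, treeSum_zero] at hn; exact (lt_irrefl _ hn).elim
  · omega

/-- Orders are congruent to 1 modulo the span. This supplies the divisibility conditions under which
Fourier inversion is valid in the later estimates. -/
lemma CharBounds.exists_eq_mul_add_one (H : CharBounds p d c σ2 η K) {n : ℕ}
    (hn : n ∈ gwSizes p) : ∃ a, n = d * a + 1 := by
  obtain ⟨j, rfl⟩ := Nat.exists_eq_add_of_le' (pos_of_mem_gwSizes hn)
  rw [mem_gwSizes_iff] at hn
  have h := natCast_mul_sizeProb p j
  have : walkProb p (j + 1) j ≠ 0 := by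
    rw [← h]; positivity
  obtain ⟨a, ha⟩ := dvd_of_walkProb_ne_zero p H.dvd this
  exact ⟨a, by rw [ha]⟩

lemma CharBounds.walkProb_self_mul (H : CharBounds p d c σ2 η K) {j : ℕ} (hj : d ∣ j) :
    (walkProb p j j : ℂ) * (2 * Real.pi / d : ℝ) = symmIntegral (Real.pi / d) (charMap p ^ j) := by
  have h := H.walkProb_mul j hj
  rw [sub_self, twist_zero, mul_one] at h
  rw [← h]; push_cast; rfl

lemma CharBounds.walkProb_succ_mul (H : CharBounds p d c σ2 η K) {j : ℕ} (hj : d ∣ j + 1) :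
    (walkProb p j (j + 1) : ℂ) * (2 * Real.pi / d : ℝ)
      = symmIntegral (Real.pi / d) (charMap p ^ j * twist (-1)) := by
  have h := H.walkProb_mul j hj
  rw [show (j : ℝ) - ((j + 1 : ℕ) : ℝ) = -1 by push_cast; ring] at h
  rw [← h]; push_cast; rfl

lemma CharBounds.walkProb_pred_mul (H : CharBounds p d c σ2 η K) {j : ℕ} (hj : d ∣ j) :
    (walkProb p (j + 1) j : ℂ) * (2 * Real.pi / d : ℝ)
      = symmIntegral (Real.pi / d) (charMap p ^ (j + 1) * twist 1) := by
  have h := H.walkProb_mul (j + 1) hj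
  rw [show ((j + 1 : ℕ) : ℝ) - (j : ℝ) = 1 by push_cast; ring] at h
  rw [← h]; push_cast; rfl

lemma norm_ofReal_mul_ofReal (x : ℝ) {M : ℝ} (hM : 0 < M) :
    ‖(x : ℂ) * (M : ℂ)‖ = |x| * M := by
  rw [norm_mul, Complex.norm_real, Complex.norm_real, Real.norm_eq_abs, Real.norm_of_nonneg hM.le]

lemma CharBounds.exists_walkProb_le (H : CharBounds p d c σ2 η K) :
    ∃ C : ℝ, 0 < C ∧ (∀ j, walkProb p j j ≤ C / √(j + 1)) ∧
      (∀ j, walkProb p j (j + 1) ≤ C / √(j + 1)) ∧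
      ∀ j, walkProb p (j + 1) j ≤ C / √(j + 1) := by
  obtain ⟨C, hC0, hC⟩ := H.exists_symmIntegral_le
  have hd : (0 : ℝ) < d := by exact_mod_cast H.d_pos
  set M := 2 * Real.pi / d with hM
  have hM0 : 0 < M := by positivity
  have hbase : ∀ (j : ℕ) (θ : ℝ), ‖symmIntegral (Real.pi / d) (charMap p ^ j * twist θ)‖
      ≤ C / √(j + 1) := by
    intro j θ
    have := hC 0 (by norm_num) j (twist θ) 1 zero_le_one
      (fun t _ => by rw [twist_apply, norm_cexp_eq]; simp)
    simpa using this
  have hfin : ∀ (j : ℕ) (x : ℝ) (z : ℂ), (x : ℂ) * (M : ℂ) = z → ‖z‖ ≤ C / √(j + 1) →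
      x ≤ C / M / √(j + 1) := by
    intro j x z h1 h2
    rw [← h1, norm_ofReal_mul_ofReal x hM0] at h2
    have := le_abs_self x
    rw [div_right_comm, le_div_iff₀ hM0]
    nlinarith
  have hzero : ∀ j s : ℕ, ¬ d ∣ s → walkProb p j s ≤ C / M / √(j + 1) := by
    intro j s h
    have : walkProb p j s = 0 := by
      by_contra h'; exact h (dvd_of_walkProb_ne_zero p H.dvd h')
    rw [this]; positivity
  refine ⟨C / M, by positivity, fun j => ?_, fun j => ?_, fun j => ?_⟩
  · by_cases h : d ∣ j
    · refine hfin j _ _ (H.walkProb_self_mul h) ?_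
      have := hbase j 0
      rwa [twist_zero, mul_one] at this
    · exact hzero _ _ h
  · by_cases h : d ∣ j + 1
    · exact hfin j _ _ (H.walkProb_succ_mul h) (hbase j _)
    · exact hzero _ _ h
  · by_cases h : d ∣ j
    · refine hfin j _ _ (H.walkProb_pred_mul h) ((hbase (j + 1) _).trans ?_)
      gcongr
      linarith
    · refine (hzero _ _ h).trans ?_
      gcongr
      linarith

/-- For large `n` the Gaussian main term dominates both errors by the factor `n^{-η/2}`. The
finitely many smaller orders are absorbed by adding their reciprocals to the constant. -/
lemma CharBounds.exists_le_sizeProb (H : CharBounds p d c σ2 η K) :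
    ∃ C : ℝ, 0 < C ∧ ∀ n ∈ gwSizes p, 1 ≤ C * (n * √n * sizeProb p n) := by
  obtain ⟨a, ha0, ha⟩ := H.exists_gauss_lower
  obtain ⟨C1, hC1, h1⟩ := H.exists_sub_gauss_estimate
  obtain ⟨C2, hC2, h2⟩ := H.exists_twist_sub_one_estimate
  have hη := H.η_pos
  have hd : (0 : ℝ) < d := by exact_mod_cast H.d_pos
  set M := 2 * Real.pi / d with hM
  have hM0 : 0 < M := by positivity
  have hlim : Filter.Tendsto (fun n : ℕ => (C1 + C2) * (n : ℝ) ^ (-(η / 2))) Filter.atTop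
      (nhds 0) := by
    have := ((tendsto_rpow_neg_atTop (show 0 < η / 2 by positivity)).comp
      tendsto_natCast_atTop_atTop).const_mul (C1 + C2)
    simpa using this
  obtain ⟨N, hN⟩ := Filter.eventually_atTop.1
    (hlim.eventually_le_const (show (0 : ℝ) < a / 2 by positivity))
  set S := ∑ n ∈ Finset.range N, (n * √n * sizeProb p n)⁻¹ with hS
  have hpos : ∀ n : ℕ, 0 ≤ (n : ℝ) * √n * sizeProb p n := fun n => by
    have := sizeProb_nonneg p n; positivity
  have hS0 : 0 ≤ S := Finset.sum_nonneg fun n _ => inv_nonneg.2 (hpos n)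
  refine ⟨2 * M / a + S, by positivity, fun n hn => ?_⟩
  have hn1 := pos_of_mem_gwSizes hn
  rcases lt_or_ge n N with h | h
  · have hpn : 0 < (n : ℝ) * √n * sizeProb p n := by
      have := (mem_gwSizes_iff p n).1 hn
      have : (0 : ℝ) < n := by exact_mod_cast hn1
      positivity
    have h3 : (n * √n * sizeProb p n)⁻¹ ≤ S :=
      Finset.single_le_sum (f := fun n : ℕ => ((n : ℝ) * √n * sizeProb p n)⁻¹)
        (fun n _ => inv_nonneg.2 (hpos n)) (Finset.mem_range.2 h)
    calc (1 : ℝ) = (n * √n * sizeProb p n)⁻¹ * (n * √n * sizeProb p n) :=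
          (inv_mul_cancel₀ hpn.ne').symm
      _ ≤ _ := by
        refine mul_le_mul_of_nonneg_right (h3.trans ?_) hpn.le
        have : 0 < 2 * M / a := by positivity
        linarith
  · obtain ⟨e, he⟩ := H.exists_eq_mul_add_one hn
    obtain ⟨j, rfl⟩ := Nat.exists_eq_add_of_le' hn1
    have hdj : d ∣ j := ⟨e, by omega⟩
    have h3 := H.walkProb_pred_mul hdj
    have hj : (0 : ℝ) < (j : ℝ) + 1 := by positivity
    have hj1 : (1 : ℝ) ≤ (j : ℝ) + 1 := by linarith [j.cast_nonneg (α := ℝ)]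
    set L := Real.pi / d with hL
    have e1 : symmIntegral L (charMap p ^ (j + 1) * twist 1)
        = symmIntegral L (gaussMap σ2 ^ (j + 1))
          + symmIntegral L (charMap p ^ (j + 1) - gaussMap σ2 ^ (j + 1))
          + symmIntegral L (charMap p ^ (j + 1) * (twist 1 - 1)) := by
      rw [← map_add, ← map_add]; congr 1; ring
    have h4 := congrArg Complex.re h3
    rw [e1, ← Complex.ofReal_mul, Complex.ofReal_re, Complex.add_re, Complex.add_re] at h4
    have h5 := (abs_le.1 ((Complex.abs_re_le_norm _).trans (h1 j))).1
    have h6 := (abs_le.1 ((Complex.abs_re_le_norm _).trans (h2 j))).1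
    have h7 := ha j
    have hs : √((j : ℝ) + 1) = ((j : ℝ) + 1) ^ (1 / 2 : ℝ) := Real.sqrt_eq_rpow _
    have h8 : √((j : ℝ) + 1) * ((j : ℝ) + 1) ^ (-((1 + η) / 2)) = ((j : ℝ) + 1) ^ (-(η / 2)) := by
      rw [hs, ← Real.rpow_add hj]; congr 1; ring
    have h9 : √((j : ℝ) + 1) * ((j : ℝ) + 1) ^ (-(1 + η / 2)) ≤ ((j : ℝ) + 1) ^ (-(η / 2)) := by
      rw [hs, ← Real.rpow_add hj]
      exact Real.rpow_le_rpow_of_exponent_le hj1 (by linarith)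
    have h10 := hN (j + 1) h
    rw [Nat.cast_add_one] at h10
    have hs0 : 0 < √((j : ℝ) + 1) := by positivity
    have h11 : √((j : ℝ) + 1) * (a / √(j + 1)) = a := by field_simp
    -- The main term contributes `a`, and `N` was chosen so that the two errors together take at
    -- most half of it.
    have h12 : a / 2 ≤ √((j : ℝ) + 1) * (walkProb p (j + 1) j * M) := by
      rw [h4]
      have := mul_le_mul_of_nonneg_left h5 hs0.le
      have := mul_le_mul_of_nonneg_left h6 hs0.le
      have := mul_le_mul_of_nonneg_left h7 hs0.le
      have := mul_le_mul_of_nonneg_left h9 hC2.le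
      nlinarith
    have h13 := natCast_mul_sizeProb p j
    have h14 : ((j + 1 : ℕ) : ℝ) * √((j + 1 : ℕ) : ℝ) * sizeProb p (j + 1)
        = √((j : ℝ) + 1) * walkProb p (j + 1) j := by
      rw [← h13]; push_cast; ring
    rw [h14]
    have h15 : 0 ≤ √((j : ℝ) + 1) * walkProb p (j + 1) j := by
      have := walkProb_nonneg p (j + 1) j; positivity
    have h16 : 1 ≤ 2 * M / a * (√((j : ℝ) + 1) * walkProb p (j + 1) j) := by
      rw [div_mul_eq_mul_div, le_div_iff₀ ha0]; nlinarith
    nlinarith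

variable (p) in
/-- The local limit estimates for the random walk with the given offspring distribution that
enter the variance bound. -/
structure WalkBounds (C η : ℝ) : Prop where
  C_pos : 0 < C
  η_pos : 0 < η
  sizeProb_le : ∀ n : ℕ, 1 ≤ n → sizeProb p n ≤ C / (n * √n)
  le_sizeProb : ∀ n ∈ gwSizes p, 1 ≤ C * (n * √n * sizeProb p n)
  walkProb_le : ∀ j : ℕ, walkProb p j j ≤ C / √(j + 1)
  walkProb_succ_le : ∀ j : ℕ, walkProb p j (j + 1) ≤ C / √(j + 1)
  product : ∀ n ∈ gwSizes p, ∀ k ∈ gwSizes p, ∀ m ∈ gwSizes p, 4 * k ≤ n → 4 * m ≤ n →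
    |walkProb p (n - k - m) (n - k - m + 1) * walkProb p n (n - 1)
      - walkProb p (n - k) (n - k) * walkProb p (n - m) (n - m)|
      ≤ C * (1 / n ^ 2 + (k + m) / (n ^ 2 * √n) + k * m / n ^ 3)
  diff : ∀ n ∈ gwSizes p, ∀ k ∈ gwSizes p, ∀ m ∈ gwSizes p, 4 * k ≤ n → 4 * m ≤ n →
    |walkProb p (n - k) (n - k) - walkProb p (n - k - m) (n - k - m + 1)|
      ≤ C * (1 / n + m / (n * √n))
  near : ∀ k ∈ gwSizes p, ∀ m ∈ gwSizes p, 2 * m ≤ k →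
    |walkProb p (k - m) (k - m) - walkProb p k (k - 1)|
      ≤ C * ((k : ℝ) ^ (-(1 + η / 2)) + m / (k * √k))

/-- As `k, m ≤ n/4`, the remaining walk length satisfies `√(j + 1) ≥ √n / 2`; the constant 64 is `2
^ 6` from the highest power of this bound. -/
lemma CharBounds.exists_product (H : CharBounds p d c σ2 η K) :
    ∃ C : ℝ, 0 < C ∧ ∀ n ∈ gwSizes p, ∀ k ∈ gwSizes p, ∀ m ∈ gwSizes p, 4 * k ≤ n → 4 * m ≤ n →
    |walkProb p (n - k - m) (n - k - m + 1) * walkProb p n (n - 1)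
      - walkProb p (n - k) (n - k) * walkProb p (n - m) (n - m)|
      ≤ C * (1 / n ^ 2 + (k + m) / (n ^ 2 * √n) + k * m / n ^ 3) := by
  obtain ⟨C, hC0, hC⟩ := H.exists_product_estimate
  have hd : (0 : ℝ) < d := by exact_mod_cast H.d_pos
  set M := 2 * Real.pi / d with hM
  have hM0 : 0 < M := by positivity
  refine ⟨64 * C / M ^ 2, by positivity, fun n hn k hk m hm hkn hmn => ?_⟩
  have hn1 := pos_of_mem_gwSizes hn
  have hn0 : (0 : ℝ) < n := by exact_mod_cast hn1
  obtain ⟨n', hn'⟩ := H.exists_eq_mul_add_one hn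
  obtain ⟨k', hk'⟩ := H.exists_eq_mul_add_one hk
  obtain ⟨m', hm'⟩ := H.exists_eq_mul_add_one hm
  set j := n - k - m with hj
  have d1 : d ∣ j + 1 := ⟨n' - k' - m', by
    rw [Nat.mul_sub, Nat.mul_sub]; omega⟩
  have d2 : d ∣ n - 1 := ⟨n', by omega⟩
  have d3 : d ∣ n - k := ⟨n' - k', by rw [Nat.mul_sub]; omega⟩
  have d4 : d ∣ n - m := ⟨n' - m', by rw [Nat.mul_sub]; omega⟩
  have f1 := H.walkProb_succ_mul d1
  have f2 := H.walkProb_pred_mul d2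
  have f3 := H.walkProb_self_mul d3
  have f4 := H.walkProb_self_mul d4
  rw [Nat.sub_add_cancel hn1] at f2
  have h := hC j k m
  rw [show j + k + m = n by omega, show j + m = n - k by omega, show j + k = n - m by omega,
    ← f1, ← f2, ← f3, ← f4] at h
  have e : ((walkProb p j (j + 1) : ℂ) * (M : ℂ)) * ((walkProb p n (n - 1) : ℂ) * (M : ℂ))
      - ((walkProb p (n - k) (n - k) : ℂ) * (M : ℂ)) * ((walkProb p (n - m) (n - m) : ℂ) * (M : ℂ))
      = ((walkProb p j (j + 1) * walkProb p n (n - 1)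
        - walkProb p (n - k) (n - k) * walkProb p (n - m) (n - m) : ℝ) : ℂ)
        * ((M ^ 2 : ℝ) : ℂ) := by push_cast; ring
  rw [e, norm_ofReal_mul_ofReal _ (by positivity)] at h
  rw [div_mul_eq_mul_div, le_div_iff₀ (by positivity)]
  refine h.trans ?_
  set s := √((j : ℝ) + 1) with hs
  set x := √(n : ℝ) with hx
  have hx0 : 0 < x := by positivity
  have hx2 : x ^ 2 = n := Real.sq_sqrt hn0.le
  have hsx : x / 2 ≤ s := by
    rw [hs]
    refine Real.le_sqrt_of_sq_le ?_
    rw [div_pow, hx2]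
    have : (n : ℝ) ≤ 4 * ((j : ℝ) + 1) := by exact_mod_cast (by omega : n ≤ 4 * (j + 1))
    linarith
  have hs0 : 0 < x / 2 := by positivity
  have g1 : 1 / s ^ 4 ≤ 64 * (1 / (n : ℝ) ^ 2) := by
    calc 1 / s ^ 4 ≤ 1 / (x / 2) ^ 4 := by gcongr
      _ = 16 * (1 / (n : ℝ) ^ 2) := by rw [← hx2]; field_simp; ring
      _ ≤ _ := by
        have : 0 ≤ 1 / (n : ℝ) ^ 2 := by positivity
        linarith
  have g2 : ((k : ℝ) + m) / s ^ 5 ≤ 64 * ((k + m) / (n ^ 2 * x)) := by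
    calc ((k : ℝ) + m) / s ^ 5 ≤ (k + m) / (x / 2) ^ 5 := by gcongr
      _ = 32 * ((k + m) / (n ^ 2 * x)) := by rw [← hx2]; field_simp; ring
      _ ≤ _ := by
        have : 0 ≤ ((k : ℝ) + m) / (n ^ 2 * x) := by positivity
        linarith
  have g3 : (k : ℝ) * m / s ^ 6 ≤ 64 * ((k : ℝ) * m / n ^ 3) := by
    calc (k : ℝ) * m / s ^ 6 ≤ (k : ℝ) * m / (x / 2) ^ 6 := by gcongr
      _ = 64 * ((k : ℝ) * m / n ^ 3) := by rw [← hx2]; field_simp; ring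
  calc _ ≤ C * (64 * (1 / (n : ℝ) ^ 2) + 64 * ((k + m) / (n ^ 2 * x)) + 64 * (k * m / n ^ 3)) := by
        gcongr
    _ = _ := by ring

lemma CharBounds.exists_diff (H : CharBounds p d c σ2 η K) :
    ∃ C : ℝ, 0 < C ∧ ∀ n ∈ gwSizes p, ∀ k ∈ gwSizes p, ∀ m ∈ gwSizes p, 4 * k ≤ n → 4 * m ≤ n →
    |walkProb p (n - k) (n - k) - walkProb p (n - k - m) (n - k - m + 1)|
      ≤ C * (1 / n + m / (n * √n)) := by
  obtain ⟨C, hC0, hC⟩ := H.exists_diff_estimate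
  have hd : (0 : ℝ) < d := by exact_mod_cast H.d_pos
  set M := 2 * Real.pi / d with hM
  have hM0 : 0 < M := by positivity
  refine ⟨8 * C / M, by positivity, fun n hn k hk m hm hkn hmn => ?_⟩
  have hn1 := pos_of_mem_gwSizes hn
  have hn0 : (0 : ℝ) < n := by exact_mod_cast hn1
  obtain ⟨n', hn'⟩ := H.exists_eq_mul_add_one hn
  obtain ⟨k', hk'⟩ := H.exists_eq_mul_add_one hk
  obtain ⟨m', hm'⟩ := H.exists_eq_mul_add_one hm
  set j := n - k - m with hj
  have d1 : d ∣ j + 1 := ⟨n' - k' - m', by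
    rw [Nat.mul_sub, Nat.mul_sub]; omega⟩
  have d3 : d ∣ n - k := ⟨n' - k', by rw [Nat.mul_sub]; omega⟩
  have f1 := H.walkProb_succ_mul d1
  have f3 := H.walkProb_self_mul d3
  have h := hC j m
  rw [show j + m = n - k by omega, ← f1, ← f3, ← sub_mul, ← Complex.ofReal_sub,
    norm_ofReal_mul_ofReal _ hM0] at h
  rw [div_mul_eq_mul_div, le_div_iff₀ hM0]
  refine h.trans ?_
  set s := √((j : ℝ) + 1) with hs
  set x := √(n : ℝ) with hx
  have hx0 : 0 < x := by positivity
  have hx2 : x ^ 2 = n := Real.sq_sqrt hn0.le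
  have hsx : x / 2 ≤ s := by
    rw [hs]
    refine Real.le_sqrt_of_sq_le ?_
    rw [div_pow, hx2]
    have : (n : ℝ) ≤ 4 * ((j : ℝ) + 1) := by exact_mod_cast (by omega : n ≤ 4 * (j + 1))
    linarith
  have hs0 : 0 < x / 2 := by positivity
  have g1 : 1 / s ^ 2 ≤ 8 * (1 / (n : ℝ)) := by
    calc 1 / s ^ 2 ≤ 1 / (x / 2) ^ 2 := by gcongr
      _ = 4 * (1 / (n : ℝ)) := by rw [← hx2]; field_simp; ring
      _ ≤ _ := by
        have : 0 ≤ 1 / (n : ℝ) := by positivity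
        linarith
  have g2 : (m : ℝ) / s ^ 3 ≤ 8 * (m / (n * x)) := by
    calc (m : ℝ) / s ^ 3 ≤ m / (x / 2) ^ 3 := by gcongr
      _ = 8 * (m / (n * x)) := by rw [← hx2]; field_simp; ring
  calc _ ≤ C * (8 * (1 / (n : ℝ)) + 8 * (m / (n * x))) := by gcongr
    _ = _ := by ring

/-- Compares `a_{k-m}` with `k p_k`: shortening the walk by `m` steps costs `m / k^{3/2}`, and
shifting the endpoint by one costs the improved `k^{-1-η/2}`. -/
lemma CharBounds.exists_near (H : CharBounds p d c σ2 η K) :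
    ∃ C : ℝ, 0 < C ∧ ∀ k ∈ gwSizes p, ∀ m ∈ gwSizes p, 2 * m ≤ k →
    |walkProb p (k - m) (k - m) - walkProb p k (k - 1)|
      ≤ C * ((k : ℝ) ^ (-(1 + η / 2)) + m / (k * √k)) := by
  obtain ⟨C, hC0, hC⟩ := H.exists_symmIntegral_le
  obtain ⟨C', hC0', hC'⟩ := H.exists_twist_sub_one_estimate
  have hK := H.K_pos
  have hd : (0 : ℝ) < d := by exact_mod_cast H.d_pos
  set M := 2 * Real.pi / d with hM
  have hM0 : 0 < M := by positivity
  refine ⟨(8 * C * K + C') / M, by positivity, fun k hk m hm hmk => ?_⟩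
  have hk1 := pos_of_mem_gwSizes hk
  have hk0 : (0 : ℝ) < k := by exact_mod_cast hk1
  obtain ⟨k', hk'⟩ := H.exists_eq_mul_add_one hk
  obtain ⟨m', hm'⟩ := H.exists_eq_mul_add_one hm
  set j := k - m with hj
  have d1 : d ∣ k - 1 := ⟨k', by omega⟩
  have d3 : d ∣ j := ⟨k' - m', by rw [Nat.mul_sub]; omega⟩
  have f1 := H.walkProb_pred_mul d1
  have f3 := H.walkProb_self_mul d3
  have h := hC' (k - 1)
  rw [Nat.sub_add_cancel hk1] at f1 h
  have hcast : ((k - 1 : ℕ) : ℝ) + 1 = k := by exact_mod_cast Nat.sub_add_cancel hk1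
  rw [hcast] at h
  set L := Real.pi / d with hL
  have e : symmIntegral L (charMap p ^ j) - symmIntegral L (charMap p ^ k * twist 1)
      = symmIntegral L (charMap p ^ j * (1 - charMap p ^ m))
        - symmIntegral L (charMap p ^ k * (twist 1 - 1)) := by
    rw [← map_sub, ← map_sub, show k = j + m by omega]; congr 1; ring
  have b2 : ‖symmIntegral L (charMap p ^ j * (1 - charMap p ^ m))‖
      ≤ C * (m * K) / √(j + 1) ^ 3 :=
    hC 2 (by norm_num) j _ _ (by positivity) fun t ht => H.norm_one_sub_charMap_pow_le m ht
  have hfin : ‖symmIntegral L (charMap p ^ j) - symmIntegral L (charMap p ^ k * twist 1)‖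
      ≤ C * (m * K) / √(j + 1) ^ 3 + C' * (k : ℝ) ^ (-(1 + η / 2)) := by
    rw [e]; exact (norm_sub_le _ _).trans (add_le_add b2 h)
  rw [← f1, ← f3, ← sub_mul, ← Complex.ofReal_sub, norm_ofReal_mul_ofReal _ hM0] at hfin
  rw [div_mul_eq_mul_div, le_div_iff₀ hM0]
  refine hfin.trans ?_
  set s := √((j : ℝ) + 1) with hs
  set x := √(k : ℝ) with hx
  have hx0 : 0 < x := by positivity
  have hx2 : x ^ 2 = k := Real.sq_sqrt hk0.le
  have hsx : x / 2 ≤ s := by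
    rw [hs]
    refine Real.le_sqrt_of_sq_le ?_
    rw [div_pow, hx2]
    have : (k : ℝ) ≤ 4 * ((j : ℝ) + 1) := by exact_mod_cast (by omega : k ≤ 4 * (j + 1))
    linarith
  have hs0 : 0 < x / 2 := by positivity
  have g2 : C * (m * K) / s ^ 3 ≤ 8 * C * K * (m / (k * x)) := by
    calc C * (m * K) / s ^ 3 ≤ C * (m * K) / (x / 2) ^ 3 := by gcongr
      _ = _ := by rw [← hx2]; field_simp; ring
  have h1 : 0 ≤ 8 * C * K * (k : ℝ) ^ (-(1 + η / 2)) := by positivity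
  have h2 : 0 ≤ C' * ((m : ℝ) / (k * x)) := by positivity
  nlinarith

lemma CharBounds.exists_walkBounds (H : CharBounds p d c σ2 η K) :
    ∃ C : ℝ, WalkBounds p C η := by
  obtain ⟨C1, h10, h1a, h1b, h1c⟩ := H.exists_walkProb_le
  obtain ⟨C2, h20, h2⟩ := H.exists_le_sizeProb
  obtain ⟨C3, h30, h3⟩ := H.exists_product
  obtain ⟨C4, h40, h4⟩ := H.exists_diff
  obtain ⟨C5, h50, h5⟩ := H.exists_near
  have l1 : C1 ≤ C1 + C2 + C3 + C4 + C5 := by linarith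
  have l2 : C2 ≤ C1 + C2 + C3 + C4 + C5 := by linarith
  have l3 : C3 ≤ C1 + C2 + C3 + C4 + C5 := by linarith
  have l4 : C4 ≤ C1 + C2 + C3 + C4 + C5 := by linarith
  have l5 : C5 ≤ C1 + C2 + C3 + C4 + C5 := by linarith
  refine ⟨C1 + C2 + C3 + C4 + C5, by positivity, H.η_pos, ?_, ?_, ?_, ?_, ?_, ?_, ?_⟩
  · intro n hn
    obtain ⟨j, rfl⟩ := Nat.exists_eq_add_of_le' hn
    have h6 := natCast_mul_sizeProb p j
    have h7 := h1c j
    have hj : (0 : ℝ) < (j : ℝ) + 1 := by positivity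
    rw [← h6] at h7
    push_cast
    calc sizeProb p (j + 1) = ((j : ℝ) + 1) * sizeProb p (j + 1) / (j + 1) := by field_simp
      _ ≤ C1 / √(j + 1) / (j + 1) := by gcongr
      _ = C1 / ((j + 1) * √(j + 1)) := by rw [div_div, mul_comm]
      _ ≤ _ := by gcongr
  · intro n hn
    refine (h2 n hn).trans ?_
    have := sizeProb_nonneg p n
    gcongr
  · intro j; exact (h1a j).trans (by gcongr)
  · intro j; exact (h1b j).trans (by gcongr)
  · intro n hn k hk m hm a b; exact (h3 n hn k hk m hm a b).trans (by gcongr)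
  · intro n hn k hk m hm a b; exact (h4 n hn k hk m hm a b).trans (by gcongr)
  · intro k hk m hm a; exact (h5 k hk m hm a).trans (by gcongr)

end PlaneTree

namespace PlaneTree

/-! ### Elementary sums -/

lemma sum_range_one_div_sqrt_succ_le (n : ℕ) :
    ∑ i ∈ Finset.range n, 1 / √((i : ℝ) + 1) ≤ 2 * √n := by
  induction n with
  | zero => simp
  | succ n ih =>
    rw [Finset.sum_range_succ]
    push_cast
    have h1 : 0 < √((n : ℝ) + 1) := by positivity
    have h2 : √((n : ℝ) + 1) ^ 2 = n + 1 := Real.sq_sqrt (by positivity)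
    have h3 : √(n : ℝ) ^ 2 = n := Real.sq_sqrt (by positivity)
    have h4 : 1 / √((n : ℝ) + 1) ≤ 2 * √((n : ℝ) + 1) - 2 * √n := by
      rw [div_le_iff₀ h1]
      nlinarith [sq_nonneg (√((n : ℝ) + 1) - √n)]
    linarith

lemma sum_range_one_div_sqrt_sub_le (n : ℕ) :
    ∑ k ∈ Finset.range (n + 1), 1 / √(((n - k : ℕ) : ℝ) + 1) ≤ 2 * √((n : ℝ) + 1) := by
  have h := Finset.sum_range_reflect (fun i : ℕ => 1 / √((i : ℝ) + 1)) (n + 1)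
  have h2 := sum_range_one_div_sqrt_succ_le (n + 1)
  push_cast at h2
  rw [← h] at h2
  simpa using h2

lemma sqrt_add_one_le {n : ℕ} (hn : 1 ≤ n) : √((n : ℝ) + 1) ≤ 2 * √n := by
  have hn' : (1 : ℝ) ≤ n := by exact_mod_cast hn
  rw [show (2 : ℝ) = √4 by rw [show (4 : ℝ) = 2 ^ 2 by norm_num, Real.sqrt_sq (by norm_num)],
    ← Real.sqrt_mul (by norm_num)]
  exact Real.sqrt_le_sqrt (by linarith)

lemma sum_range_one_div_sqrt_le (n : ℕ) :
    ∑ k ∈ Finset.range (n + 1), 1 / √(k : ℝ) ≤ 2 * √n := by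
  rw [Finset.sum_range_succ']
  have := sum_range_one_div_sqrt_succ_le n
  simpa using this

lemma sum_Ico_one_div_mul_sqrt_le {m : ℕ} (hm : 1 ≤ m) (n : ℕ) :
    ∑ k ∈ Finset.Ico m n, 1 / ((k : ℝ) * √k) ≤ 3 / √m := by
  have hm0 : (1 : ℝ) ≤ m := by exact_mod_cast hm
  have hsm : 0 < √(m : ℝ) := by positivity
  -- The subtracted tail `2 / √(m + j)` strengthens the claim so that the induction telescopes.
  have key : ∀ j : ℕ, ∑ k ∈ Finset.Ico m (m + 1 + j), 1 / ((k : ℝ) * √k)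
      ≤ 3 / √m - 2 / √((m + j : ℕ) : ℝ) := by
    intro j
    induction j with
    | zero =>
      simp only [add_zero, Nat.Ico_succ_singleton, Finset.sum_singleton]
      have h1 : 1 / ((m : ℝ) * √m) ≤ 1 / √m := by
        gcongr
        nlinarith
      have : 3 / √(m : ℝ) - 2 / √m = 1 / √m := by ring
      linarith
    | succ j ih =>
      rw [show m + 1 + (j + 1) = (m + 1 + j) + 1 by ring, Finset.sum_Ico_succ_top (by omega)]
      have e1 : ((m + 1 + j : ℕ) : ℝ) = ((m + j : ℕ) : ℝ) + 1 := by push_cast; ring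
      have e2 : ((m + (j + 1) : ℕ) : ℝ) = ((m + j : ℕ) : ℝ) + 1 := by push_cast; ring
      rw [e1, e2]
      set y : ℝ := ((m + j : ℕ) : ℝ) with hy
      have hy0 : 1 ≤ y := by rw [hy]; push_cast; linarith [j.cast_nonneg (α := ℝ)]
      have ha : 0 < √y := by positivity
      have hb : 0 < √(y + 1) := by positivity
      have ha2 : √y ^ 2 = y := Real.sq_sqrt (by linarith)
      have hb2 : √(y + 1) ^ 2 = y + 1 := Real.sq_sqrt (by linarith)
      have hab : √y ≤ √(y + 1) := Real.sqrt_le_sqrt (by linarith)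
      have h4 : 1 / ((y + 1) * √(y + 1)) ≤ 2 / √y - 2 / √(y + 1) := by
        generalize √y = u at *
        generalize √(y + 1) = v at *
        rw [← hb2, div_sub_div _ _ ha.ne' hb.ne', div_le_div_iff₀ (by positivity) (by positivity)]
        have h5 : (v - u) * (v + u) = 1 := by linarith
        have h6 : 1 ≤ 2 * (v - u) * v := by nlinarith
        have h7 : v ^ 2 * 1 ≤ v ^ 2 * (2 * (v - u) * v) := by gcongr
        nlinarith
      linarith
  rcases le_or_gt n m with h | h
  · rw [Finset.Ico_eq_empty_of_le h, Finset.sum_empty]; positivity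
  · obtain ⟨j, rfl⟩ := Nat.exists_eq_add_of_le (show m + 1 ≤ n from h)
    have h1 := key j
    have h2 : 0 ≤ 2 / √((m + j : ℕ) : ℝ) := by positivity
    linarith

lemma sum_range_one_div_mul_sqrt_le (n : ℕ) :
    ∑ k ∈ Finset.range n, 1 / ((k : ℝ) * √k) ≤ 3 := by
  cases n with
  | zero => simp
  | succ n =>
    rw [Finset.range_eq_Ico, Finset.sum_eq_sum_Ico_succ_bot (by omega)]
    have := sum_Ico_one_div_mul_sqrt_le le_rfl (n + 1)
    simpa using this

lemma sum_range_sum_range_comm (N : ℕ) (f : ℕ → ℕ → ℝ) :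
    ∑ k ∈ Finset.range N, ∑ m ∈ Finset.range k, f k m
      = ∑ m ∈ Finset.range N, ∑ k ∈ Finset.Ico (m + 1) N, f k m := by
  refine Finset.sum_comm' fun k m => ?_
  simp only [Finset.mem_range, Finset.mem_Ico]
  omega

lemma sum_range_sum_range_symm (N : ℕ) {f : ℕ → ℕ → ℝ} (hf : ∀ k m, f k m = f m k) :
    ∑ k ∈ Finset.range N, ∑ m ∈ Finset.range N, f k m
      = ∑ k ∈ Finset.range N, f k k + 2 * ∑ k ∈ Finset.range N, ∑ m ∈ Finset.range k, f k m := by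
  induction N with
  | zero => simp
  | succ N ih =>
    simp_rw [Finset.sum_range_succ _ N, Finset.sum_add_distrib]
    rw [ih, Finset.sum_congr rfl fun k _ => hf k N]
    ring

/-- A Hardy-type inequality. -/
lemma sum_hardy_le {x : ℕ → ℝ} (hx : ∀ k, 0 ≤ x k) (n : ℕ) :
    ∑ k ∈ Finset.range (n + 1), ∑ m ∈ Finset.range k, (x k + x m) * (1 / (k * √k * √m))
      ≤ 5 * ∑ k ∈ Finset.range (n + 1), x k / k := by
  simp_rw [add_mul, Finset.sum_add_distrib]
  have h1 : ∑ k ∈ Finset.range (n + 1), ∑ m ∈ Finset.range k, x k * (1 / (k * √k * √m))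
      ≤ 2 * ∑ k ∈ Finset.range (n + 1), x k / k := by
    rw [Finset.mul_sum]
    refine Finset.sum_le_sum fun k _ => ?_
    rcases k with _ | k
    · simp
    · have h2 := sum_range_one_div_sqrt_le k
      have hk : 0 < ((k + 1 : ℕ) : ℝ) := by positivity
      set y := ((k + 1 : ℕ) : ℝ) with hy
      have h3 : √(k : ℝ) ≤ √y := Real.sqrt_le_sqrt (by rw [hy]; push_cast; linarith)
      have hy2 : √y * √y = y := Real.mul_self_sqrt hk.le
      calc ∑ m ∈ Finset.range (k + 1), x (k + 1) * (1 / (y * √y * √m))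
          = x (k + 1) / (y * √y) * ∑ m ∈ Finset.range (k + 1), 1 / √(m : ℝ) := by
            rw [Finset.mul_sum]
            refine Finset.sum_congr rfl fun m _ => ?_
            rw [div_mul_div_comm, mul_one, mul_one_div]
        _ ≤ x (k + 1) / (y * √y) * (2 * √y) := by
            have := hx (k + 1)
            gcongr
            linarith
        _ = 2 * (x (k + 1) / y) := by
            field_simp
  have h2 : ∑ k ∈ Finset.range (n + 1), ∑ m ∈ Finset.range k, x m * (1 / (k * √k * √m))
      ≤ 3 * ∑ k ∈ Finset.range (n + 1), x k / k := by
    rw [sum_range_sum_range_comm, Finset.mul_sum]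
    refine Finset.sum_le_sum fun m _ => ?_
    rcases m with _ | m
    · simp
    · set y := ((m + 1 : ℕ) : ℝ) with hy
      have hy0 : 0 < y := by positivity
      have h3 : ∑ k ∈ Finset.Ico (m + 1 + 1) (n + 1), 1 / ((k : ℝ) * √k) ≤ 3 / √y :=
        (Finset.sum_le_sum_of_subset_of_nonneg (Finset.Ico_subset_Ico_left (by omega))
          (fun _ _ _ => by positivity)).trans (sum_Ico_one_div_mul_sqrt_le (by omega) (n + 1))
      have hy2 : √y * √y = y := Real.mul_self_sqrt hy0.le
      calc ∑ k ∈ Finset.Ico (m + 1 + 1) (n + 1), x (m + 1) * (1 / ((k : ℝ) * √k * √y))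
          = x (m + 1) / √y * ∑ k ∈ Finset.Ico (m + 1 + 1) (n + 1), 1 / ((k : ℝ) * √k) := by
            rw [Finset.mul_sum]
            refine Finset.sum_congr rfl fun k _ => ?_
            rw [div_mul_div_comm, mul_one, mul_one_div, mul_comm √y]
        _ ≤ x (m + 1) / √y * (3 / √y) := by
            have := hx (m + 1)
            gcongr
        _ = 3 * (x (m + 1) / y) := by
            rw [div_mul_div_comm, hy2]; ring
  linarith

/-- For fixed `m` the sum over `k` is cut at `2m`: below, `k^{3/2}` is at least `m^{3/2}` and the
singular factor sums to order `√m`; above, the singular factor is at most `1 / √m`. -/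
lemma sum_near_diagonal_le {x : ℕ → ℝ} (hx : ∀ k, 0 ≤ x k) (hx0 : x 0 = 0) (n : ℕ) :
    ∑ k ∈ Finset.range (n + 1), ∑ m ∈ Finset.range k,
        (x k + x m) * (1 / (k * √k * √(((k - m : ℕ) : ℝ) + 1)))
      ≤ 9 * ∑ k ∈ Finset.range (n + 1), x k / k := by
  simp_rw [add_mul, Finset.sum_add_distrib]
  have h1 : ∑ k ∈ Finset.range (n + 1), ∑ m ∈ Finset.range k,
        x k * (1 / (k * √k * √(((k - m : ℕ) : ℝ) + 1)))
      ≤ 4 * ∑ k ∈ Finset.range (n + 1), x k / k := by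
    rw [Finset.mul_sum]
    refine Finset.sum_le_sum fun k _ => ?_
    rcases Nat.eq_zero_or_pos k with rfl | hk
    · simp
    · have hy0 : 0 < (k : ℝ) := by exact_mod_cast hk
      have h2 : ∑ m ∈ Finset.range k, 1 / √(((k - m : ℕ) : ℝ) + 1) ≤ 4 * √(k : ℝ) :=
        (Finset.sum_le_sum_of_subset_of_nonneg (Finset.range_mono (Nat.le_succ k))
          (fun _ _ _ => by positivity)).trans ((sum_range_one_div_sqrt_sub_le k).trans
            (by linarith [sqrt_add_one_le hk]))
      calc ∑ m ∈ Finset.range k, x k * (1 / (k * √k * √(((k - m : ℕ) : ℝ) + 1)))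
          = x k / (k * √k) * ∑ m ∈ Finset.range k, 1 / √(((k - m : ℕ) : ℝ) + 1) := by
            rw [Finset.mul_sum]
            refine Finset.sum_congr rfl fun m _ => ?_
            rw [div_mul_div_comm, mul_one, mul_one_div]
        _ ≤ x k / (k * √k) * (4 * √(k : ℝ)) := by
            have := hx k
            gcongr
        _ = 4 * (x k / k) := by field_simp
  have h2 : ∑ k ∈ Finset.range (n + 1), ∑ m ∈ Finset.range k,
        x m * (1 / (k * √k * √(((k - m : ℕ) : ℝ) + 1)))
      ≤ 5 * ∑ k ∈ Finset.range (n + 1), x k / k := by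
    rw [sum_range_sum_range_comm, Finset.mul_sum]
    refine Finset.sum_le_sum fun m _ => ?_
    -- Unlike in the Hardy kernel, no factor `1 / √m` vanishes at `m = 0`, hence the assumption `x 0
    -- = 0`.
    rcases Nat.eq_zero_or_pos m with rfl | hm
    · simp [hx0]
    · have hm0 : 0 < (m : ℝ) := by exact_mod_cast hm
      have hpt : ∀ k ∈ Finset.Ico (m + 1) (n + 1), 1 / ((k : ℝ) * √k * √(((k - m : ℕ) : ℝ) + 1))
          ≤ 1 / √m * (1 / (k * √k))
            + if k < 2 * m then 1 / (m * √m) * (1 / √(((k - m : ℕ) : ℝ) + 1)) else 0 := by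
        intro k hk
        have hk1 := (Finset.mem_Ico.1 hk).1
        have hmk : (m : ℝ) ≤ k := by exact_mod_cast (by omega : m ≤ k)
        have hk0 : 0 < (k : ℝ) := by linarith
        split_ifs with h
        · have e1 : 0 ≤ 1 / √(m : ℝ) * (1 / (k * √k)) := by positivity
          have e2 : 1 / ((k : ℝ) * √k * √(((k - m : ℕ) : ℝ) + 1))
              ≤ 1 / (m * √m) * (1 / √(((k - m : ℕ) : ℝ) + 1)) := by
            rw [div_mul_div_comm, mul_one]
            gcongr
          linarith
        · rw [add_zero, div_mul_div_comm, mul_one, mul_comm √(m : ℝ)]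
          have : (m : ℝ) ≤ ((k - m : ℕ) : ℝ) + 1 := by exact_mod_cast (by omega : m ≤ k - m + 1)
          gcongr
      have hs1 : ∑ k ∈ Finset.Ico (m + 1) (n + 1), 1 / ((k : ℝ) * √k) ≤ 3 / √m :=
        (Finset.sum_le_sum_of_subset_of_nonneg (Finset.Ico_subset_Ico_left (by omega))
          (fun _ _ _ => by positivity)).trans (sum_Ico_one_div_mul_sqrt_le hm (n + 1))
      have hs2 : ∑ k ∈ Finset.Ico (m + 1) (n + 1),
          (if k < 2 * m then 1 / ((m : ℝ) * √m) * (1 / √(((k - m : ℕ) : ℝ) + 1)) else 0)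
          ≤ 1 / (m * √m) * (2 * √m) := by
        rw [← Finset.sum_filter, ← Finset.mul_sum]
        refine mul_le_mul_of_nonneg_left ?_ (by positivity)
        refine (Finset.sum_le_sum_of_subset_of_nonneg (t := Finset.Ico m (2 * m)) ?_
          (fun _ _ _ => by positivity)).trans ?_
        · intro k
          simp only [Finset.mem_filter, Finset.mem_Ico]
          omega
        · rw [Finset.sum_Ico_eq_sum_range, show 2 * m - m = m by omega]
          simpa using sum_range_one_div_sqrt_succ_le m
      have hsm : √(m : ℝ) * √m = m := Real.mul_self_sqrt hm0.le
      rw [← Finset.mul_sum]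
      calc _ ≤ x m * (1 / √m * (3 / √m) + 1 / (m * √m) * (2 * √m)) := by
            refine mul_le_mul_of_nonneg_left ((Finset.sum_le_sum hpt).trans ?_) (hx m)
            rw [Finset.sum_add_distrib, ← Finset.mul_sum]
            gcongr
        _ = 5 * (x m / m) := by
            rw [div_mul_div_comm, hsm]
            field_simp
            ring
  linarith

lemma exists_sum_rpow_le {s : ℝ} (hs : 1 < s) :
    ∃ C : ℝ, 0 < C ∧ ∀ n : ℕ, ∑ k ∈ Finset.range n, (k : ℝ) ^ (-s) ≤ C := by
  have h : Summable fun k : ℕ => (k : ℝ) ^ (-s) := Real.summable_nat_rpow.2 (by linarith)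
  refine ⟨∑' k : ℕ, (k : ℝ) ^ (-s) + 1, ?_, fun n => ?_⟩
  · have : 0 ≤ ∑' k : ℕ, (k : ℝ) ^ (-s) := tsum_nonneg fun k => by positivity
    linarith
  · have := h.sum_le_tsum (Finset.range n) (fun k _ => by positivity)
    linarith

end PlaneTree

namespace PlaneTree

variable {p : PMF ℕ} {C η : ℝ}

/-! ### Toll functions with vanishing conditional means -/

lemma condMean_nonneg {g : PlaneTree → ℝ} (hg : ∀ T, 0 ≤ g T) (n : ℕ) : 0 ≤ condMean p g n :=
  div_nonneg (treeSum_nonneg p fun T _ => hg T) (sizeProb_nonneg p n)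

/-- True at every order: where the order is impossible both sides vanish, so sums need not be
restricted to `gwSizes`. -/
lemma condMean_mul_sizeProb (g : PlaneTree → ℝ) (n : ℕ) :
    condMean p g n * sizeProb p n = treeSum p g n := by
  by_cases h : n ∈ gwSizes p
  · exact div_mul_cancel₀ _ ((mem_gwSizes_iff p n).1 h).ne'
  · rw [treeSum_eq_zero p h, sizeProb_eq_zero p h, mul_zero]

lemma condMean_eq_zero {n : ℕ} (h : n ∉ gwSizes p) (g : PlaneTree → ℝ) : condMean p g n = 0 := by
  rw [condMean, treeSum_eq_zero p h, zero_div]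

/-- Cauchy-Schwarz under the conditioned law, multiplied by the probability of the order. -/
lemma treeSum_mul_le (g h : PlaneTree → ℝ) (n : ℕ) :
    treeSum p (fun T => g T * h T) n ≤ sizeProb p n *
      (√(condMean p (fun T => g T ^ 2) n) * √(condMean p (fun T => h T ^ 2) n)) := by
  refine le_of_abs_le ?_
  have hg := condMean_nonneg (p := p) (g := fun T => g T ^ 2) (fun T => sq_nonneg _) n
  have hh := condMean_nonneg (p := p) (g := fun T => h T ^ 2) (fun T => sq_nonneg _) n
  have hp := sizeProb_nonneg p n
  refine abs_le_of_sq_le_sq ?_ (by positivity)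
  refine (treeSum_mul_sq_le p g h n).trans (le_of_eq ?_)
  rw [mul_pow, mul_pow, Real.sq_sqrt hg, Real.sq_sqrt hh, ← condMean_mul_sizeProb,
    ← condMean_mul_sizeProb (fun T => h T ^ 2)]
  ring

lemma WalkBounds.one_div_sqrt_le (W : WalkBounds p C η) {n : ℕ} (hn : n ∈ gwSizes p) :
    1 / √(n : ℝ) ≤ C * (n * sizeProb p n) := by
  have h1 := W.le_sizeProb n hn
  have hn0 : (0 : ℝ) < n := by exact_mod_cast pos_of_mem_gwSizes hn
  rw [div_le_iff₀ (by positivity)]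
  linarith

lemma one_div_sqrt_sub_le {n k : ℕ} (hn : 1 ≤ n) (h : 2 * k ≤ n) :
    1 / √(((n - k : ℕ) : ℝ) + 1) ≤ 2 / √n := by
  have hn0 : (0 : ℝ) < n := by exact_mod_cast hn
  have h1 : (n : ℝ) ≤ 4 * (((n - k : ℕ) : ℝ) + 1) := by
    exact_mod_cast (by omega : n ≤ 4 * ((n - k) + 1))
  have h2 : √(n : ℝ) ≤ 2 * √(((n - k : ℕ) : ℝ) + 1) := by
    rw [Real.sqrt_le_left (by positivity), mul_pow, Real.sq_sqrt (by positivity)]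
    linarith
  rw [div_le_div_iff₀ (by positivity) (by positivity)]
  linarith

/-- The summand is of order `(σ k / k) / √(n - k + 1)`. For `k ≤ n/2` the root is of order `√n` and
the sum `B` is used; for larger `k` one uses `σ k ≤ A`, and the inverse roots sum to order `√n`. -/
lemma WalkBounds.sum_sizeProb_le (W : WalkBounds p C η) {n : ℕ} (hn : n ∈ gwSizes p)
    {σ : ℕ → ℝ} {A B : ℝ} (hσ : ∀ k, 0 ≤ σ k) (hA : ∀ k ≤ n, σ k ≤ A)
    (hB : ∑ k ∈ Finset.range (n + 1), σ k / k ≤ B) :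
    ∑ k ∈ Finset.range (n + 1), sizeProb p k * σ k * √k * walkProb p (n - k) (n - k)
      ≤ 8 * C ^ 3 * (A + B) * (n * sizeProb p n) := by
  have hC := W.C_pos
  have hn1 := pos_of_mem_gwSizes hn
  have hn0 : (0 : ℝ) < n := by exact_mod_cast hn1
  have hA0 : 0 ≤ A := (hσ 0).trans (hA 0 (Nat.zero_le n))
  have hx0 : 0 < √(n : ℝ) := by positivity
  have hx2 : √(n : ℝ) * √n = n := Real.mul_self_sqrt hn0.le
  have hpt : ∀ k ∈ Finset.range (n + 1),
      sizeProb p k * σ k * √k * walkProb p (n - k) (n - k)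
      ≤ 2 * C ^ 2 / √n * (σ k / k) + 2 * C ^ 2 * A / n * (1 / √(((n - k : ℕ) : ℝ) + 1)) := by
    intro k hk
    have hkn : k ≤ n := by simpa [Nat.lt_succ_iff] using hk
    rcases Nat.eq_zero_or_pos k with rfl | hk0
    · simp only [sizeProb, treeSum_zero, Nat.cast_zero, zero_mul, div_zero, mul_zero, zero_add]
      positivity
    · have hk1 : (0 : ℝ) < k := by exact_mod_cast hk0
      have h1 := W.sizeProb_le k hk0
      have h2 := W.walkProb_le (n - k)
      have hw := walkProb_nonneg p (n - k) (n - k)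
      have hp := sizeProb_nonneg p k
      have hs := hσ k
      have h3 : sizeProb p k * σ k * √k * walkProb p (n - k) (n - k)
          ≤ C / (k * √k) * σ k * √k * (C / √(((n - k : ℕ) : ℝ) + 1)) := by gcongr
      have h4 : C / (k * √k) * σ k * √k * (C / √(((n - k : ℕ) : ℝ) + 1))
          = C ^ 2 * (σ k / k) * (1 / √(((n - k : ℕ) : ℝ) + 1)) := by
        have : √(k : ℝ) ≠ 0 := by positivity
        field_simp
      rw [h4] at h3
      refine h3.trans ?_
      rcases le_or_gt (2 * k) n with h | h
      · have h5 := one_div_sqrt_sub_le hn1 h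
        have h6 : 0 ≤ 2 * C ^ 2 * A / n * (1 / √(((n - k : ℕ) : ℝ) + 1)) := by positivity
        calc _ ≤ C ^ 2 * (σ k / k) * (2 / √n) := by gcongr
          _ = 2 * C ^ 2 / √n * (σ k / k) := by ring
          _ ≤ _ := by linarith
      · have h5 : σ k / k ≤ 2 * A / n := by
          have : (n : ℝ) ≤ 2 * k := by exact_mod_cast h.le
          rw [div_le_div_iff₀ hk1 hn0]
          nlinarith [hA k hkn]
        have h6 : 0 ≤ 2 * C ^ 2 / √n * (σ k / k) := by positivity
        calc _ ≤ C ^ 2 * (2 * A / n) * (1 / √(((n - k : ℕ) : ℝ) + 1)) := by gcongr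
          _ = 2 * C ^ 2 * A / n * (1 / √(((n - k : ℕ) : ℝ) + 1)) := by ring
          _ ≤ _ := by linarith
  have h1 := Finset.sum_le_sum hpt
  rw [Finset.sum_add_distrib, ← Finset.mul_sum, ← Finset.mul_sum] at h1
  have h2 : ∑ k ∈ Finset.range (n + 1), 1 / √(((n - k : ℕ) : ℝ) + 1) ≤ 4 * √n :=
    (sum_range_one_div_sqrt_sub_le n).trans (by linarith [sqrt_add_one_le hn1])
  have h3 : 2 * C ^ 2 * A / n * (4 * √(n : ℝ)) = 8 * C ^ 2 * A * (1 / √n) := by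
    nth_rewrite 1 [← hx2]
    field_simp
    ring
  have h4 := W.one_div_sqrt_le hn
  have hB0 : 0 ≤ B := le_trans (Finset.sum_nonneg fun k _ => by have := hσ k; positivity) hB
  calc _ ≤ 2 * C ^ 2 / √n * B + 2 * C ^ 2 * A / n * (4 * √n) := by
        refine h1.trans (add_le_add ?_ ?_)
        · gcongr
        · gcongr
    _ = (2 * C ^ 2 * B + 8 * C ^ 2 * A) * (1 / √n) := by rw [h3]; ring
    _ ≤ (8 * C ^ 2 * B + 8 * C ^ 2 * A) * (C * (n * sizeProb p n)) := by
        gcongr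
        linarith
    _ = _ := by ring

/-- The second moment bound for toll functions with vanishing conditional means. -/
lemma WalkBounds.sqrt_condMean_additive_le (W : WalkBounds p C η) {g : PlaneTree → ℝ}
    (hg : ∀ k, treeSum p g k = 0) {n : ℕ} {A B : ℝ}
    (hA : ∀ k ≤ n, √(condMean p (fun T => g T ^ 2) k) ≤ A)
    (hB : ∑ k ∈ Finset.range (n + 1), √(condMean p (fun T => g T ^ 2) k) / k ≤ B) :
    √(condMean p (fun T => additive g T ^ 2) n) ≤ 16 * C ^ 3 * √n * (A + B) := by
  have hC := W.C_pos
  set σ : ℕ → ℝ := fun k => √(condMean p (fun T => g T ^ 2) k) with hσ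
  set V : ℕ → ℝ := fun k => condMean p (fun T => additive g T ^ 2) k with hV
  have hV0 : ∀ k, 0 ≤ V k := fun k => condMean_nonneg (fun T => sq_nonneg _) k
  have hA0 : 0 ≤ A := (Real.sqrt_nonneg _).trans (hA 0 (Nat.zero_le n))
  have hB0 : 0 ≤ B := le_trans (Finset.sum_nonneg fun k _ => by positivity) hB
  -- Bootstrap: let `M` be the largest value of `√(V k / k)` up to `n`, and prove a quadratic
  -- inequality for `M` at the maximiser.
  obtain ⟨k₀, hk₀, hmax⟩ := Finset.exists_max_image (Finset.range (n + 1))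
    (fun k => √(V k) / √k) ⟨0, by simp⟩
  set M := √(V k₀) / √k₀ with hM
  have hM0 : 0 ≤ M := by positivity
  have hk₀n : k₀ ≤ n := by simpa [Nat.lt_succ_iff] using hk₀
  have hVM : ∀ k ≤ n, √(V k) ≤ M * √k := by
    intro k hk
    rcases Nat.eq_zero_or_pos k with rfl | hk0
    · have : V 0 = 0 := by simp [hV, condMean, treeSum_zero]
      simp [this]
    · have hk1 : (0 : ℝ) < k := by exact_mod_cast hk0
      have := hmax k (Finset.mem_range.2 (by omega))
      rwa [div_le_iff₀ (by positivity)] at this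
  have hMle : M ≤ 16 * C ^ 3 * (A + B) := by
    by_cases hs : k₀ ∈ gwSizes p
    · have hk1 := pos_of_mem_gwSizes hs
      have hk0 : (0 : ℝ) < k₀ := by exact_mod_cast hk1
      have hp0 := (mem_gwSizes_iff p k₀).1 hs
      have h1 := treeSum_additive_mul p g g k₀
      -- All disjoint pairs vanish because each order has weighted toll sum zero.
      simp only [hg, zero_mul, Finset.sum_const_zero, add_zero] at h1
      have h2 : treeSum p (fun T => additive g T * additive g T) k₀ = V k₀ * sizeProb p k₀ := by
        rw [condMean_mul_sizeProb]; exact treeSum_congr p fun T _ => by ring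
      have h3 : ∀ k ∈ Finset.range (k₀ + 1),
          treeSum p (nested g g) k * walkProb p (k₀ - k) (k₀ - k)
          ≤ 2 * M * (sizeProb p k * σ k * √k * walkProb p (k₀ - k) (k₀ - k)) := by
        intro k hk
        have hkn : k ≤ n := by have := Finset.mem_range.1 hk; omega
        have hw := walkProb_nonneg p (k₀ - k) (k₀ - k)
        have hp := sizeProb_nonneg p k
        have h4 : treeSum p (nested g g) k ≤ 2 * treeSum p (fun T => g T * additive g T) k := by
          rw [← treeSum_const_mul]
          refine treeSum_mono p fun T _ => ?_
          rw [nested]; nlinarith [sq_nonneg (g T)]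
        have h5 := treeSum_mul_le (p := p) g (additive g) k
        have h6 : sizeProb p k * (σ k * √(V k)) ≤ sizeProb p k * (σ k * (M * √k)) := by
          have := hVM k hkn
          have : 0 ≤ σ k := Real.sqrt_nonneg _
          gcongr
        calc _ ≤ (2 * (sizeProb p k * (σ k * (M * √k)))) * walkProb p (k₀ - k) (k₀ - k) := by
              gcongr
              exact h4.trans (by linarith [h5.trans h6])
          _ = _ := by ring
      have h7 := Finset.sum_le_sum h3
      rw [← h1, h2, ← Finset.mul_sum] at h7
      have h8 := W.sum_sizeProb_le hs (σ := σ) (A := A) (B := B) (fun k => Real.sqrt_nonneg _)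
        (fun k hk => hA k (hk.trans hk₀n))
        ((Finset.sum_le_sum_of_subset_of_nonneg (Finset.range_mono (by omega))
          (fun _ _ _ => by positivity)).trans hB)
      have h9 : V k₀ = M ^ 2 * k₀ := by
        rw [hM, div_pow, Real.sq_sqrt (hV0 k₀), Real.sq_sqrt hk0.le, div_mul_cancel₀ _ hk0.ne']
      have h10 : M ^ 2 * (k₀ * sizeProb p k₀)
          ≤ (2 * M * (8 * C ^ 3 * (A + B))) * (k₀ * sizeProb p k₀) := by
        rw [h9] at h7
        nlinarith [mul_le_mul_of_nonneg_left h8 (show 0 ≤ 2 * M by positivity)]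
      have h11 := le_of_mul_le_mul_right h10 (by positivity)
      -- From `M² ≤ 16 C³ (A + B) M` one factor `M` is cancelled; it is positive if the bound fails.
      by_contra hcon
      push Not at hcon
      have : 0 ≤ 16 * C ^ 3 * (A + B) := by positivity
      nlinarith
    · have : M = 0 := by
        rw [hM, hV]; simp only; rw [condMean_eq_zero hs, Real.sqrt_zero, zero_div]
      rw [this]; positivity
  calc √(V n) ≤ M * √n := hVM n le_rfl
    _ ≤ 16 * C ^ 3 * (A + B) * √n := by gcongr
    _ = _ := by ring

end PlaneTree

namespace PlaneTree

variable {p : PMF ℕ} {C η : ℝ}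

/-! ### Toll functions depending only on the order of the tree -/

lemma treeSum_size (μ : ℕ → ℝ) (k : ℕ) :
    treeSum p (fun T => μ T.size) k = μ k * sizeProb p k := by
  rw [← treeSum_const]; exact treeSum_congr p fun T hT => by rw [hT]

lemma treeSum_nested_size (μ : ℕ → ℝ) (k : ℕ) :
    treeSum p (nested (fun T => μ T.size) fun T => μ T.size) k
      = 2 * μ k * treeSum p (additive fun T => μ T.size) k - μ k * (μ k * sizeProb p k) := by
  rw [← treeSum_const_mul, ← treeSum_size, ← treeSum_const_mul, ← treeSum_sub]
  refine treeSum_congr p fun T hT => ?_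
  rw [nested, hT]; ring

lemma treeSum_additive_size (μ : ℕ → ℝ) (n : ℕ) : treeSum p (additive fun T => μ T.size) n
    = ∑ k ∈ Finset.range (n + 1), μ k * sizeProb p k * walkProb p (n - k) (n - k) := by
  rw [treeSum_additive]
  exact Finset.sum_congr rfl fun k _ => by rw [treeSum_size]

/-- The second moment bound when only large subtrees contribute. -/
lemma WalkBounds.condMean_additive_sq_le_of_large (W : WalkBounds p C η) {n : ℕ}
    (hn : n ∈ gwSizes p) {μ : ℕ → ℝ} {A : ℝ} (hμ : ∀ k, |μ k| ≤ A)
    (hsupp : ∀ k, 4 * k ≤ n → μ k = 0) :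
    condMean p (fun T => additive (fun T => μ T.size) T ^ 2) n ≤ 768 * C ^ 4 * A ^ 2 * n := by
  have hC := W.C_pos
  have hA0 : 0 ≤ A := (abs_nonneg _).trans (hμ 0)
  have hn1 := pos_of_mem_gwSizes hn
  have hn0 : (0 : ℝ) < n := by exact_mod_cast hn1
  set x := √(n : ℝ) with hx
  have hx0 : 0 < x := by positivity
  have hx2 : x * x = n := Real.mul_self_sqrt hn0.le
  have hx1 : √((n : ℝ) + 1) ≤ 2 * x := sqrt_add_one_le hn1
  set F := additive fun T => μ T.size with hF
  set w : ℕ → ℝ := fun k => μ k * sizeProb p k with hw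
  -- Only `k > n/4` matters, where `p_k` is of order `n^{-3/2}`; 8 is `4 ^ (3/2)`.
  have hwle : ∀ k, |w k| ≤ 8 * A * C / (n * x) := by
    intro k
    rcases le_or_gt (4 * k) n with h | h
    · simp only [hw, hsupp k h, zero_mul, abs_zero]; positivity
    · have hk0 : 1 ≤ k := by omega
      have hkn : (n : ℝ) ≤ 4 * k := by exact_mod_cast h.le
      have hk1 : (0 : ℝ) < k := by exact_mod_cast hk0
      have h1 : x ≤ 2 * √(k : ℝ) := by
        rw [hx, Real.sqrt_le_left (by positivity), mul_pow, Real.sq_sqrt hk1.le]; linarith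
      have h2 : n * x ≤ 8 * (k * √k) := by
        calc n * x ≤ (4 * k) * (2 * √(k : ℝ)) := by gcongr
          _ = _ := by ring
      have h3 := W.sizeProb_le k hk0
      rw [hw, abs_mul, abs_of_nonneg (sizeProb_nonneg p k)]
      calc |μ k| * sizeProb p k ≤ A * (C / (k * √k)) := by
            gcongr
            · exact sizeProb_nonneg p k
            · exact hμ k
        _ = 8 * A * C / (8 * (k * √k)) := by field_simp
        _ ≤ _ := by gcongr
  have hmean : ∀ k ≤ n, |treeSum p F k| ≤ 32 * A * C ^ 2 / n := by
    intro k hk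
    rw [hF, treeSum_additive_size]
    refine (Finset.abs_sum_le_sum_abs _ _).trans ?_
    have h1 : ∀ m ∈ Finset.range (k + 1), |μ m * sizeProb p m * walkProb p (k - m) (k - m)|
        ≤ 8 * A * C / (n * x) * C * (1 / √(((k - m : ℕ) : ℝ) + 1)) := by
      intro m _
      have h2 := W.walkProb_le (k - m)
      have h3 := walkProb_nonneg p (k - m) (k - m)
      rw [abs_mul, abs_of_nonneg h3, mul_assoc (8 * A * C / (n * x)), mul_one_div]
      exact mul_le_mul (hwle m) h2 h3 (by positivity)
    refine (Finset.sum_le_sum h1).trans ?_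
    rw [← Finset.mul_sum]
    have h2 : ∑ m ∈ Finset.range (k + 1), 1 / √(((k - m : ℕ) : ℝ) + 1) ≤ 4 * x := by
      refine (sum_range_one_div_sqrt_sub_le k).trans ?_
      have : √((k : ℝ) + 1) ≤ √((n : ℝ) + 1) := by gcongr
      linarith
    calc _ ≤ 8 * A * C / (n * x) * C * (4 * x) := by gcongr
      _ = _ := by field_simp; ring
  have h1 := treeSum_additive_mul p (fun T => μ T.size) (fun T => μ T.size) n
  have e1 : treeSum p (fun T => F T * F T) n = condMean p (fun T => F T ^ 2) n * sizeProb p n := by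
    rw [condMean_mul_sizeProb]; exact treeSum_congr p fun T _ => by ring
  have hS1 : ∑ k ∈ Finset.range (n + 1), treeSum p (nested (fun T => μ T.size) fun T => μ T.size) k
      * walkProb p (n - k) (n - k) ≤ 256 * A ^ 2 * C ^ 3 * (1 / x) := by
    have h2 : ∀ k ∈ Finset.range (n + 1),
        treeSum p (nested (fun T => μ T.size) fun T => μ T.size) k * walkProb p (n - k) (n - k)
        ≤ 64 * A ^ 2 * C ^ 3 / n * (1 / √(((n - k : ℕ) : ℝ) + 1)) := by
      intro k hk
      have hk' : k ≤ n := by simpa [Nat.lt_succ_iff] using hk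
      have h3 : treeSum p (nested (fun T => μ T.size) fun T => μ T.size) k
          ≤ 2 * (A * (32 * A * C ^ 2 / n)) := by
        rw [treeSum_nested_size]
        have h4 : μ k * treeSum p F k ≤ A * (32 * A * C ^ 2 / n) := by
          refine (le_abs_self _).trans ?_
          rw [abs_mul]
          exact mul_le_mul (hμ k) (hmean k hk') (abs_nonneg _) hA0
        have h5 : 0 ≤ μ k * (μ k * sizeProb p k) := by
          have := sizeProb_nonneg p k
          nlinarith [mul_nonneg (mul_self_nonneg (μ k)) this]
        linarith
      have h6 := W.walkProb_le (n - k)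
      have h7 := walkProb_nonneg p (n - k) (n - k)
      calc _ ≤ 2 * (A * (32 * A * C ^ 2 / n)) * (C / √(((n - k : ℕ) : ℝ) + 1)) :=
            mul_le_mul h3 h6 h7 (by positivity)
        _ = _ := by ring
    refine (Finset.sum_le_sum h2).trans ?_
    rw [← Finset.mul_sum]
    have h3 : ∑ k ∈ Finset.range (n + 1), 1 / √(((n - k : ℕ) : ℝ) + 1) ≤ 4 * x := by
      refine (sum_range_one_div_sqrt_sub_le n).trans ?_
      linarith
    calc _ ≤ 64 * A ^ 2 * C ^ 3 / n * (4 * x) := by gcongr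
      _ = _ := by rw [← hx2]; field_simp; ring
  -- At most `(2n)²` terms, each of order `n^{-5/2}`: two weights `n^{-3/2}` and a two-hole weight
  -- `n^{1/2}`. No cancellation is needed.
  have hS2 : ∑ k ∈ Finset.range (n + 1), ∑ m ∈ Finset.range (n - k + 1),
      treeSum p (fun T => μ T.size) k * treeSum p (fun T => μ T.size) m *
        (((n - k - m : ℕ) + 1 : ℝ) * walkProb p (n - k - m) (n - k - m + 1))
      ≤ 512 * A ^ 2 * C ^ 3 * (1 / x) := by
    have h2 : ∀ k m : ℕ, treeSum p (fun T => μ T.size) k * treeSum p (fun T => μ T.size) m *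
        (((n - k - m : ℕ) + 1 : ℝ) * walkProb p (n - k - m) (n - k - m + 1))
        ≤ 128 * A ^ 2 * C ^ 3 * x / (n ^ 2 * x ^ 2) := by
      intro k m
      rw [treeSum_size, treeSum_size]
      set j := n - k - m with hj
      have h3 := W.walkProb_succ_le j
      have h4 : ((j : ℝ) + 1) * walkProb p j (j + 1) ≤ C * (2 * x) := by
        have hj0 : (0 : ℝ) < (j : ℝ) + 1 := by positivity
        have hjn : √((j : ℝ) + 1) ≤ √((n : ℝ) + 1) := by
          have : (j : ℝ) ≤ n := by exact_mod_cast (by omega : j ≤ n)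
          gcongr
        calc _ ≤ ((j : ℝ) + 1) * (C / √((j : ℝ) + 1)) := by gcongr
          _ = C * √((j : ℝ) + 1) := by
            rw [mul_div_left_comm, Real.div_sqrt]
          _ ≤ _ := by gcongr; linarith
      have h5 : 0 ≤ ((j : ℝ) + 1) * walkProb p j (j + 1) := by
        have := walkProb_nonneg p j (j + 1); positivity
      refine (le_abs_self _).trans ?_
      rw [abs_mul, abs_mul, abs_of_nonneg h5]
      calc _ ≤ (8 * A * C / (n * x)) * (8 * A * C / (n * x)) * (C * (2 * x)) := by
            gcongr
            · exact hwle k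
            · exact hwle m
        _ = _ := by field_simp; ring
    have h3 : ∀ k ∈ Finset.range (n + 1), ∑ m ∈ Finset.range (n - k + 1),
        treeSum p (fun T => μ T.size) k * treeSum p (fun T => μ T.size) m *
        (((n - k - m : ℕ) + 1 : ℝ) * walkProb p (n - k - m) (n - k - m + 1))
        ≤ (2 * n) * (128 * A ^ 2 * C ^ 3 * x / (n ^ 2 * x ^ 2)) := by
      intro k _
      refine (Finset.sum_le_card_nsmul _ _ _ fun m _ => h2 k m).trans ?_
      rw [Finset.card_range, nsmul_eq_mul]
      have : ((n - k + 1 : ℕ) : ℝ) ≤ 2 * n := by exact_mod_cast (by omega : n - k + 1 ≤ 2 * n)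
      gcongr
    refine (Finset.sum_le_card_nsmul _ _ _ h3).trans ?_
    rw [Finset.card_range, nsmul_eq_mul]
    have : ((n + 1 : ℕ) : ℝ) ≤ 2 * n := by exact_mod_cast (by omega : n + 1 ≤ 2 * n)
    calc _ ≤ (2 * n) * ((2 * n) * (128 * A ^ 2 * C ^ 3 * x / (n ^ 2 * x ^ 2))) := by gcongr
      _ = _ := by field_simp; ring
  have hp0 := (mem_gwSizes_iff p n).1 hn
  have h2 : condMean p (fun T => F T ^ 2) n * sizeProb p n
      ≤ 768 * C ^ 4 * A ^ 2 * n * sizeProb p n := by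
    rw [← e1, h1]
    refine (add_le_add hS1 hS2).trans ?_
    have := mul_le_mul_of_nonneg_left (W.one_div_sqrt_le hn)
      (show 0 ≤ 768 * A ^ 2 * C ^ 3 by positivity)
    nlinarith
  exact le_of_mul_le_mul_right h2 hp0

lemma WalkBounds.one_le (W : WalkBounds p C η) {n : ℕ} (hn : n ∈ gwSizes p) : 1 ≤ C := by
  have hC := W.C_pos
  have h1 := W.le_sizeProb n hn
  have hn1 := pos_of_mem_gwSizes hn
  have hn0 : (0 : ℝ) < n := by exact_mod_cast hn1
  have h2 := W.sizeProb_le n hn1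
  rw [le_div_iff₀ (by positivity)] at h2
  nlinarith

lemma mul_sizeProb_eq {n : ℕ} (hn : 1 ≤ n) : (n : ℝ) * sizeProb p n = walkProb p n (n - 1) := by
  obtain ⟨j, rfl⟩ := Nat.exists_eq_add_of_le' hn
  have := natCast_mul_sizeProb p j
  push_cast
  rw [this]

/-- The main covariance estimate for disjoint subtrees. -/
lemma WalkBounds.abs_disjoint_le (W : WalkBounds p C η) {n k m : ℕ} (hn : n ∈ gwSizes p)
    (hk : k ∈ gwSizes p) (hm : m ∈ gwSizes p) (hkn : 4 * k ≤ n) (hmn : 4 * m ≤ n) :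
    |n * walkProb p (n - k - m) (n - k - m + 1)
        - walkProb p (n - k) (n - k) * walkProb p (n - m) (n - m) / sizeProb p n|
      ≤ C ^ 2 * (1 / √n + (k + m) / n + k * m / (n * √n)) := by
  have hC := W.C_pos
  have hn1 := pos_of_mem_gwSizes hn
  have hn0 : (0 : ℝ) < n := by exact_mod_cast hn1
  have hp0 := (mem_gwSizes_iff p n).1 hn
  have h1 := W.product n hn k hk m hm hkn hmn
  rw [← mul_sizeProb_eq hn1] at h1
  set c := walkProb p (n - k - m) (n - k - m + 1)
  set a := walkProb p (n - k) (n - k)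
  set a' := walkProb p (n - m) (n - m)
  -- Multiplying by `n p_n / (n p_n)` brings out the difference of products estimated by Fourier
  -- inversion, since `n p_n` is a walk probability.
  have e : n * c - a * a' / sizeProb p n
      = (c * (n * sizeProb p n) - a * a') * (1 / sizeProb p n) := by field_simp
  set x := √(n : ℝ) with hx
  have hx0 : 0 < x := by positivity
  have hx2 : (n : ℝ) = x ^ 2 := (Real.sq_sqrt hn0.le).symm
  have h2 : 1 / sizeProb p n ≤ C * (n * x) := by
    rw [div_le_iff₀ hp0]
    linarith [W.le_sizeProb n hn]
  rw [e, abs_mul, abs_of_pos (show 0 < 1 / sizeProb p n by positivity)]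
  calc _ ≤ C * (1 / (n : ℝ) ^ 2 + (k + m) / (n ^ 2 * x) + (k : ℝ) * m / n ^ 3) * (C * (n * x)) := by
        gcongr
    _ = _ := by
        rw [hx2]; field_simp

lemma WalkBounds.walkProb_le_two_div (W : WalkBounds p C η) {n k : ℕ} (hn : 1 ≤ n)
    (h : 2 * k ≤ n) : walkProb p (n - k) (n - k) ≤ 2 * C / √n := by
  have h1 := W.walkProb_le (n - k)
  have h2 := mul_le_mul_of_nonneg_left (one_div_sqrt_sub_le hn h) W.C_pos.le
  rw [mul_one_div] at h2
  exact (h1.trans h2).trans (le_of_eq (by ring))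

lemma WalkBounds.walkProb_succ_le_two_div (W : WalkBounds p C η) {n k m : ℕ} (hn : 1 ≤ n)
    (hk : 4 * k ≤ n) (hm : 4 * m ≤ n) :
    walkProb p (n - k - m) (n - k - m + 1) ≤ 2 * C / √n := by
  have h1 := W.walkProb_succ_le (n - k - m)
  have h2 := mul_le_mul_of_nonneg_left (one_div_sqrt_sub_le hn (show 2 * (k + m) ≤ n by omega))
    W.C_pos.le
  rw [mul_one_div, ← Nat.sub_sub] at h2
  exact (h1.trans h2).trans (le_of_eq (by ring))

/-- The contribution of a pair of equal orders to the variance. -/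
lemma WalkBounds.abs_diagonal_le (W : WalkBounds p C η) {n k : ℕ} (hn : n ∈ gwSizes p)
    (hk : k ∈ gwSizes p) (hkn : 4 * k ≤ n) :
    |sizeProb p k * walkProb p (n - k) (n - k) + sizeProb p k * sizeProb p k *
        (((n - k - k : ℕ) + 1 : ℝ) * walkProb p (n - k - k) (n - k - k + 1)
          - walkProb p (n - k) (n - k) * walkProb p (n - k) (n - k) / sizeProb p n)|
      ≤ 10 * C ^ 4 / √n * (1 / (k * √k)) := by
  have hC := W.C_pos
  have hC1 := W.one_le hn
  have hn1 := pos_of_mem_gwSizes hn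
  have hk1 := pos_of_mem_gwSizes hk
  have hn0 : (1 : ℝ) ≤ n := by exact_mod_cast hn1
  have hk0 : (1 : ℝ) ≤ k := by exact_mod_cast hk1
  have hkn' : (k : ℝ) ≤ n := by exact_mod_cast (by omega : k ≤ n)
  have h1 := W.abs_disjoint_le hn hk hk hkn hkn
  have h2 := W.walkProb_le_two_div hn1 (show 2 * k ≤ n by omega)
  have h3 := W.walkProb_succ_le_two_div hn1 hkn hkn
  have h4 := W.sizeProb_le k hk1
  have hcast : ((n - k - k : ℕ) : ℝ) = n - k - k := by
    rw [Nat.cast_sub (by omega), Nat.cast_sub (by omega)]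
  have hX0 := walkProb_nonneg p (n - k) (n - k)
  have hc0 := walkProb_nonneg p (n - k - k) (n - k - k + 1)
  have hp0 := sizeProb_nonneg p k
  rw [hcast]
  set c := walkProb p (n - k - k) (n - k - k + 1)
  set X := walkProb p (n - k) (n - k)
  set x := √(n : ℝ) with hx
  have hx0 : 1 ≤ x := by rw [hx, Real.one_le_sqrt]; exact hn0
  have hx2 : (n : ℝ) = x ^ 2 := (Real.sq_sqrt (by linarith)).symm
  set u := √(k : ℝ) with hu
  have hu0 : 1 ≤ u := by rw [hu, Real.one_le_sqrt]; exact hk0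
  have hu2 : (k : ℝ) = u ^ 2 := (Real.sq_sqrt (by linarith)).symm
  have hux : u ≤ x := Real.sqrt_le_sqrt hkn'
  have hQ : |((n : ℝ) - k - k + 1) * c - X * X / sizeProb p n| ≤ 8 * C ^ 2 * k / x := by
    -- The number of places differs from `n` by `2k - 1`; this discrepancy is affordable because
    -- both weights are `p_k`.
    have e : ((n : ℝ) - k - k + 1) * c - X * X / sizeProb p n
        = (n * c - X * X / sizeProb p n) - (2 * k - 1) * c := by ring
    rw [e]
    refine (abs_sub _ _).trans ?_
    rw [abs_of_nonneg (show 0 ≤ (2 * (k : ℝ) - 1) * c by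
      apply mul_nonneg _ hc0; linarith)]
    have h5 : (2 * (k : ℝ) - 1) * c ≤ 2 * k * (2 * C / x) := by
      apply mul_le_mul (by linarith) h3 hc0 (by positivity)
    have h6 : 1 / x + ((k : ℝ) + k) / n + k * k / (n * x) ≤ 4 * (k / x) := by
      have i1 : 1 / x ≤ k / x := by gcongr
      have i2 : ((k : ℝ) + k) / n ≤ 2 * (k / x) := by
        have : (k : ℝ) / n ≤ k / x := by gcongr; rw [hx2]; nlinarith
        have e2 : ((k : ℝ) + k) / n = 2 * (k / n) := by ring
        linarith
      have i3 : (k : ℝ) * k / (n * x) ≤ k / x := by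
        have : (k : ℝ) * k / (n * x) ≤ n * k / (n * x) := by gcongr
        refine this.trans (le_of_eq ?_)
        rw [mul_div_mul_left _ _ (by linarith)]
      linarith
    have h7 : C ^ 2 * (1 / x + ((k : ℝ) + k) / n + k * k / (n * x)) ≤ C ^ 2 * (4 * (k / x)) := by
      gcongr
    have h8 : 2 * (k : ℝ) * (2 * C / x) ≤ 4 * C ^ 2 * (k / x) := by
      have : C ≤ C ^ 2 := by nlinarith
      have e3 : 2 * (k : ℝ) * (2 * C / x) = 4 * C * (k / x) := by ring
      rw [e3]; gcongr
    have e4 : 8 * C ^ 2 * k / x = C ^ 2 * (4 * (k / x)) + 4 * C ^ 2 * (k / x) := by ring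
    linarith
  refine (abs_add_le _ _).trans ?_
  rw [abs_of_nonneg (mul_nonneg hp0 hX0), abs_mul, abs_of_nonneg (mul_nonneg hp0 hp0)]
  calc _ ≤ C / (k * u) * (2 * C / x) + C / (k * u) * (C / (k * u)) * (8 * C ^ 2 * k / x) := by
        gcongr
    _ = C ^ 2 * 2 / x * (1 / (k * u)) + 8 * C ^ 4 / x * (1 / (k * u)) * (1 / u) := by
        field_simp
    _ ≤ C ^ 4 * 2 / x * (1 / (k * u)) + 8 * C ^ 4 / x * (1 / (k * u)) * 1 := by
        have : C ^ 2 ≤ C ^ 4 := pow_le_pow_right₀ hC1 (by norm_num)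
        gcongr
        rw [div_le_one (by linarith)]; exact hu0
    _ = _ := by ring

/-- The part of the covariance kernel that is summable. -/
noncomputable def summableKernel (η : ℝ) (n k m : ℕ) : ℝ :=
  (k : ℝ) ^ (-(1 + η / 2)) * (1 / (m * √m)) + 1 / √n * (1 / √k * (1 / (m * √m)))
    + 1 / n * (1 / √k * (1 / √m)) + 1 / (k * √k) * (1 / (m * √m))

/-- The part of the covariance kernel that is bounded on a weighted space of square summable
sequences. -/
noncomputable def hardyKernel (k m : ℕ) : ℝ :=
  1 / (k * √k * √m) + 1 / (k * √k * √(((k - m : ℕ) : ℝ) + 1))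

lemma WalkBounds.sizeProb_mul_abs_near_le (W : WalkBounds p C η) {k m : ℕ}
    (hk : k ∈ gwSizes p) (hm : m ∈ gwSizes p) (hmk : m < k) :
    sizeProb p m * |walkProb p (k - m) (k - m) - k * sizeProb p k|
      ≤ 8 * C ^ 2 * ((k : ℝ) ^ (-(1 + η / 2)) * (1 / (m * √m)) + hardyKernel k m) := by
  have hC := W.C_pos
  have hk1 := pos_of_mem_gwSizes hk
  have hm1 := pos_of_mem_gwSizes hm
  have hk0 : (0 : ℝ) < k := by exact_mod_cast hk1
  have hm0 : (0 : ℝ) < m := by exact_mod_cast hm1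
  have h4 := W.sizeProb_le m hm1
  have hp0 := sizeProb_nonneg p m
  rw [hardyKernel]
  set q := √(((k - m : ℕ) : ℝ) + 1) with hq
  have hq0 : 0 < q := by positivity
  set E := (k : ℝ) ^ (-(1 + η / 2)) with hE
  have hE0 : 0 ≤ E := by positivity
  -- For `m ≤ k/2` the difference is genuinely small. Close to the diagonal both terms are bounded
  -- separately by `C / √(k - m + 1)`, which produces the second part of `hardyKernel`.
  rcases le_or_gt (2 * m) k with h | h
  · have h1 := W.near k hk m hm h
    rw [← mul_sizeProb_eq hk1] at h1
    calc _ ≤ C / (m * √m) * (C * (E + m / (k * √k))) := by gcongr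
      _ = C ^ 2 * (E * (1 / (m * √m)) + 1 / (k * √k * √m)) := by field_simp
      _ ≤ C ^ 2 * (8 * (E * (1 / (m * √m)) + 1 / (k * √k * √m))) := by
          have : 0 ≤ E * (1 / (m * √m)) + 1 / (k * √k * √m) := by positivity
          gcongr; linarith
      _ ≤ _ := by
          have : 0 ≤ C ^ 2 * (1 / ((k : ℝ) * √k * q)) := by positivity
          linarith
  · have h1 := W.walkProb_le (k - m)
    have h2 := walkProb_nonneg p (k - m) (k - m)
    have h3 : k * sizeProb p k ≤ C / q := by
      have hqk : q ≤ √(k : ℝ) := by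
        apply Real.sqrt_le_sqrt; exact_mod_cast (by omega : k - m + 1 ≤ k)
      calc k * sizeProb p k ≤ k * (C / (k * √k)) := by
            have := W.sizeProb_le k hk1; gcongr
        _ = C / √k := by field_simp
        _ ≤ _ := by gcongr
    have h5 : |walkProb p (k - m) (k - m) - k * sizeProb p k| ≤ C / q := by
      have : 0 ≤ k * sizeProb p k := mul_nonneg hk0.le (sizeProb_nonneg p k)
      rw [abs_le]; constructor <;> linarith
    have h6 : (k : ℝ) * √k ≤ 8 * (m * √m) := by
      have i1 : (k : ℝ) ≤ 2 * m := by exact_mod_cast h.le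
      have i2 : √(k : ℝ) ≤ 2 * √m := by
        rw [Real.sqrt_le_left (by positivity), mul_pow, Real.sq_sqrt hm0.le]; linarith
      calc (k : ℝ) * √k ≤ (2 * m) * (2 * √m) := by gcongr
        _ ≤ _ := by
          have : 0 ≤ (m : ℝ) * √m := by positivity
          linarith
    calc _ ≤ C / (m * √m) * (C / q) := by gcongr
      _ = C ^ 2 * 8 / (8 * (m * √m)) / q := by field_simp
      _ ≤ C ^ 2 * 8 / (k * √k) / q := by gcongr
      _ = 8 * C ^ 2 * (1 / (k * √k * q)) := by field_simp
      _ ≤ _ := by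
          have : 0 ≤ E * (1 / (m * √m)) + 1 / (k * √k * √m) := by positivity
          have : 0 ≤ 8 * C ^ 2 * (E * (1 / (m * √m)) + 1 / (k * √k * √m)) := by positivity
          linarith

/-- The contribution of a pair of different orders to the variance. -/
lemma WalkBounds.abs_offDiagonal_le (W : WalkBounds p C η) {n k m : ℕ} (hn : n ∈ gwSizes p)
    (hk : k ∈ gwSizes p) (hm : m ∈ gwSizes p) (hmk : m < k) (hkn : 4 * k ≤ n) :
    |sizeProb p m * walkProb p (k - m) (k - m) * walkProb p (n - k) (n - k)
      + sizeProb p k * sizeProb p m *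
        (((n - k - m : ℕ) + 1 : ℝ) * walkProb p (n - k - m) (n - k - m + 1)
          - walkProb p (n - k) (n - k) * walkProb p (n - m) (n - m) / sizeProb p n)|
      ≤ 20 * C ^ 4 / √n * (summableKernel η n k m + hardyKernel k m) := by
  have hC := W.C_pos
  have hC1 := W.one_le hn
  have hmn : 4 * m ≤ n := by omega
  have hn1 := pos_of_mem_gwSizes hn
  have hk1 := pos_of_mem_gwSizes hk
  have hm1 := pos_of_mem_gwSizes hm
  have hn0 : (1 : ℝ) ≤ n := by exact_mod_cast hn1
  have hk0 : (1 : ℝ) ≤ k := by exact_mod_cast hk1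
  have hm0 : (1 : ℝ) ≤ m := by exact_mod_cast hm1
  have hmk' : (m : ℝ) ≤ k := by exact_mod_cast hmk.le
  have h0 := W.sizeProb_mul_abs_near_le hk hm hmk
  have h1 := W.abs_disjoint_le hn hk hm hkn hmn
  have h2 := W.walkProb_le_two_div hn1 (show 2 * k ≤ n by omega)
  have h3 := W.walkProb_succ_le_two_div hn1 hkn hmn
  have h4 := W.sizeProb_le k hk1
  have h5 := W.sizeProb_le m hm1
  have h6 := W.diff n hn k hk m hm hkn hmn
  have hcast : ((n - k - m : ℕ) : ℝ) = n - k - m := by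
    rw [Nat.cast_sub (by omega), Nat.cast_sub (by omega)]
  have hX0 := walkProb_nonneg p (n - k) (n - k)
  have hc0 := walkProb_nonneg p (n - k - m) (n - k - m + 1)
  have hpk := sizeProb_nonneg p k
  have hpm := sizeProb_nonneg p m
  rw [hcast]
  set c := walkProb p (n - k - m) (n - k - m + 1)
  set X := walkProb p (n - k) (n - k)
  set X' := walkProb p (n - m) (n - m)
  set Y := walkProb p (k - m) (k - m)
  set x := √(n : ℝ) with hx
  have hx0 : 1 ≤ x := by rw [hx, Real.one_le_sqrt]; exact hn0
  have hCC : C ≤ C ^ 2 := by nlinarith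
  have hQ : |k * X + (((n : ℝ) - k - m + 1) * c - X * X' / sizeProb p n)|
      ≤ 4 * C ^ 2 * (k / n + k * m / (n * x) + m / x + 1 / x) := by
    -- The deficit `-k c` in the number of places pairs with `k X`, so only `k (X - c)` has to be
    -- estimated.
    have e : k * X + (((n : ℝ) - k - m + 1) * c - X * X' / sizeProb p n)
        = k * (X - c) + (n * c - X * X' / sizeProb p n) - (m - 1) * c := by ring
    rw [e]
    refine (abs_sub _ _).trans ?_
    have i1 : |(k : ℝ) * (X - c)| ≤ k * (C * (1 / n + m / (n * x))) := by
      rw [abs_mul, abs_of_nonneg (by linarith : (0 : ℝ) ≤ k)]; gcongr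
    have i2 : |((m : ℝ) - 1) * c| ≤ m * (2 * C / x) := by
      rw [abs_of_nonneg (mul_nonneg (by linarith) hc0)]
      exact mul_le_mul (by linarith) h3 hc0 (by linarith)
    have i3 : ((k : ℝ) + m) / n ≤ 2 * (k / n) := by
      have : ((k : ℝ) + m) / n ≤ (k + k) / n := by gcongr
      exact this.trans (le_of_eq (by ring))
    have j1 : 0 ≤ (k : ℝ) / n := by positivity
    have j2 : 0 ≤ (k : ℝ) * m / (n * x) := by positivity
    have j3 : 0 ≤ (m : ℝ) / x := by positivity
    have j4 : 0 ≤ 1 / x := by positivity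
    have e1 : k * (C * (1 / n + m / (n * x))) = C * (k / n) + C * (k * m / (n * x)) := by ring
    have e2 : m * (2 * C / x) = 2 * C * (m / x) := by ring
    have k1 := mul_le_mul_of_nonneg_right hCC j1
    have k2 := mul_le_mul_of_nonneg_right hCC j2
    have k3 := mul_le_mul_of_nonneg_right hCC j3
    have k4 := mul_le_mul_of_nonneg_left i3 (sq_nonneg C)
    have k5 := mul_nonneg (sq_nonneg C) j1
    have k6 := mul_nonneg (sq_nonneg C) j2
    have k7 := mul_nonneg (sq_nonneg C) j3
    have k8 := mul_nonneg (sq_nonneg C) j4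
    have := abs_add_le ((k : ℝ) * (X - c)) (n * c - X * X' / sizeProb p n)
    linarith
  -- Adding and subtracting `k p_k p_m X` makes the main part of the nested contribution available
  -- to compensate the disjoint one.
  have e : sizeProb p m * Y * X + sizeProb p k * sizeProb p m *
        (((n : ℝ) - k - m + 1) * c - X * X' / sizeProb p n)
      = sizeProb p m * (Y - k * sizeProb p k) * X + sizeProb p k * sizeProb p m *
        (k * X + (((n : ℝ) - k - m + 1) * c - X * X' / sizeProb p n)) := by ring
  rw [e]
  refine (abs_add_le _ _).trans ?_
  rw [abs_mul, abs_mul, abs_mul, abs_of_nonneg hpm, abs_of_nonneg hX0,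
    abs_of_nonneg (mul_nonneg hpk hpm)]
  set E := (k : ℝ) ^ (-(1 + η / 2)) with hE
  have hE0 : 0 ≤ E := by positivity
  have hH0 : 1 / ((k : ℝ) * √k * √m) ≤ hardyKernel k m := by
    rw [hardyKernel]
    have : 0 ≤ 1 / ((k : ℝ) * √k * √(((k - m : ℕ) : ℝ) + 1)) := by positivity
    linarith
  have hH1 : 0 ≤ hardyKernel k m := le_trans (by positivity) hH0
  have hu2 : (k : ℝ) = √k ^ 2 := (Real.sq_sqrt (by linarith)).symm
  have hv2 : (m : ℝ) = √m ^ 2 := (Real.sq_sqrt (by linarith)).symm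
  have hx2 : (n : ℝ) = x ^ 2 := (Real.sq_sqrt (by linarith)).symm
  have hu0 : 0 < √(k : ℝ) := by positivity
  have hv0 : 0 < √(m : ℝ) := by positivity
  have b1 : sizeProb p m * |Y - k * sizeProb p k| * X
      ≤ 16 * C ^ 4 / x * (E * (1 / (m * √m)) + hardyKernel k m) := by
    calc _ ≤ 8 * C ^ 2 * (E * (1 / (m * √m)) + hardyKernel k m) * (2 * C / x) := by gcongr
      _ = 16 * C ^ 3 / x * (E * (1 / (m * √m)) + hardyKernel k m) := by ring
      _ ≤ _ := by
        have : C ^ 3 ≤ C ^ 4 := pow_le_pow_right₀ hC1 (by norm_num)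
        gcongr
  have b2 : sizeProb p k * sizeProb p m *
        |k * X + (((n : ℝ) - k - m + 1) * c - X * X' / sizeProb p n)|
      ≤ 4 * C ^ 4 / x * (1 / x * (1 / √k * (1 / (m * √m))) + 1 / n * (1 / √k * (1 / √m))
          + 1 / (k * √k * √m) + 1 / (k * √k) * (1 / (m * √m))) := by
    calc _ ≤ C / (k * √k) * (C / (m * √m)) *
          (4 * C ^ 2 * (k / n + k * m / (n * x) + m / x + 1 / x)) := by gcongr
      _ = _ := by
        generalize √(k : ℝ) = u at *
        generalize √(m : ℝ) = v at *
        rw [hu2, hv2, hx2]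
        field_simp
  refine (add_le_add b1 b2).trans ?_
  rw [summableKernel]
  have z1 : 0 ≤ E * (1 / (m * √m)) := by positivity
  have z2 : 0 ≤ 1 / x * (1 / √k * (1 / (m * √m))) + 1 / n * (1 / √k * (1 / √m))
    + 1 / ((k : ℝ) * √k) * (1 / (m * √m)) := by positivity
  have hD : 0 ≤ C ^ 4 / x := by positivity
  have y1 := mul_nonneg hD z1
  have y2 := mul_nonneg hD z2
  have y3 := mul_le_mul_of_nonneg_left hH0 hD
  have f1 : 16 * C ^ 4 / x = 16 * (C ^ 4 / x) := by ring
  have f2 : 4 * C ^ 4 / x = 4 * (C ^ 4 / x) := by ring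
  have f3 : 20 * C ^ 4 / x = 20 * (C ^ 4 / x) := by ring
  rw [f1, f2, f3]
  linarith

end PlaneTree

/-! ### Summing the covariance kernel for tolls depending on the order. -/

namespace PlaneTree

variable {p : PMF ℕ} {C η : ℝ}

/-- The contribution to the variance of a pair of equal orders. -/
noncomputable def diagonalTerm (p : PMF ℕ) (n k : ℕ) : ℝ :=
  sizeProb p k * walkProb p (n - k) (n - k) + sizeProb p k * sizeProb p k *
    (((n - k - k : ℕ) + 1 : ℝ) * walkProb p (n - k - k) (n - k - k + 1)
      - walkProb p (n - k) (n - k) * walkProb p (n - k) (n - k) / sizeProb p n)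

/-- The contribution to the variance of a pair of different orders. -/
noncomputable def offDiagonalTerm (p : PMF ℕ) (n k m : ℕ) : ℝ :=
  sizeProb p m * walkProb p (k - m) (k - m) * walkProb p (n - k) (n - k)
    + sizeProb p k * sizeProb p m *
      (((n - k - m : ℕ) + 1 : ℝ) * walkProb p (n - k - m) (n - k - m + 1)
        - walkProb p (n - k) (n - k) * walkProb p (n - m) (n - m) / sizeProb p n)

/-- An exact formula for `p_n` times the variance. For `m < k` the nested and disjoint contributions
are kept in one term, because they are only small together. -/
lemma treeSum_additive_size_sq_sub {n : ℕ} {μ : ℕ → ℝ} (hsupp : ∀ k, n < 4 * k → μ k = 0) :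
    treeSum p (fun T => additive (fun T => μ T.size) T ^ 2) n
        - treeSum p (additive fun T => μ T.size) n ^ 2 / sizeProb p n
      = ∑ k ∈ Finset.range (n + 1), μ k ^ 2 * diagonalTerm p n k
        + 2 * ∑ k ∈ Finset.range (n + 1), ∑ m ∈ Finset.range k,
          μ k * μ m * offDiagonalTerm p n k m := by
  set s : ℕ → ℕ → ℝ := fun k m => μ k * sizeProb p k * (μ m * sizeProb p m) *
    (((n - k - m : ℕ) + 1 : ℝ) * walkProb p (n - k - m) (n - k - m + 1)
      - walkProb p (n - k) (n - k) * walkProb p (n - m) (n - m) / sizeProb p n) with hs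
  have hsymm : ∀ k m, s k m = s m k := by
    intro k m
    simp only [hs]
    rw [Nat.sub_right_comm n k m]; ring
  have e1 : (fun T => additive (fun T => μ T.size) T ^ 2)
      = fun T => additive (fun T => μ T.size) T * additive (fun T => μ T.size) T := by
    ext T; ring
  have e2 : ∑ k ∈ Finset.range (n + 1), ∑ m ∈ Finset.range (n - k + 1),
      treeSum p (fun T => μ T.size) k * treeSum p (fun T => μ T.size) m *
        (((n - k - m : ℕ) + 1 : ℝ) * walkProb p (n - k - m) (n - k - m + 1))
      = ∑ k ∈ Finset.range (n + 1), ∑ m ∈ Finset.range (n + 1),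
        μ k * sizeProb p k * (μ m * sizeProb p m) *
        (((n - k - m : ℕ) + 1 : ℝ) * walkProb p (n - k - m) (n - k - m + 1)) := by
    refine Finset.sum_congr rfl fun k hk => ?_
    -- If `k + m > n`, one of the two orders exceeds `n/4` and its toll vanishes; truncated
    -- subtraction therefore does no harm and the index set becomes symmetric.
    rw [← Finset.sum_subset (Finset.range_mono (by omega : n - k + 1 ≤ n + 1))]
    · simp_rw [treeSum_size]
    · intro m _ hm
      simp only [Finset.mem_range, not_lt] at hm
      rcases lt_or_ge n (4 * k) with h | h
      · rw [hsupp k h]; ring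
      · rw [hsupp m (by omega)]; ring
  have e3 : treeSum p (additive fun T => μ T.size) n ^ 2 / sizeProb p n
      = ∑ k ∈ Finset.range (n + 1), ∑ m ∈ Finset.range (n + 1),
        μ k * sizeProb p k * (μ m * sizeProb p m) *
        (walkProb p (n - k) (n - k) * walkProb p (n - m) (n - m) / sizeProb p n) := by
    rw [treeSum_additive_size, sq, Finset.sum_mul_sum, Finset.sum_div]
    refine Finset.sum_congr rfl fun k _ => ?_
    rw [Finset.sum_div]
    exact Finset.sum_congr rfl fun m _ => by ring
  -- The index `m = k` is the subtree paired with itself: it appears twice in the mean and is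
  -- subtracted once by `nested`.
  have e4 : ∀ k, treeSum p (nested (fun T => μ T.size) fun T => μ T.size) k
      = μ k ^ 2 * sizeProb p k
        + 2 * ∑ m ∈ Finset.range k, μ k * μ m * (sizeProb p m * walkProb p (k - m) (k - m)) := by
    intro k
    have : ∑ m ∈ Finset.range k, μ k * μ m * (sizeProb p m * walkProb p (k - m) (k - m))
        = μ k * ∑ m ∈ Finset.range k, μ m * sizeProb p m * walkProb p (k - m) (k - m) := by
      rw [Finset.mul_sum]
      exact Finset.sum_congr rfl fun m _ => by ring
    rw [this, treeSum_nested_size, treeSum_additive_size, Finset.sum_range_succ, Nat.sub_self,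
      walkProb_zero, if_pos rfl]
    ring
  rw [e1, treeSum_additive_mul, e2, e3, add_sub_assoc, ← Finset.sum_sub_distrib]
  simp_rw [← Finset.sum_sub_distrib, ← mul_sub]
  rw [sum_range_sum_range_symm (n + 1) (f := s) hsymm, Finset.mul_sum, Finset.mul_sum,
    ← Finset.sum_add_distrib, ← Finset.sum_add_distrib, ← Finset.sum_add_distrib]
  refine Finset.sum_congr rfl fun k _ => ?_
  rw [e4, add_mul, mul_assoc 2, Finset.sum_mul]
  have e6 : ∑ m ∈ Finset.range k, μ k * μ m * offDiagonalTerm p n k m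
      = ∑ m ∈ Finset.range k, μ k * μ m * (sizeProb p m * walkProb p (k - m) (k - m))
          * walkProb p (n - k) (n - k) + ∑ m ∈ Finset.range k, s k m := by
    rw [← Finset.sum_add_distrib]
    refine Finset.sum_congr rfl fun m _ => ?_
    rw [offDiagonalTerm, hs]; ring
  rw [e6, diagonalTerm, hs]
  ring

lemma sum_sum_range_le_of_prod (n : ℕ) {a b : ℕ → ℝ} {A B : ℝ} (ha : ∀ k, 0 ≤ a k)
    (hb : ∀ k, 0 ≤ b k) (hA : ∑ k ∈ Finset.range (n + 1), a k ≤ A)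
    (hB : ∑ k ∈ Finset.range (n + 1), b k ≤ B) :
    ∑ k ∈ Finset.range (n + 1), ∑ m ∈ Finset.range k, a k * b m ≤ A * B := by
  have hA0 : 0 ≤ A := (Finset.sum_nonneg fun k _ => ha k).trans hA
  have h1 : ∑ k ∈ Finset.range (n + 1), ∑ m ∈ Finset.range k, a k * b m
      ≤ ∑ k ∈ Finset.range (n + 1), ∑ m ∈ Finset.range (n + 1), a k * b m := by
    refine Finset.sum_le_sum fun k hk => ?_
    refine Finset.sum_le_sum_of_subset_of_nonneg
      (Finset.range_mono (Finset.mem_range.1 hk).le) fun m _ _ => mul_nonneg (ha k) (hb m)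
  rw [← Finset.sum_mul_sum] at h1
  exact h1.trans (mul_le_mul hA hB (Finset.sum_nonneg fun k _ => hb k) hA0)

/-- Each of the four products is bounded by a product of two single sums: `3S`, `6`, `4` and `9`. -/
lemma sum_summableKernel_le {n : ℕ} (hn : 1 ≤ n) {S : ℝ}
    (hS : ∑ k ∈ Finset.range (n + 1), (k : ℝ) ^ (-(1 + η / 2)) ≤ S) :
    ∑ k ∈ Finset.range (n + 1), ∑ m ∈ Finset.range k, summableKernel η n k m ≤ 3 * S + 19 := by
  have hn0 : (0 : ℝ) < n := by exact_mod_cast hn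
  set x := √(n : ℝ) with hx
  have hx0 : 0 < x := by positivity
  have hx2 : x * x = n := Real.mul_self_sqrt hn0.le
  have hT := sum_range_one_div_mul_sqrt_le (n + 1)
  have hR := sum_range_one_div_sqrt_le n
  have p1 : ∀ k : ℕ, 0 ≤ 1 / ((k : ℝ) * √k) := fun k => by positivity
  have p2 : ∀ k : ℕ, 0 ≤ 1 / √(k : ℝ) := fun k => by positivity
  have h1 := sum_sum_range_le_of_prod n (a := fun k => (k : ℝ) ^ (-(1 + η / 2)))
    (fun k => by positivity) p1 hS hT
  have h2 := sum_sum_range_le_of_prod n p2 p1 hR hT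
  have h3 := sum_sum_range_le_of_prod n p2 p2 hR hR
  have h4 := sum_sum_range_le_of_prod n p1 p1 hT hT
  simp_rw [summableKernel, Finset.sum_add_distrib, ← Finset.mul_sum]
  simp_rw [← Finset.mul_sum] at h1 h2 h3 h4
  have h2' := mul_le_mul_of_nonneg_left h2 (show 0 ≤ 1 / x by positivity)
  have h3' := mul_le_mul_of_nonneg_left h3 (show 0 ≤ 1 / (n : ℝ) by positivity)
  have e2 : 1 / x * (2 * x * 3) = 6 := by field_simp; norm_num
  have e3 : 1 / (n : ℝ) * (2 * x * (2 * x)) = 4 := by rw [← hx2]; field_simp; norm_num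
  rw [e2] at h2'
  rw [e3] at h3'
  linarith

lemma sum_mul_hardyKernel_le {y : ℕ → ℝ} (hy : ∀ k, 0 ≤ y k) (hy0 : y 0 = 0) (n : ℕ) :
    ∑ k ∈ Finset.range (n + 1), ∑ m ∈ Finset.range k, (y k + y m) * hardyKernel k m
      ≤ 14 * ∑ k ∈ Finset.range (n + 1), y k / k := by
  simp_rw [hardyKernel, mul_add, Finset.sum_add_distrib]
  have h1 := sum_hardy_le hy n
  have h2 := sum_near_diagonal_le hy hy0 n
  linarith

lemma hardyKernel_nonneg (k m : ℕ) : 0 ≤ hardyKernel k m := by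
  rw [hardyKernel]; positivity

lemma summableKernel_nonneg (η : ℝ) (n k m : ℕ) : 0 ≤ summableKernel η n k m := by
  rw [summableKernel]; positivity

/-- The variance bound when only small subtrees contribute. -/
lemma WalkBounds.exists_variance_size_le_of_small (W : WalkBounds p C η) :
    ∃ K : ℝ, 0 < K ∧ ∀ n ∈ gwSizes p, ∀ (μ : ℕ → ℝ) (A D : ℝ), (∀ k, |μ k| ≤ A) →
      (∀ k, k ∉ gwSizes p → μ k = 0) → (∀ k, n < 4 * k → μ k = 0) →
      ∑ k ∈ Finset.range (n + 1), μ k ^ 2 / k ≤ D →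
      condMean p (fun T => additive (fun T => μ T.size) T ^ 2) n
        - condMean p (additive fun T => μ T.size) n ^ 2 ≤ K * n * (A ^ 2 + D) := by
  have hC := W.C_pos
  obtain ⟨S, hS0, hS⟩ := exists_sum_rpow_le (s := 1 + η / 2) (by linarith [W.η_pos])
  -- The coefficient of `A ^ 2` is `10 · 3 + 2 · 20 (3S + 19)`; that of `D` is `2 · 20 · 14 = 560`,
  -- which is smaller.
  refine ⟨C ^ 5 * (790 + 120 * S), by positivity, fun n hn μ A D hA hoff hsupp hD => ?_⟩
  have hn1 := pos_of_mem_gwSizes hn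
  have hn0 : (0 : ℝ) < n := by exact_mod_cast hn1
  have hp0 := (mem_gwSizes_iff p n).1 hn
  have hA0 : 0 ≤ A := (abs_nonneg _).trans (hA 0)
  have hμA : ∀ k, μ k ^ 2 ≤ A ^ 2 := fun k => sq_le_sq.2 (by rw [abs_of_nonneg hA0]; exact hA k)
  have hμ0 : μ 0 = 0 := hoff 0 fun h => absurd (pos_of_mem_gwSizes h) (by norm_num)
  set x := √(n : ℝ) with hx
  have hx0 : 0 < x := by positivity
  set Q := C ^ 4 / x with hQ
  have hQ0 : 0 ≤ Q := by positivity
  have hdiag : ∀ k, μ k ^ 2 * diagonalTerm p n k ≤ 10 * Q * A ^ 2 * (1 / (k * √k)) := by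
    intro k
    by_cases hk : k ∈ gwSizes p ∧ 4 * k ≤ n
    · have h1 := W.abs_diagonal_le hn hk.1 hk.2
      calc _ ≤ A ^ 2 * (10 * C ^ 4 / x * (1 / (k * √k))) :=
            (mul_le_mul_of_nonneg_left ((le_abs_self _).trans h1) (sq_nonneg _)).trans
              (mul_le_mul_of_nonneg_right (hμA k) (by positivity))
        _ = _ := by rw [hQ]; ring
    · have : μ k = 0 := by
        by_contra h
        exact hk ⟨by_contra fun h' => h (hoff k h'), not_lt.1 fun h' => h (hsupp k h')⟩
      rw [this]
      simp only [ne_eq, OfNat.ofNat_ne_zero, not_false_eq_true, zero_pow, zero_mul]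
      positivity
  -- The product of the two values is bounded by `A ^ 2` on the summable kernel and by the sum of
  -- squares on the Hardy kernel.
  have hoffd : ∀ k m, m < k → μ k * μ m * offDiagonalTerm p n k m
      ≤ 20 * Q * (A ^ 2 * summableKernel η n k m + (μ k ^ 2 + μ m ^ 2) * hardyKernel k m) := by
    intro k m hmk
    have s0 := summableKernel_nonneg η n k m
    have s1 := hardyKernel_nonneg k m
    by_cases hk : (k ∈ gwSizes p ∧ 4 * k ≤ n) ∧ m ∈ gwSizes p
    · have h1 : |offDiagonalTerm p n k m| ≤ _ := W.abs_offDiagonal_le hn hk.1.1 hk.2 hmk hk.1.2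
      refine (le_abs_self _).trans ?_
      rw [abs_mul, abs_mul]
      have i1 : |μ k| * |μ m| ≤ A ^ 2 := by
        rw [sq]; exact mul_le_mul (hA k) (hA m) (abs_nonneg _) hA0
      have i2 : |μ k| * |μ m| ≤ μ k ^ 2 + μ m ^ 2 := by
        rw [← sq_abs (μ k), ← sq_abs (μ m)]
        nlinarith [sq_nonneg (|μ k| - |μ m|), sq_nonneg (|μ k|), sq_nonneg (|μ m|)]
      calc _ ≤ |μ k| * |μ m| * (20 * C ^ 4 / x * (summableKernel η n k m + hardyKernel k m)) := by
            gcongr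
        _ = 20 * Q * (|μ k| * |μ m| * summableKernel η n k m
              + |μ k| * |μ m| * hardyKernel k m) := by rw [hQ]; ring
        _ ≤ _ := by gcongr
    · have : μ k * μ m = 0 := by
        by_contra h
        exact hk ⟨⟨by_contra fun h' => h (by rw [hoff k h', zero_mul]),
          not_lt.1 fun h' => h (by rw [hsupp k h', zero_mul])⟩,
          by_contra fun h' => h (by rw [hoff m h', mul_zero])⟩
      rw [this, zero_mul]
      positivity
  have h1 : ∑ k ∈ Finset.range (n + 1), μ k ^ 2 * diagonalTerm p n k ≤ 10 * Q * A ^ 2 * 3 := by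
    refine (Finset.sum_le_sum fun k _ => hdiag k).trans ?_
    rw [← Finset.mul_sum]
    have := sum_range_one_div_mul_sqrt_le (n + 1)
    gcongr
  have h2 : ∑ k ∈ Finset.range (n + 1), ∑ m ∈ Finset.range k,
      μ k * μ m * offDiagonalTerm p n k m ≤ 20 * Q * (A ^ 2 * (3 * S + 19) + 14 * D) := by
    refine (Finset.sum_le_sum fun k _ => Finset.sum_le_sum fun m hm =>
      hoffd k m (Finset.mem_range.1 hm)).trans ?_
    simp_rw [← Finset.mul_sum, Finset.sum_add_distrib, ← Finset.mul_sum]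
    have i1 := sum_summableKernel_le hn1 (hS (n + 1))
    have i2 := sum_mul_hardyKernel_le (y := fun k => μ k ^ 2) (fun k => sq_nonneg _)
      (by rw [hμ0]; norm_num) n
    gcongr
    linarith
  have hD0 : 0 ≤ D := (Finset.sum_nonneg fun k _ => by positivity).trans hD
  have h3 : treeSum p (fun T => additive (fun T => μ T.size) T ^ 2) n
        - treeSum p (additive fun T => μ T.size) n ^ 2 / sizeProb p n
      ≤ Q * ((790 + 120 * S) * (A ^ 2 + D)) := by
    rw [treeSum_additive_size_sq_sub hsupp]
    have j : 0 ≤ Q * ((230 + 120 * S) * D) := by positivity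
    linarith
  have h4 : Q ≤ C ^ 5 * (n * sizeProb p n) := by
    have := mul_le_mul_of_nonneg_left (W.one_div_sqrt_le hn) (show 0 ≤ C ^ 4 by positivity)
    rw [hQ, div_eq_mul_one_div]
    linarith
  have h5 : (condMean p (fun T => additive (fun T => μ T.size) T ^ 2) n
        - condMean p (additive fun T => μ T.size) n ^ 2) * sizeProb p n
      ≤ C ^ 5 * (790 + 120 * S) * n * (A ^ 2 + D) * sizeProb p n := by
    calc _ = treeSum p (fun T => additive (fun T => μ T.size) T ^ 2) n
        - treeSum p (additive fun T => μ T.size) n ^ 2 / sizeProb p n := by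
          rw [condMean, condMean]; field_simp
      _ ≤ _ := h3
      _ ≤ C ^ 5 * (n * sizeProb p n) * ((790 + 120 * S) * (A ^ 2 + D)) := by gcongr
      _ = _ := by ring
  exact le_of_mul_le_mul_right h5 hp0

end PlaneTree

/-! ### General toll functions: centering and recombination. -/

namespace PlaneTree

variable {p : PMF ℕ} {C η : ℝ}

/-- The variance of `g` on the conditioned Galton-Watson tree with `n` nodes. -/
noncomputable def condVar (p : PMF ℕ) (g : PlaneTree → ℝ) (n : ℕ) : ℝ :=
  condMean p (fun T => (g T - condMean p g n) ^ 2) n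

lemma condVar_eq {n : ℕ} (hn : n ∈ gwSizes p) (g : PlaneTree → ℝ) :
    condVar p g n = condMean p (fun T => g T ^ 2) n - condMean p g n ^ 2 := by
  rw [condVar, condMean_sub_sq p hn]; ring

lemma condVar_le_condMean_sub_sq {n : ℕ} (hn : n ∈ gwSizes p) (g : PlaneTree → ℝ) (c : ℝ) :
    condVar p g n ≤ condMean p (fun T => (g T - c) ^ 2) n := by
  rw [condVar_eq hn, condMean_sub_sq p hn]
  nlinarith [sq_nonneg (condMean p g n - c)]

/-- Center the sum at the mean of `h` alone and use `(x + y)² ≤ 2x² + 2y²`; thus a raw second moment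
suffices for `g`. -/
lemma condVar_add_le {n : ℕ} (hn : n ∈ gwSizes p) (g h : PlaneTree → ℝ) :
    condVar p (fun T => g T + h T) n
      ≤ 2 * condMean p (fun T => g T ^ 2) n + 2 * condVar p h n := by
  refine (condVar_le_condMean_sub_sq hn _ (condMean p h n)).trans ?_
  have hp := (mem_gwSizes_iff p n).1 hn
  simp only [condVar, condMean]
  rw [← mul_div_assoc, ← mul_div_assoc, ← add_div, ← treeSum_const_mul, ← treeSum_const_mul, ← treeSum_add]
  refine div_le_div_of_nonneg_right (treeSum_mono p fun T _ => ?_) hp.le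
  nlinarith [sq_nonneg (g T - (h T - treeSum p h n / sizeProb p n))]

lemma additive_add (f g : PlaneTree → ℝ) (T : PlaneTree) :
    additive (fun T => f T + g T) T = additive f T + additive g T :=
  List.sum_map_add

lemma WalkBounds.exists_condVar_additive_size_le (W : WalkBounds p C η) :
    ∃ K : ℝ, 0 < K ∧ ∀ n ∈ gwSizes p, ∀ (μ : ℕ → ℝ) (A D : ℝ), (∀ k, |μ k| ≤ A) →
      (∀ k, k ∉ gwSizes p → μ k = 0) → ∑ k ∈ Finset.range (n + 1), μ k ^ 2 / k ≤ D →
      condVar p (additive fun T => μ T.size) n ≤ K * n * (A ^ 2 + D) := by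
  have hC := W.C_pos
  obtain ⟨K, hK0, hK⟩ := W.exists_variance_size_le_of_small
  refine ⟨2 * (768 * C ^ 4) + 2 * K, by positivity, fun n hn μ A D hA hoff hD => ?_⟩
  have hA0 : 0 ≤ A := (abs_nonneg _).trans (hA 0)
  have hD0 : 0 ≤ D := (Finset.sum_nonneg fun k _ => by positivity).trans hD
  -- Orders above `n/4` have a small enough second moment; the others need the variance bound with
  -- its cancellations.
  set μ₁ : ℕ → ℝ := fun k => if n < 4 * k then μ k else 0 with hμ₁
  set μ₂ : ℕ → ℝ := fun k => if n < 4 * k then 0 else μ k with hμ₂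
  have e : additive (fun T => μ T.size)
      = fun T => additive (fun T => μ₁ T.size) T + additive (fun T => μ₂ T.size) T := by
    ext T
    rw [← additive_add]
    congr 1
    ext T
    simp only [hμ₁, hμ₂]
    split_ifs <;> simp
  have h1 : condMean p (fun T => additive (fun T => μ₁ T.size) T ^ 2) n
      ≤ 768 * C ^ 4 * A ^ 2 * n := by
    refine W.condMean_additive_sq_le_of_large hn (fun k => ?_) fun k hk => if_neg (by omega)
    simp only [hμ₁]
    split_ifs
    · exact hA k
    · rwa [abs_zero]
  have h2 : condVar p (additive fun T => μ₂ T.size) n ≤ K * n * (A ^ 2 + D) := by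
    rw [condVar_eq hn]
    refine hK n hn μ₂ A D (fun k => ?_) (fun k hk => ?_) (fun k hk => if_pos hk)
      (le_trans (Finset.sum_le_sum fun k _ => ?_) hD)
    · simp only [hμ₂]
      split_ifs
      · rwa [abs_zero]
      · exact hA k
    · simp only [hμ₂]
      rw [hoff k hk, ite_self]
    · simp only [hμ₂]
      split_ifs
      · have : 0 ≤ μ k ^ 2 / (k : ℝ) := by positivity
        simpa using this
      · exact le_rfl
  rw [e]
  refine (condVar_add_le hn _ _).trans ?_
  have : 0 ≤ 768 * C ^ 4 * D * n := by positivity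
  linarith

/-- The variance bound for general additive functionals. -/
lemma WalkBounds.exists_sqrt_condVar_additive_le (W : WalkBounds p C η) :
    ∃ K : ℝ, 0 < K ∧ ∀ n ∈ gwSizes p, ∀ (f : PlaneTree → ℝ) (A B D : ℝ),
      (∀ k ∈ gwSizes p, √(condMean p (fun T => f T ^ 2) k) ≤ A) →
      ∑ k ∈ Finset.range (n + 1), √(condVar p f k) / k ≤ B →
      ∑ k ∈ Finset.range (n + 1), condMean p f k ^ 2 / k ≤ D →
      √(condVar p (additive f) n) ≤ K * √n * (A + B + √D) := by
  have hC := W.C_pos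
  obtain ⟨K, hK0, hK⟩ := W.exists_condVar_additive_size_le
  refine ⟨√(2 * (16 * C ^ 3) ^ 2 + 2 * K), by positivity, fun n hn f A B D hA hB hD => ?_⟩
  have hn0 : (0 : ℝ) ≤ n := by positivity
  have hA0 : 0 ≤ A := (Real.sqrt_nonneg _).trans (hA n hn)
  have hB0 : 0 ≤ B := (Finset.sum_nonneg fun k _ => by positivity).trans hB
  have hD0 : 0 ≤ D := (Finset.sum_nonneg fun k _ => by positivity).trans hD
  set μ : ℕ → ℝ := condMean p f with hμ
  -- Centering at each order: the second moment of `g` at order `k` is the variance of `f` there,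
  -- while `|μ k|` is bounded by the root mean square of `f`.
  set g : PlaneTree → ℝ := fun T => f T - μ T.size with hg
  have hg0 : ∀ k, treeSum p g k = 0 := by
    intro k
    rw [hg, treeSum_sub, treeSum_size, hμ, condMean_mul_sizeProb, sub_self]
  have hg2 : ∀ k, condMean p (fun T => g T ^ 2) k = condVar p f k := by
    intro k
    rw [condVar, condMean, condMean]
    congr 1
    exact treeSum_congr p fun T hT => by simp only [hg]; rw [hT]
  have hgle : ∀ k ∈ gwSizes p, condVar p f k ≤ condMean p (fun T => f T ^ 2) k := by
    intro k hk
    rw [condVar_eq hk]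
    linarith [sq_nonneg (condMean p f k)]
  have hμA : ∀ k, |μ k| ≤ A := by
    intro k
    by_cases hk : k ∈ gwSizes p
    · refine le_trans ?_ (hA k hk)
      rw [← Real.sqrt_sq_eq_abs]
      apply Real.sqrt_le_sqrt
      have h1 := condVar_eq hk f
      have h2 : 0 ≤ condVar p f k := condMean_nonneg (fun T => sq_nonneg _) k
      linarith
    · rw [hμ, condMean_eq_zero hk, abs_zero]; exact hA0
  have h1 : √(condMean p (fun T => additive g T ^ 2) n) ≤ 16 * C ^ 3 * √n * (A + B) := by
    refine W.sqrt_condMean_additive_le hg0 (fun k _ => ?_) ?_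
    · rw [hg2]
      by_cases hk : k ∈ gwSizes p
      · exact (Real.sqrt_le_sqrt (hgle k hk)).trans (hA k hk)
      · rw [condVar, condMean_eq_zero hk, Real.sqrt_zero]; exact hA0
    · simp_rw [hg2]; exact hB
  have h2 := hK n hn μ A D hμA (fun k hk => condMean_eq_zero hk f) hD
  have e : additive f = fun T => additive g T + additive (fun T => μ T.size) T := by
    ext T
    rw [← additive_add]
    congr 1
    ext T
    simp only [hg, sub_add_cancel]
  have h3 : condMean p (fun T => additive g T ^ 2) n ≤ (16 * C ^ 3) ^ 2 * n * (A + B) ^ 2 := by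
    have := Real.sqrt_le_left (x := condMean p (fun T => additive g T ^ 2) n)
      (y := 16 * C ^ 3 * √n * (A + B)) (by positivity)
    rw [this, mul_pow, mul_pow, Real.sq_sqrt hn0] at h1
    exact h1
  have h4 := condVar_add_le hn (additive g) (additive fun T => μ T.size)
  rw [← e] at h4
  rw [← Real.sqrt_mul (by positivity), Real.sqrt_le_left (by positivity), mul_pow,
    Real.sq_sqrt (by positivity)]
  have hs : 0 ≤ √D := Real.sqrt_nonneg D
  have hDs : D = √D ^ 2 := (Real.sq_sqrt hD0).symm
  have i1 : (A + B) ^ 2 ≤ (A + B + √D) ^ 2 :=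
    pow_le_pow_left₀ (by positivity) (by linarith) 2
  have i2 : A ^ 2 + D ≤ (A + B + √D) ^ 2 := by
    nlinarith [mul_nonneg hA0 hB0, mul_nonneg hA0 hs, mul_nonneg hB0 hs, sq_nonneg B]
  have j1 := mul_le_mul_of_nonneg_left i1 (show 0 ≤ (16 * C ^ 3) ^ 2 * n by positivity)
  have j2 := mul_le_mul_of_nonneg_left i2 (show 0 ≤ K * n by positivity)
  linarith

lemma condMean_congr {g h : PlaneTree → ℝ} {n : ℕ} (H : ∀ T, T.size = n → g T = h T) :
    condMean p g n = condMean p h n := by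
  rw [condMean, condMean, treeSum_congr p H]

lemma restrict_of_size_eq {f : PlaneTree → ℝ} {k : ℕ} {T : PlaneTree} (h : T.size = k) :
    restrict f k T = f T := if_pos h

lemma condMean_restrict (f : PlaneTree → ℝ) (k : ℕ) :
    condMean p (restrict f k) k = condMean p f k :=
  condMean_congr fun _ hT => restrict_of_size_eq hT

lemma condMean_restrict_sq (f : PlaneTree → ℝ) (k : ℕ) :
    condMean p (fun T => restrict f k T ^ 2) k = condMean p (fun T => f T ^ 2) k :=
  condMean_congr fun T hT => by rw [restrict_of_size_eq hT]

lemma condVar_restrict (f : PlaneTree → ℝ) (k : ℕ) :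
    condVar p (restrict f k) k = condVar p f k := by
  rw [condVar, condMean_restrict]
  exact condMean_congr fun T hT => by rw [restrict_of_size_eq hT]

/-- Passes from the extended sum over possible orders to real partial sums over all orders, which
agree because the terms vanish elsewhere. -/
lemma sum_range_le_toReal_tsum {s : Set ℕ} {h : ℕ → ℝ} (h0 : ∀ k, 0 ≤ h k)
    (hs : ∀ k, k ∉ s → h k = 0) (htop : ∑' k : s, ENNReal.ofReal (h k) ≠ ⊤) (n : ℕ) :
    ∑ k ∈ Finset.range n, h k ≤ (∑' k : s, ENNReal.ofReal (h k)).toReal := by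
  rw [← ENNReal.ofReal_le_iff_le_toReal htop, ENNReal.ofReal_sum_of_nonneg fun k _ => h0 k,
    tsum_subtype s fun k => ENNReal.ofReal (h k)]
  have : s.indicator (fun k => ENNReal.ofReal (h k)) = fun k => ENNReal.ofReal (h k) := by
    ext k
    by_cases hk : k ∈ s
    · rw [Set.indicator_of_mem hk]
    · rw [Set.indicator_of_notMem hk, hs k hk, ENNReal.ofReal_zero]
  rw [this]
  exact ENNReal.sum_le_tsum _

end PlaneTree

/-! ### The theorem in extended nonnegative reals. -/

theorem mainTheorem7 (p : PMF ℕ) (δ : ℝ) (hδ : 0 < δ)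
    (hmean : ∫ k : ℕ, (k : ℝ) ∂p.toMeasure = 1)
    (hvar : 0 < Var[fun k : ℕ => (k : ℝ); p.toMeasure])
    (hmom : Integrable (fun k : ℕ => (k : ℝ) ^ (2 + δ)) p.toMeasure) :
    ∃ C : ℝ≥0, ∀ (f : PlaneTree → ℝ) (n : ℕ), n ∈ gwSizes p →
      ENNReal.ofReal (√(Var[PlaneTree.additive f; condGWLaw p n])) ≤
        (C : ℝ≥0∞) * ENNReal.ofReal (√(n : ℝ)) *
          ((⨆ k : gwSizes p,
              ENNReal.ofReal (√(∫ T, (PlaneTree.restrict f k T) ^ 2 ∂condGWLaw p k)))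
            + (∑' k : gwSizes p,
              ENNReal.ofReal (√(Var[PlaneTree.restrict f k; condGWLaw p k]) / (k : ℕ)))
            + (∑' k : gwSizes p,
              ENNReal.ofReal ((∫ T, PlaneTree.restrict f k T ∂condGWLaw p k) ^ 2 / (k : ℕ)))
                ^ (1 / 2 : ℝ)) := by
  obtain ⟨d, c, σ2, η, K₀, H⟩ := PlaneTree.exists_charBounds p hδ hmean hvar hmom
  obtain ⟨C, W⟩ := H.exists_walkBounds
  obtain ⟨K, hK0, hK⟩ := W.exists_sqrt_condVar_additive_le
  refine ⟨K.toNNReal, fun f n hn => ?_⟩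
  have hKe : (K.toNNReal : ℝ≥0∞) = ENNReal.ofReal K := rfl
  have hv : ∀ (g : PlaneTree → ℝ) (k : ℕ), Var[g; condGWLaw p k] = PlaneTree.condVar p g k :=
    fun g k => PlaneTree.variance_condGWLaw p g k
  simp_rw [hv, PlaneTree.integral_condGWLaw, PlaneTree.condVar_restrict, PlaneTree.condMean_restrict, PlaneTree.condMean_restrict_sq]
  rw [hKe]
  have hn0 : (0 : ℝ) < n := by exact_mod_cast PlaneTree.pos_of_mem_gwSizes hn
  set a := ⨆ k : gwSizes p, ENNReal.ofReal (√(PlaneTree.condMean p (fun T => f T ^ 2) k)) with ha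
  set b := ∑' k : gwSizes p, ENNReal.ofReal (√(PlaneTree.condVar p f k) / (k : ℕ)) with hb
  set q := ∑' k : gwSizes p, ENNReal.ofReal (PlaneTree.condMean p f k ^ 2 / (k : ℕ)) with hq
  -- Needed because `0 * ⊤ = 0`: when one of the three terms is infinite the right-hand side must
  -- really be `⊤`.
  have hpre : ENNReal.ofReal K * ENNReal.ofReal √(n : ℝ) ≠ 0 := by
    rw [← ENNReal.ofReal_mul hK0.le]
    exact (ENNReal.ofReal_pos.2 (by positivity)).ne'
  by_cases hfin : a ≠ ⊤ ∧ b ≠ ⊤ ∧ q ≠ ⊤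
  · obtain ⟨ha', hb', hq'⟩ := hfin
    have h := hK n hn f a.toReal b.toReal q.toReal (fun k hk => ?_) ?_ ?_
    · refine (ENNReal.ofReal_le_ofReal h).trans (le_of_eq ?_)
      rw [Real.sqrt_eq_rpow q.toReal, ENNReal.ofReal_mul (by positivity),
        ENNReal.ofReal_mul hK0.le, ENNReal.ofReal_add (by positivity) (by positivity),
        ENNReal.ofReal_add (by positivity) (by positivity), ENNReal.ofReal_toReal ha',
        ENNReal.ofReal_toReal hb',
        ← ENNReal.ofReal_rpow_of_nonneg ENNReal.toReal_nonneg (by norm_num),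
        ENNReal.ofReal_toReal hq']
    · rw [← ENNReal.ofReal_le_iff_le_toReal ha', ha]
      exact le_iSup (fun k : gwSizes p =>
        ENNReal.ofReal (√(PlaneTree.condMean p (fun T => f T ^ 2) k))) ⟨k, hk⟩
    · refine PlaneTree.sum_range_le_toReal_tsum (h := fun k => √(PlaneTree.condVar p f k) / k)
        (fun k => by positivity) (fun k hk => ?_) hb' _
      simp only [PlaneTree.condVar]
      rw [PlaneTree.condMean_eq_zero hk, Real.sqrt_zero, zero_div]
    · refine PlaneTree.sum_range_le_toReal_tsum (h := fun k => PlaneTree.condMean p f k ^ 2 / k)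
        (fun k => by positivity) (fun k hk => ?_) hq' _
      rw [PlaneTree.condMean_eq_zero hk, zero_pow two_ne_zero, zero_div]
  · have : a + b + q ^ (1 / 2 : ℝ) = ⊤ := by
      by_contra h
      simp only [ENNReal.add_eq_top, not_or] at h
      refine hfin ⟨h.1.1, h.1.2, fun h' => h.2 ?_⟩
      rw [h', ENNReal.top_rpow_of_pos (by norm_num)]
    rw [this, ENNReal.mul_top hpre]
    exact le_top
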